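/- A linear quantum cellular automaton (LQCA) is a tuple $A=(\Sigma,q,N,\delta)$, where $\Sigma$ is a finite set of states, $q\in\Sigma$ is the quiescent state, $N=(a_1<\dots<a_r)$ with $r\ge 1$ is a sequence of integers (the neighborhood), and $\delta:\Sigma^r\to\mathbb C^\Sigma$ is the local transition function, such that $\|\delta(w)\|>0$ for every $w\in\Sigma^r$, $[\delta(q,\dots,q)](q)=1$ and $[\delta(q,\dots,q)](x)=0$ for $x\ne q$. It is simple if $\{a_1,\dots,a_r\}$ is an interval of $\mathbb Z$. Let $\mathcal C_A$ be the set of all $c\in\Sigma^{\mathbb Z}$ with $c_i\neq q$ for only finitely many $i$. The time evolution operator of $A$ is given by the matrix $$U_A(d,c)=\prod_{i\in\mathbb Z}[\delta(c_{i+a_1},\dots,c_{i+a_r})](d_i)\qquad(c,d\in\mathcal C_A),$$ in which only finitely many factors differ from $1$. $A$ is well-formed if $U_A$ preserves the norm of $\ell_2(\mathcal C_A)$, i.e. for every $u\in\ell_2(\mathcal C_A)$ the vector $U_Au=\big(\sum_{c}U_A(d,c)\,u(c)\big)_{d}$ is well defined, belongs to $\ell_2(\mathcal C_A)$ and satisfies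 $\|U_Au\|=\|u\|$. The model of computation is the algebraic one: a unit-cost random access machine that stores a complex number or an integer in one memory cell, and in one unit of time performs an arithmetic operation ($+,-,\times,/$, complex conjugation) on complex numbers, compares two complex numbers for equality or their real parts for order, adds, subtracts or compares two integers, loads an integer constant, accesses (possibly indirectly) a memory cell, or jumps. An LQCA is given to the machine by the numbers $|\Sigma|$, $r$, $q$ and $a_1,\dots,a_r$ (for an arbitrary numbering of $\Sigma$) and the table of the $n=|\Sigma|^{r+1}$ complex values $[\delta(x_1,\dots,x_r)](y)$; $n$ is called the size of $A$. Theorem. There exists an algorithm (a single program of this machine) which takes a simple LQCA $A$ as input and decides whether $A$ is well-formed. The complexity of the algorithm is $O(n^2)$: there is a constant $C$ such that on every simple LQCA of size $n$ it stops with the correct answer after at most $C n^2$ steps. -/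

import Mathlib

/-! ### Linear quantum cellular automata -/

/-- A linear quantum cellular automaton with finite state set `S`: the quiescent state `q`, the
neighborhood `N = (a_1 < ... < a_r)` with `r ≥ 1`, and the local transition function
`δ : S ^ r → ℂ ^ S`, whose values have positive norm and which maps `(q, ..., q)` to the
superposition concentrated in `q`. -/
structure LQCA (S : Type*) [Fintype S] where
  /-- the quiescent state -/
  q : S
  /-- the size of the neighborhood -/
  r : ℕ
  one_le_r : 1 ≤ r
  /-- the neighborhood -/
  N : Fin r → ℤ
  N_strictMono : StrictMono N
  /-- the local transition function -/
  δ : (Fin r → S) → EuclideanSpace ℂ S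
  norm_δ_pos : ∀ w, 0 < ‖δ w‖
  δ_quiescent_self : δ (fun _ => q) q = 1
  δ_quiescent_ne : ∀ x, x ≠ q → δ (fun _ => q) x = 0

namespace LQCA

variable {S : Type*} [Fintype S]

/-- The automaton is simple if the elements of its neighborhood form an interval of `ℤ`. -/
def IsSimple (A : LQCA S) : Prop :=
  ∃ j k : ℤ, Set.range A.N = Set.Icc j k

/-- The (finite) configurations: maps `ℤ → S` that are quiescent at all but finitely many cells. -/
def Config (A : LQCA S) : Type _ :=
  {c : ℤ → S // {i | c i ≠ A.q}.Finite}

/-- `c_{i+N}`, the states of the neighbors of cell `i` in the configuration `c`. -/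
def Config.nbhd {A : LQCA S} (c : A.Config) (i : ℤ) : Fin A.r → S :=
  fun k => c.1 (i + A.N k)

/-- The amplitude `U_A(d, c)` with which the automaton enters `d` from `c` in one step, a product
over all cells with only finitely many factors different from `1`. -/
noncomputable def amplitude (A : LQCA S) (d c : A.Config) : ℂ :=
  ∏ᶠ i : ℤ, A.δ (c.nbhd i) (d.1 i)

/-- Only finitely many factors of the amplitude are different from `1`. -/
theorem finite_mulSupport_amplitude (A : LQCA S) (d c : A.Config) :
    (Function.mulSupport fun i : ℤ => A.δ (c.nbhd i) (d.1 i)).Finite := by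
  have h1 : (⋃ k : Fin A.r, (fun i : ℤ => i + A.N k) ⁻¹' {i | c.1 i ≠ A.q}).Finite :=
    Set.finite_iUnion fun k => c.2.preimage (add_left_injective (A.N k)).injOn
  refine (h1.union d.2).subset fun i hi => ?_
  by_contra hcon
  simp only [Set.mem_union, Set.mem_iUnion, Set.mem_preimage, Set.mem_ofPred_eq, not_or,
    not_exists, not_not] at hcon
  apply hi
  have h2 : c.nbhd i = fun _ => A.q := funext hcon.1
  simp only [h2, hcon.2, A.δ_quiescent_self]

/-- The automaton is well-formed if its time evolution operator preserves the norm of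
`ℓ₂(Config)`: for every `u` in `ℓ₂`, the vector with entries `∑_c U_A(d, c) u(c)` is well defined,
lies in `ℓ₂`, and has the norm of `u`. -/
def WellFormed (A : LQCA S) : Prop :=
  ∀ u : lp (fun _ : A.Config => ℂ) 2, ∃ v : lp (fun _ : A.Config => ℂ) 2,
    (∀ d : A.Config, HasSum (fun c : A.Config => A.amplitude d c * u c) (v d)) ∧ ‖v‖ = ‖u‖

/-- The size `|S| ^ (r + 1)` of the automaton, i.e. the size of the table of `δ`. -/
def size (A : LQCA S) : ℕ := Fintype.card S ^ (A.r + 1)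

/-- The integer part of the description of an automaton whose states are numbered by `e`: the
number of states, the size of the neighborhood, the quiescent state, and the neighborhood. -/
def encodeInts (A : LQCA S) (e : S ≃ Fin (Fintype.card S)) : List ℤ :=
  [(Fintype.card S : ℤ), (A.r : ℤ), ((e A.q : ℕ) : ℤ)] ++ List.ofFn A.N

/-- The table of `δ`. If the states are numbered by `e` and `s` is their number, then the amplitude
`[δ(x_1, ..., x_r)](y)` is the entry at position `e y + e x_1 * s + ... + e x_r * s ^ r`. -/
def encodeTable (A : LQCA S) (e : S ≃ Fin (Fintype.card S)) : List ℂ :=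
  List.ofFn fun k : Fin (Fintype.card S ^ (A.r + 1)) =>
    A.δ (fun i => e.symm (finFunctionFinEquiv.symm k i.succ))
      (e.symm (finFunctionFinEquiv.symm k 0))

end LQCA

/-! ### The algebraic model of computation

A random access machine with two memories, one whose cells hold integers (used for indices and
addresses) and one whose cells hold complex numbers. Both are addressed by integers. Every
instruction takes one unit of time. -/

namespace AlgebraicRAM

/-- The instructions. `I` is the integer memory and `X` is the memory for complex numbers. All
operands are constants of the program. -/
inductive Instr where
  /-- `I[d] := k` -/
  | iconst (d k : ℤ)
  /-- `I[d] := I[a] + I[b]` -/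
  | iadd (d a b : ℤ)
  /-- `I[d] := I[a] - I[b]` -/
  | isub (d a b : ℤ)
  /-- `I[d] := I[I[a]]` -/
  | iload (d a : ℤ)
  /-- `I[I[a]] := I[b]` -/
  | istore (a b : ℤ)
  /-- `X[d] := k` -/
  | xconst (d k : ℤ)
  /-- `X[d] := X[a] + X[b]` -/
  | xadd (d a b : ℤ)
  /-- `X[d] := X[a] - X[b]` -/
  | xsub (d a b : ℤ)
  /-- `X[d] := X[a] * X[b]` -/
  | xmul (d a b : ℤ)
  /-- `X[d] := X[a] / X[b]` (and `0` if `X[b] = 0`) -/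
  | xdiv (d a b : ℤ)
  /-- `X[d]` becomes the complex conjugate of `X[a]` -/
  | xconj (d a : ℤ)
  /-- `X[d] := X[I[a]]` -/
  | xload (d a : ℤ)
  /-- `X[I[a]] := X[b]` -/
  | xstore (a b : ℤ)
  /-- go to instruction `l` -/
  | jump (l : ℕ)
  /-- go to instruction `l` if `I[a] ≤ I[b]` -/
  | ijumpLE (a b : ℤ) (l : ℕ)
  /-- go to instruction `l` if `X[a] = X[b]` -/
  | xjumpEq (a b : ℤ) (l : ℕ)
  /-- go to instruction `l` if the real part of `X[a]` is at most that of `X[b]` -/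
  | xjumpLE (a b : ℤ) (l : ℕ)
  /-- stop with the answer `b` -/
  | halt (b : Bool)

/-- A program is a finite list of instructions, numbered from `0`. -/
abbrev Program := List Instr

/-- A state of the machine: the number of the next instruction and the contents of the memories. -/
structure State where
  /-- number of the next instruction -/
  pc : ℕ
  /-- the integer memory -/
  I : ℤ → ℤ
  /-- the memory for complex numbers -/
  X : ℤ → ℂ

namespace State

/-- Write `k` to cell `d` of the integer memory and go to the next instruction. -/
def writeI (σ : State) (d k : ℤ) : State :=
  { pc := σ.pc + 1, I := Function.update σ.I d k, X := σ.X }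

/-- Write `z` to cell `d` of the memory for complex numbers and go to the next instruction. -/
def writeX (σ : State) (d : ℤ) (z : ℂ) : State :=
  { pc := σ.pc + 1, I := σ.I, X := Function.update σ.X d z }

open Classical in
/-- Go to instruction `l` if `p` holds, and to the next instruction otherwise. -/
noncomputable def branch (σ : State) (p : Prop) (l : ℕ) : State :=
  { pc := if p then l else σ.pc + 1, I := σ.I, X := σ.X }

end State

/-- The effect of one instruction. -/
noncomputable def Instr.run : Instr → State → State
  | .iconst d k, σ => σ.writeI d k
  | .iadd d a b, σ => σ.writeI d (σ.I a + σ.I b)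
  | .isub d a b, σ => σ.writeI d (σ.I a - σ.I b)
  | .iload d a, σ => σ.writeI d (σ.I (σ.I a))
  | .istore a b, σ => σ.writeI (σ.I a) (σ.I b)
  | .xconst d k, σ => σ.writeX d (k : ℂ)
  | .xadd d a b, σ => σ.writeX d (σ.X a + σ.X b)
  | .xsub d a b, σ => σ.writeX d (σ.X a - σ.X b)
  | .xmul d a b, σ => σ.writeX d (σ.X a * σ.X b)
  | .xdiv d a b, σ => σ.writeX d (σ.X a / σ.X b)
  | .xconj d a, σ => σ.writeX d ((starRingEnd ℂ) (σ.X a))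
  | .xload d a, σ => σ.writeX d (σ.X (σ.I a))
  | .xstore a b, σ => σ.writeX (σ.I a) (σ.X b)
  | .jump l, σ => σ.branch True l
  | .ijumpLE a b l, σ => σ.branch (σ.I a ≤ σ.I b) l
  | .xjumpEq a b l, σ => σ.branch (σ.X a = σ.X b) l
  | .xjumpLE a b l, σ => σ.branch ((σ.X a).re ≤ (σ.X b).re) l
  | .halt _, σ => σ

/-- The memory whose cells `0, 1, 2, ...` hold the entries of the list and whose other cells
hold `0`. -/
def memoryOf {α : Type} [Zero α] (l : List α) (k : ℤ) : α :=
  if 0 ≤ k then l.getD k.toNat 0 else 0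

/-- The initial state on the input consisting of a list of integers and a list of complex
numbers. -/
def initial (ints : List ℤ) (nums : List ℂ) : State :=
  { pc := 0, I := memoryOf ints, X := memoryOf nums }

namespace Program

/-- One step of the program. The machine is stuck, without an answer, if there is no next
instruction. -/
noncomputable def step (P : Program) (σ : State) : State :=
  match P[σ.pc]? with
  | none => σ
  | some i => i.run σ

/-- On the given input, the program stops with the answer `b` after at most `t` steps. -/
def AnswersWithin (P : Program) (ints : List ℤ) (nums : List ℂ) (t : ℕ) (b : Bool) : Prop :=
  ∃ k ≤ t, P[((step P)^[k] (initial ints nums)).pc]? = some (Instr.halt b)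

end Program

end AlgebraicRAM

/-! ### Orthonormality of the columns of the time evolution operator. -/

namespace LQCA

open scoped ComplexConjugate InnerProductSpace

variable {S : Type*} [Fintype S]

/-! Only finitely many cells of a configuration have a nonquiescent neighborhood, so the inner
product of the columns of `c` and `c'` factors: it is the product over all cells of the local inner
products `gram (c.nbhd i) (c'.nbhd i)` (`hasSum_conj_amplitude_mul`). Preserving the norm means that
the columns are orthonormal (`wellFormed_iff_orthonormal`). Hence two things are required: the
squared norms of the local values multiply to one along every configuration, and any two different
configurations have orthogonal local values at some cell (`wellFormed_iff_gram`).

For a simple automaton the neighborhoods are the windows of length `r` of a bi-infinite word, and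
both requirements become finite. For the norms, `weight` collects the factors of all windows up to a
given one after everything to the left of that window has been replaced by `q`. It serves as a
potential along the word, and the products are all one exactly if it ignores the first letter of the
window (`forall_finprod_eq_one_iff`). For the orthogonality, a violating pair of words is a walk
through pairs of different windows with nonzero inner product that starts right after equal windows
and ends right before equal windows (`forall_exists_eq_zero_iff`).

With `s` states and `w = s ^ r` windows the size is `n = s * w`. All inner products take `O(w² s)`
steps and all weights `O(w r)`. The graph of pairs has at most `w²` nodes with at most `s²`
successors each, so searching it takes `O(w² s²) = O(n²)` steps.

To turn this into a program of the machine, a small structured language with a cost semantics is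
compiled with a constant loss of time (`Exec.run`), and its loops are verified by invariants that
carry a decreasing number (`Spec.loop`). `SearchInv` is the invariant of the graph search. Words are
numbered by their digits in base `s`, and `not_wellFormed_iff` ties the computed flag to the
automaton. -/

/-- The inner product of two values of the local transition function. -/
noncomputable def gram (A : LQCA S) (w w' : Fin A.r → S) : ℂ :=
  ∑ x, conj (A.δ w x) * A.δ w' x

theorem gram_self_ne_zero (A : LQCA S) (w : Fin A.r → S) : A.gram w w ≠ 0 := by
  have h : A.gram w w = ((‖A.δ w‖ ^ 2 : ℝ) : ℂ) := by
    rw [EuclideanSpace.norm_sq_eq]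
    simp [gram, Complex.conj_mul']
  rw [h]
  exact_mod_cast (pow_pos (A.norm_δ_pos w) 2).ne'

theorem gram_quiescent (A : LQCA S) : A.gram (fun _ => A.q) (fun _ => A.q) = 1 := by
  classical
  rw [gram, Finset.sum_eq_single A.q]
  · simp [A.δ_quiescent_self]
  · intro x _ hx
    simp [A.δ_quiescent_ne x hx]
  · simp

theorem finite_nbhd_ne (A : LQCA S) (c : A.Config) :
    {i : ℤ | c.nbhd i ≠ fun _ => A.q}.Finite := by
  have h1 : (⋃ k : Fin A.r, (fun i : ℤ => i + A.N k) ⁻¹' {i | c.1 i ≠ A.q}).Finite :=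
    Set.finite_iUnion fun k => c.2.preimage (add_left_injective (A.N k)).injOn
  refine h1.subset fun i hi => ?_
  by_contra hcon
  simp only [Set.mem_iUnion, Set.mem_preimage, Set.mem_ofPred_eq, not_exists, not_not] at hcon
  exact hi (funext hcon)

/-- The configuration with the given states in the cells of `T` that is quiescent elsewhere. -/
noncomputable def Config.ofFinset (A : LQCA S) (T : Finset ℤ) (f : T → S) : A.Config := by
  classical
  exact ⟨fun i => if h : i ∈ T then f ⟨i, h⟩ else A.q,
    T.finite_toSet.subset fun i hi => by
      by_contra h
      exact hi (dif_neg h)⟩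

theorem Config.ofFinset_apply_mem (A : LQCA S) (T : Finset ℤ) (f : T → S) (i : T) :
    (Config.ofFinset A T f).1 i = f i := by
  simp [Config.ofFinset]

theorem Config.ofFinset_apply_notMem (A : LQCA S) (T : Finset ℤ) (f : T → S) {i : ℤ}
    (hi : i ∉ T) : (Config.ofFinset A T f).1 i = A.q := by
  simp [Config.ofFinset, hi]

theorem Config.ofFinset_injective (A : LQCA S) (T : Finset ℤ) :
    Function.Injective (Config.ofFinset A T) := fun f g h => funext fun i => by
  rw [← Config.ofFinset_apply_mem A T f i, h, Config.ofFinset_apply_mem]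

/-- A cell with a quiescent neighborhood can only enter `q`. If `T` contains all other cells, the
column of `c` is therefore supported on the finitely many configurations given by `T → S`, and the
cells outside `T` contribute the factor one. -/
theorem amplitude_ofFinset (A : LQCA S) (T : Finset ℤ) (c : A.Config)
    (hc : ∀ i ∉ T, c.nbhd i = fun _ => A.q) (f : T → S) :
    A.amplitude (Config.ofFinset A T f) c = ∏ i : T, A.δ (c.nbhd i) (f i) := by
  rw [amplitude, finprod_eq_prod_of_mulSupport_subset (s := T), ← Finset.prod_coe_sort]
  · simp only [Config.ofFinset_apply_mem]
  · intro i hi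
    by_contra h
    refine hi ?_
    simp only
    rw [hc i h, Config.ofFinset_apply_notMem A T f h, A.δ_quiescent_self]

theorem amplitude_eq_zero (A : LQCA S) (T : Finset ℤ) (c : A.Config)
    (hc : ∀ i ∉ T, c.nbhd i = fun _ => A.q) (d : A.Config)
    (hd : d ∉ Set.range (Config.ofFinset A T)) : A.amplitude d c = 0 := by
  have h : ∃ i ∉ T, d.1 i ≠ A.q := by
    by_contra! h
    refine hd ⟨fun i => d.1 i, Subtype.ext (funext fun i => ?_)⟩
    by_cases hi : i ∈ T
    · exact Config.ofFinset_apply_mem A T _ ⟨i, hi⟩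
    · rw [Config.ofFinset_apply_notMem A T _ hi, h i hi]
  obtain ⟨i, hi, hq⟩ := h
  refine finprod_eq_zero _ i ?_ (A.finite_mulSupport_amplitude d c)
  rw [hc i hi, A.δ_quiescent_ne _ hq]

/-- The inner product of two columns of the time evolution operator is the product of the inner
products of the corresponding values of the local transition function. -/
theorem hasSum_conj_amplitude_mul (A : LQCA S) (c c' : A.Config) :
    HasSum (fun d => conj (A.amplitude d c) * A.amplitude d c')
      (∏ᶠ i, A.gram (c.nbhd i) (c'.nbhd i)) := by
  classical
  obtain ⟨T, hT⟩ := ((A.finite_nbhd_ne c).union (A.finite_nbhd_ne c')).exists_finset_coe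
  have hc : ∀ i ∉ T, c.nbhd i = fun _ => A.q := fun i hi => by
    by_contra h
    exact hi (by rw [← Finset.mem_coe, hT]; exact Or.inl h)
  have hc' : ∀ i ∉ T, c'.nbhd i = fun _ => A.q := fun i hi => by
    by_contra h
    exact hi (by rw [← Finset.mem_coe, hT]; exact Or.inr h)
  rw [← (Config.ofFinset_injective A T).hasSum_iff
    (fun d hd => by rw [A.amplitude_eq_zero T c hc d hd]; simp)]
  suffices h : ∏ᶠ i, A.gram (c.nbhd i) (c'.nbhd i) = ∑ f : T → S,
      ((fun d => conj (A.amplitude d c) * A.amplitude d c') ∘ Config.ofFinset A T) f by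
    rw [h]
    exact hasSum_fintype _
  rw [finprod_eq_prod_of_mulSupport_subset (s := T), ← Finset.prod_coe_sort]
  · simp only [gram, Function.comp_apply, amplitude_ofFinset A T c hc,
      amplitude_ofFinset A T c' hc', map_prod, ← Finset.prod_mul_distrib]
    -- Expanding the product of sums gives one term for each choice function `T → S`, that is, for
    -- each configuration in the support.
    rw [Finset.prod_univ_sum]
    simp
  · intro i hi
    by_contra h
    refine hi ?_
    simp only
    rw [hc i h, hc' i h, gram_quiescent]

/-- A column of the time evolution operator. -/
noncomputable def column (A : LQCA S) (c : A.Config) : lp (fun _ : A.Config => ℂ) 2 :=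
  ⟨fun d => A.amplitude d c, memℓp_gen (by
    have h := (A.hasSum_conj_amplitude_mul c c).summable.norm
    simpa [pow_two] using h)⟩

theorem inner_column (A : LQCA S) (c c' : A.Config) :
    ⟪A.column c, A.column c'⟫_ℂ = ∏ᶠ i, A.gram (c.nbhd i) (c'.nbhd i) := by
  refine (lp.hasSum_inner (A.column c) (A.column c')).unique ?_
  have h : (fun d => ⟪A.column c d, A.column c' d⟫_ℂ) =
      fun d => conj (A.amplitude d c) * A.amplitude d c' :=
    funext fun d => by
      rw [RCLike.inner_apply, mul_comm]
      rfl
  rw [h]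
  exact A.hasSum_conj_amplitude_mul c c'

open Classical in
-- Combinations of two basis vectors already determine all inner products of columns. Conversely, an
-- orthonormal family spans an isometric copy of `ℓ₂`.
theorem wellFormed_iff_orthonormal (A : LQCA S) : A.WellFormed ↔ Orthonormal ℂ A.column := by
  constructor
  · intro h
    have key : ∀ (c c' : A.Config) (t : ℂ), ‖A.column c + t • A.column c'‖ =
        ‖(lp.single 2 c (1 : ℂ) : lp (fun _ : A.Config => ℂ) 2) + t • lp.single 2 c' (1 : ℂ)‖ := by
      intro c c' t
      obtain ⟨v, hv, hn⟩ := h (lp.single 2 c (1 : ℂ) + t • lp.single 2 c' (1 : ℂ))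
      rw [← hn]
      congr 1
      ext d
      refine HasSum.unique ?_ (hv d)
      have h1 : HasSum (fun b => A.amplitude d b * (Pi.single c (1 : ℂ) : A.Config → ℂ) b)
          (A.amplitude d c) := by
        convert hasSum_single c _ using 1
        · simp
        · intro b hb
          simp [hb]
      have h2 : HasSum (fun b => A.amplitude d b * (Pi.single c' (1 : ℂ) : A.Config → ℂ) b)
          (A.amplitude d c') := by
        convert hasSum_single c' _ using 1
        · simp
        · intro b hb
          simp [hb]
      have h3 : (fun b => A.amplitude d b *
          (lp.single 2 c (1 : ℂ) + t • lp.single 2 c' (1 : ℂ) : lp (fun _ : A.Config => ℂ) 2) b) =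
          fun b => A.amplitude d b * (Pi.single c (1 : ℂ) : A.Config → ℂ) b +
            t * (A.amplitude d b * (Pi.single c' (1 : ℂ) : A.Config → ℂ) b) :=
        funext fun b => by
          simp only [lp.coeFn_add, lp.coeFn_smul, Pi.add_apply, Pi.smul_apply, lp.coeFn_single,
            smul_eq_mul]
          ring
      rw [h3]
      exact h1.add (h2.mul_left t)
    rw [orthonormal_iff_ite]
    intro c c'
    have e : ⟪A.column c, A.column c'⟫_ℂ =
        ⟪(lp.single 2 c (1 : ℂ) : lp (fun _ : A.Config => ℂ) 2), lp.single 2 c' (1 : ℂ)⟫_ℂ := by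
      -- The four values of `t` supply the norms that occur in the polarization identity.
      have k1 := key c c' 1
      have k2 := key c c' (-1)
      have k3 := key c c' Complex.I
      have k4 := key c c' (-Complex.I)
      simp only [neg_smul, one_smul, ← sub_eq_add_neg] at k1 k2 k3 k4
      rw [inner_eq_sum_norm_sq_div_four, inner_eq_sum_norm_sq_div_four, k1, k2]
      erw [k3, k4]
      rfl
    rw [e, lp.inner_single_left, lp.single_apply]
    by_cases hcc : c = c'
    · subst hcc; simp
    · simp [hcc]
  · intro h u
    -- The isometry of the family sends `u` to the `ℓ₂`-convergent series of the columns with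
    -- coefficients `u c`. Evaluation at `d` is continuous, so the series also converges entrywise
    -- to the required values.
    let V := h.orthogonalFamily
    refine ⟨V.linearIsometry u, fun d => ?_, V.linearIsometry.norm_map u⟩
    have h1 := V.hasSum_linearIsometry u
    have h2 := h1.mapL (lp.evalCLM ℂ (fun _ : A.Config => ℂ) 2 d)
    have h3 : (fun c => A.amplitude d c * u c) = fun c => lp.evalCLM ℂ (fun _ : A.Config => ℂ) 2 d
        (LinearIsometry.toSpanSingleton ℂ _ (h.1 c) (u c)) :=
      funext fun c => mul_comm _ _
    rw [h3]
    exact h2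

/-- Almost all factors of the product are one, so it vanishes only if a single factor does. -/
theorem wellFormed_iff_gram (A : LQCA S) : A.WellFormed ↔
    (∀ c : A.Config, ∏ᶠ i, A.gram (c.nbhd i) (c.nbhd i) = 1) ∧
    ∀ c c' : A.Config, c ≠ c' → ∃ i, A.gram (c.nbhd i) (c'.nbhd i) = 0 := by
  classical
  have hfin : ∀ c c' : A.Config,
      (Function.mulSupport fun i => A.gram (c.nbhd i) (c'.nbhd i)).Finite := by
    intro c c'
    refine ((A.finite_nbhd_ne c).union (A.finite_nbhd_ne c')).subset fun i hi => ?_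
    by_contra h
    simp only [Set.mem_union, Set.mem_ofPred_eq, not_or, not_not] at h
    refine hi ?_
    simp only
    rw [h.1, h.2, gram_quiescent]
  rw [wellFormed_iff_orthonormal, orthonormal_iff_ite]
  simp only [inner_column]
  constructor
  · intro h
    refine ⟨fun c => by simpa using h c c, fun c c' hne => ?_⟩
    have h0 := h c c'
    rw [if_neg hne, finprod_eq_prod _ (hfin c c'), Finset.prod_eq_zero_iff] at h0
    obtain ⟨i, -, hi⟩ := h0
    exact ⟨i, hi⟩
  · rintro ⟨h1, h2⟩ c c'
    split_ifs with hcc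
    · rw [hcc, h1]
    · obtain ⟨i, hi⟩ := h2 c c' hcc
      exact finprod_eq_zero _ i hi (hfin c c')

end LQCA

/-! ### Windows of bi-infinite words -/

namespace Window

variable {S : Type*} {r : ℕ}

/-- The window of length `r` at position `i`. -/
def win (r : ℕ) (f : ℤ → S) (i : ℤ) : Fin r → S := fun k => f (i + (k : ℕ))

/-- The words agree except possibly in the last letter. -/
def InitEq (w u : Fin r → S) : Prop := ∀ k : Fin r, (k : ℕ) + 1 < r → w k = u k

/-- The words agree except possibly in the first letter. -/
def TailEq (w u : Fin r → S) : Prop := ∀ k : Fin r, 0 < (k : ℕ) → w k = u k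

/-- The word `u` can be the window that follows the window `w`. -/
def Follows (w u : Fin r → S) : Prop :=
  ∀ (k : ℕ) (h : k + 1 < r), u ⟨k, by omega⟩ = w ⟨k + 1, h⟩

/-- Drop the last letter and put `q` in front. -/
def shiftIn (q : S) (w : Fin r → S) : Fin r → S :=
  fun k => if (k : ℕ) = 0 then q else w ⟨k - 1, by omega⟩

/-- Replace the first letter by `q`. -/
def setHead (q : S) (w : Fin r → S) : Fin r → S := fun k => if (k : ℕ) = 0 then q else w k

/-- The word surrounded by the letter `q`. -/
def pad (q : S) (w : Fin r → S) : ℤ → S := fun i =>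
  if h : 0 ≤ i ∧ i < r then w ⟨i.toNat, by omega⟩ else q

/-- Pairs of different windows that can be reached from a pair of equal windows through pairs of
different windows on which `g` does not vanish. -/
inductive Reach (g : (Fin r → S) → (Fin r → S) → ℂ) : (Fin r → S) → (Fin r → S) → Prop
  | base {u u'} : u ≠ u' → g u u' ≠ 0 → InitEq u u' → Reach g u u'
  | step {w w' u u'} : Reach g w w' → u ≠ u' → g u u' ≠ 0 → Follows w u → Follows w' u' →
      Reach g u u'

/-- The weight of the windows of `pad q w` up to position `0`. -/
noncomputable def weight (q : S) (g : (Fin r → S) → ℂ) (w : Fin r → S) : ℂ :=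
  ∏ j ∈ Finset.range r, g ((shiftIn q)^[j] w)

theorem Reach.ne {g : (Fin r → S) → (Fin r → S) → ℂ} {w w' : Fin r → S} (h : Reach g w w') :
    w ≠ w' := by
  cases h <;> assumption

theorem win_congr {f f' : ℤ → S} {i i' : ℤ} (h : ∀ k : ℕ, k < r → f (i + k) = f' (i' + k)) :
    win r f i = win r f' i' := funext fun k => h k k.2

theorem follows_win (f : ℤ → S) (i : ℤ) : Follows (win r f i) (win r f (i + 1)) := fun k h => by
  simp only [win]
  congr 1
  push_cast
  ring

theorem pad_of_neg (q : S) (w : Fin r → S) {i : ℤ} (h : i < 0) : pad q w i = q :=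
  dif_neg (by omega)

theorem pad_of_le (q : S) (w : Fin r → S) {i : ℤ} (h : r ≤ i) : pad q w i = q :=
  dif_neg (by omega)

theorem pad_of_lt (q : S) (w : Fin r → S) {k : ℕ} (h : k < r) : pad q w k = w ⟨k, h⟩ := by
  rw [pad, dif_pos (by omega)]
  rfl

theorem win_pad_zero (q : S) (w : Fin r → S) : win r (pad q w) 0 = w := funext fun k => by
  simp only [win, zero_add]
  exact pad_of_lt q w k.2

theorem finite_pad_ne (q : S) (w : Fin r → S) : {i | pad q w i ≠ q}.Finite :=
  (Set.finite_Ico (0 : ℤ) r).subset fun i hi => by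
    by_contra h
    exact hi (dif_neg h)

theorem finite_win_ne {q : S} {f : ℤ → S} (hf : {i | f i ≠ q}.Finite) :
    {i | win r f i ≠ fun _ => q}.Finite := by
  refine (Set.finite_iUnion fun k : Fin r =>
    hf.preimage (add_left_injective ((k : ℕ) : ℤ)).injOn).subset fun i hi => ?_
  by_contra h
  simp only [Set.mem_iUnion, Set.mem_preimage, Set.mem_ofPred_eq, not_exists, not_not] at h
  exact hi (funext h)

/-! ### Pairs of windows -/

section Pairs

variable {q : S} {g : (Fin r → S) → (Fin r → S) → ℂ}

/-- A derivation of reachability is read as a pair of words whose windows at position `0` are the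
reached pair. In the base case both words are padded with `q`: the windows to the left contain only
letters on which the two words agree, so they coincide and `hg` applies. Each further step moves the
words one cell to the left. -/
theorem Reach.exists_win (hg : ∀ w, g w w ≠ 0) {u u' : Fin r → S} (h : Reach g u u') :
    ∃ f f' : ℤ → S, {i | f i ≠ q}.Finite ∧ {i | f' i ≠ q}.Finite ∧
      (∀ i : ℤ, r ≤ i → f i = q ∧ f' i = q) ∧ win r f 0 = u ∧ win r f' 0 = u' ∧
      ∀ i ≤ 0, g (win r f i) (win r f' i) ≠ 0 := by
  induction h with
  | @base u u' _ h0 hi =>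
    refine ⟨pad q u, pad q u', finite_pad_ne q u, finite_pad_ne q u',
      fun i h => ⟨pad_of_le q u h, pad_of_le q u' h⟩, win_pad_zero q u, win_pad_zero q u',
      fun i hle => ?_⟩
    rcases hle.lt_or_eq with hlt | rfl
    · have : win r (pad q u) i = win r (pad q u') i := win_congr fun k hk => by
        by_cases hn : i + k < 0
        · rw [pad_of_neg q u hn, pad_of_neg q u' hn]
        · obtain ⟨l, hl⟩ := Int.eq_ofNat_of_zero_le (not_lt.1 hn)
          rw [hl, pad_of_lt q u (by omega), pad_of_lt q u' (by omega)]
          exact hi _ (by simp only; omega)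
      rw [this]
      exact hg _
    · rwa [win_pad_zero, win_pad_zero]
  | @step w w' u u' _ _ h0 hs hs' ih =>
    obtain ⟨f, f', hf, hf', hq, hw, hw', hnz⟩ := ih
    have aux : ∀ (f : ℤ → S) (w u : Fin r → S), {i | f i ≠ q}.Finite → win r f 0 = w →
        Follows w u → ∃ f₁ : ℤ → S, {i | f₁ i ≠ q}.Finite ∧ (∀ i : ℤ, r ≤ i → f₁ i = q) ∧
          win r f₁ 0 = u ∧ ∀ i < 0, win r f₁ i = win r f (i + 1) := by
      intro f w u hf hw hs
      -- The old word is shifted to the left and overwritten by `u` from cell `0` on. `Follows` says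
      -- that this changes nothing in the cells shared with the old window.
      refine ⟨fun i => if i < 0 then f (i + 1) else pad q u i, ?_, fun i hi => ?_, ?_,
        fun i hi => ?_⟩
      · refine ((hf.preimage (add_left_injective (1 : ℤ)).injOn).union
          (finite_pad_ne q u)).subset fun i hi => ?_
        by_cases h : i < 0
        · exact Or.inl (by simpa [h] using hi)
        · exact Or.inr (by simpa [h] using hi)
      · beta_reduce
        rw [if_neg (by omega), pad_of_le q u hi]
      · rw [← win_pad_zero q u]
        refine win_congr fun k hk => ?_
        rw [if_neg (by omega), win_pad_zero]
      · refine win_congr fun k hk => ?_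
        split_ifs with h
        · congr 1
          ring
        · obtain ⟨l, hl⟩ := Int.eq_ofNat_of_zero_le (not_lt.1 h)
          have hl' : l + 1 < r := by omega
          rw [hl, pad_of_lt q u (by omega), hs l hl', ← hw]
          simp only [win]
          congr 1
          push_cast
          omega
    obtain ⟨f₁, a1, a2, a3, a4⟩ := aux f w u hf hw hs
    obtain ⟨f₁', b1, b2, b3, b4⟩ := aux f' w' u' hf' hw' hs'
    refine ⟨f₁, f₁', a1, b1, fun i h => ⟨a2 i h, b2 i h⟩, a3, b3, fun i hi => ?_⟩
    rcases hi.lt_or_eq with hlt | rfl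
    · rw [a4 i hlt, b4 i hlt]
      exact hnz _ (by omega)
    · rwa [a3, b3]

/-- Two different words all of whose pairs of windows have nonzero weight exist if and only if
a pair of different windows is reachable that can be followed by a pair of equal windows. -/
theorem forall_exists_eq_zero_iff (hr : 1 ≤ r) (hg : ∀ w, g w w ≠ 0) :
    (∀ f f' : ℤ → S, {i | f i ≠ q}.Finite → {i | f' i ≠ q}.Finite → f ≠ f' →
      ∃ i, g (win r f i) (win r f' i) = 0) ↔
    ¬ ∃ w w', Reach g w w' ∧ TailEq w w' := by
  constructor
  · rintro h ⟨w, w', hR, ht⟩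
    obtain ⟨f, f', hf, hf', hq, hw, hw', hnz⟩ := hR.exists_win (q := q) hg
    have hne : f ≠ f' := by
      rintro rfl
      exact hR.ne (hw.symm.trans hw')
    obtain ⟨i, hi⟩ := h f f' hf hf' hne
    rcases le_or_gt i 0 with h0 | h0
    · exact hnz i h0 hi
    -- To the right of position `0` the first letter of the reached pair has left the window. The
    -- remaining letters agree by `TailEq`, and beyond them both words are quiescent.
    · have : win r f i = win r f' i := win_congr fun k hk => by
        rcases le_or_gt (r : ℤ) (i + k) with h1 | h1
        · rw [(hq _ h1).1, (hq _ h1).2]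
        · obtain ⟨l, hl⟩ := Int.eq_ofNat_of_zero_le (a := i + k) (by omega)
          have e1 := congrFun hw ⟨l, by omega⟩
          have e2 := congrFun hw' ⟨l, by omega⟩
          simp only [win, zero_add] at e1 e2
          rw [hl, e1, e2]
          exact ht _ (by simp only; omega)
      rw [this] at hi
      exact hg _ hi
  · intro hbad f f' hf hf' hne
    by_contra! hnz
    obtain ⟨p, hp⟩ := Function.ne_iff.1 hne
    have hfin : {i | win r f i ≠ win r f' i}.Finite := by
      refine ((finite_win_ne (r := r) hf).union (finite_win_ne (r := r) hf')).subset fun i hi => ?_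
      by_contra h
      simp only [Set.mem_union, Set.mem_ofPred_eq, not_or, not_not] at h
      exact hi (h.1.trans h.2.symm)
    have hpne : win r f p ≠ win r f' p := fun h => hp (by
      simpa [win] using congrFun h ⟨0, hr⟩)
    obtain ⟨b, hb⟩ := hfin.bddBelow
    -- At the leftmost position where the windows differ, the previous windows are equal, which
    -- provides the base case of `Reach`.
    obtain ⟨i, hi, hmin⟩ := Int.exists_least_of_bdd (P := fun i => win r f i ≠ win r f' i)
      ⟨b, fun z hz => hb hz⟩ ⟨p, hpne⟩
    have hprev : win r f (i - 1) = win r f' (i - 1) := by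
      by_contra h
      have := hmin _ h
      omega
    -- The windows can never become equal again: the last different pair before that would be
    -- reachable and satisfy `TailEq`. So they differ at all later positions, against the finiteness
    -- of the two words.
    have hR : ∀ j : ℕ, Reach g (win r f (i + j)) (win r f' (i + j)) := by
      intro j
      induction j with
      | zero =>
        rw [Nat.cast_zero, add_zero]
        refine Reach.base hi (hnz i) fun k hk => ?_
        have := congrFun hprev ⟨k + 1, hk⟩
        simp only [win] at this ⊢
        convert this using 2 <;> push_cast <;> ring
      | succ j ih =>
        have e : i + ((j + 1 : ℕ) : ℤ) = i + j + 1 := by push_cast; ring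
        rw [e]
        refine ih.step (fun h => ?_) (hnz _) (follows_win f _) (follows_win f' _)
        refine hbad ⟨_, _, ih, fun k hk => ?_⟩
        have := congrFun h ⟨k - 1, by omega⟩
        simp only [win] at this ⊢
        convert this using 2 <;> push_cast [Nat.cast_sub (show 1 ≤ (k : ℕ) from hk)] <;> ring
    obtain ⟨B, hB⟩ := hfin.bddAbove
    have h1 := hB (hR (B - i + 1).toNat).ne
    omega

end Pairs

/-! ### Weights of windows -/

section Weights

variable {q : S} {g : (Fin r → S) → ℂ}

theorem iterate_shiftIn (w : Fin r → S) (j : ℕ) :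
    (shiftIn q)^[j] w = win r (pad q w) (-j) := by
  induction j with
  | zero => simp [win_pad_zero]
  | succ j ih =>
    rw [Function.iterate_succ_apply', ih]
    funext k
    simp only [shiftIn, win]
    split_ifs with h
    · rw [pad_of_neg]
      omega
    · congr 1
      push_cast [Nat.cast_sub (show 1 ≤ (k : ℕ) by omega)]
      ring

theorem iterate_shiftIn_length (w : Fin r → S) : (shiftIn q)^[r] w = fun _ => q := by
  rw [iterate_shiftIn]
  funext k
  exact pad_of_neg q w (by omega)

/-- After `r` shifts only `q` is left, with factor one. Hence the product over `r` shifts may be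
extended by one factor and its first factor split off. -/
theorem weight_eq_mul (h1 : g (fun _ => q) = 1) (w : Fin r → S) :
    weight q g w = g w * weight q g (shiftIn q w) := by
  have e : weight q g w * g ((shiftIn q)^[r] w) = g w * weight q g (shiftIn q w) := by
    simp only [weight, ← Function.iterate_succ_apply]
    rw [← Finset.prod_range_succ (fun j => g ((shiftIn q)^[j] w)), Finset.prod_range_succ',
      mul_comm]
    rfl
  rw [← e, iterate_shiftIn_length, h1, mul_one]

theorem shiftIn_const : shiftIn q (fun _ : Fin r => q) = fun _ => q :=
  funext fun k => by simp [shiftIn]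

theorem weight_const (h1 : g (fun _ => q) = 1) : weight q g (fun _ => q) = 1 := by
  have : ∀ j, (shiftIn q)^[j] (fun _ : Fin r => q) = fun _ => q := fun j =>
    Function.iterate_fixed shiftIn_const j
  simp [weight, this, h1]

theorem setHead_win (f : ℤ → S) (i : ℤ) :
    setHead q (win r f i) = shiftIn q (win r f (i + 1)) := funext fun k => by
  simp only [setHead, shiftIn, win]
  split_ifs with h
  · rfl
  · congr 1
    push_cast [Nat.cast_sub (show 1 ≤ (k : ℕ) by omega)]
    ring

theorem finprod_win_eq (h1 : g (fun _ => q) = 1) (f : ℤ → S) (a : ℤ) (n : ℕ)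
    (hf : ∀ i, (i < a ∨ a + n ≤ i) → win r f i = fun _ => q) :
    ∏ᶠ i, g (win r f i) = ∏ j ∈ Finset.range n, g (win r f (a + j)) := by
  classical
  rw [finprod_eq_prod_of_mulSupport_subset (s := (Finset.range n).image fun j : ℕ => a + (j : ℤ)),
    Finset.prod_image]
  · intro i _ j _ h
    simpa using h
  · intro i hi
    by_contra h
    simp only [Finset.coe_image, Set.mem_image, Finset.mem_coe, Finset.mem_range, not_exists,
      not_and] at h
    refine hi ?_
    simp only
    rw [hf i, h1]
    by_contra hcon
    exact h (i - a).toNat (by omega) (by omega)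

/-- The products of the weights of the windows of all words are `1` if and only if the weight of
a padded word up to position `0` does not depend on its first letter. -/
theorem forall_finprod_eq_one_iff (h1 : g (fun _ => q) = 1) :
    (∀ f : ℤ → S, {i | f i ≠ q}.Finite → ∏ᶠ i, g (win r f i) = 1) ↔
    ∀ w, weight q g w = weight q g (setHead q w) := by
  constructor
  · intro h w
    -- The nontrivial windows of the padded word lie at positions `1 - r` to `r`. Those up to
    -- position `0` make up the weight.
    have key : ∀ w : Fin r → S, weight q g w *
        ∏ j ∈ Finset.range r, g (win r (pad q w) (j + 1)) = 1 := by
      intro w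
      rw [← h (pad q w) (finite_pad_ne q w),
        finprod_win_eq h1 (pad q w) (1 - r) (r + r) (fun i hi => funext fun k => ?_),
        Finset.prod_range_add, weight, ← Finset.prod_range_reflect]
      · congr 1
        · refine Finset.prod_congr rfl fun j hj => ?_
          rw [Finset.mem_range] at hj
          rw [iterate_shiftIn]
          congr 2
          omega
        · refine Finset.prod_congr rfl fun j hj => ?_
          congr 2
          push_cast
          ring
      · rcases hi with hi | hi
        · exact pad_of_neg q w (by omega)
        · exact pad_of_le q w (by push_cast at hi; omega)
    -- Windows at positive positions do not see cell `0`, so changing the first letter leaves their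
    -- product unchanged. It can be cancelled because it is a factor of one.
    have e : ∀ j : ℕ, win r (pad q (setHead q w)) (j + 1) = win r (pad q w) (j + 1) := by
      intro j
      refine win_congr fun k hk => ?_
      rcases lt_or_ge (j + 1 + k) r with hlt | hge
      · have e2 : (j : ℤ) + 1 + k = ((j + 1 + k : ℕ) : ℤ) := by push_cast; ring
        rw [e2, pad_of_lt q _ hlt, pad_of_lt q _ hlt]
        simp [setHead]
      · rw [pad_of_le q _ (by omega), pad_of_le q _ (by omega)]
    have k1 := key w
    have k2 := key (setHead q w)
    simp only [e] at k2
    exact mul_right_cancel₀ (right_ne_zero_of_mul_eq_one k1) (k1.trans k2.symm)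
  · intro h f hf
    have hfin := finite_win_ne (r := r) hf
    obtain ⟨b, hb⟩ := hfin.bddBelow
    obtain ⟨B, hB⟩ := hfin.bddAbove
    have hlow : ∀ i, i < b → win r f i = fun _ => q := fun i hi => by
      by_contra hne
      have := hb hne
      omega
    have hhigh : ∀ i, B < i → win r f i = fun _ => q := fun i hi => by
      by_contra hne
      have := hB hne
      omega
    -- The product telescopes: by hypothesis the weight of a window equals that with first letter
    -- `q`, which is the shifted next window by `setHead_win`. At both quiescent ends the potential
    -- is one.
    have tel : ∀ n : ℕ, (∏ j ∈ Finset.range n, g (win r f (b - 1 + j))) *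
        weight q g (shiftIn q (win r f (b - 1))) =
        weight q g (shiftIn q (win r f (b - 1 + n))) := by
      intro n
      induction n with
      | zero => simp
      | succ n ih =>
        rw [Finset.prod_range_succ, mul_right_comm, ih, mul_comm, ← weight_eq_mul h1, h,
          setHead_win]
        congr 3
        push_cast
        ring
    rw [finprod_win_eq h1 f (b - 1) (B - b + 2).toNat]
    · have := tel (B - b + 2).toNat
      rw [hlow (b - 1) (by omega), hhigh (b - 1 + (B - b + 2).toNat) (by omega), shiftIn_const,
        weight_const h1, mul_one] at this
      exact this
    · rintro i (hi | hi)
      · exact hlow i (by omega)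
      · exact hhigh i (by omega)

end Weights

end Window

/-! ### The finite criterion for simple automata. -/

namespace LQCA

open Window

variable {S : Type*} [Fintype S]

/-- An increasing enumeration of an interval has no gaps: if `j + k` is the value at index `k`, then
the value at the next index is larger, and `j + k + 1` is attained at some later index. -/
theorem IsSimple.exists_eq_add {A : LQCA S} (h : A.IsSimple) :
    ∃ a : ℤ, ∀ k, A.N k = a + (k : ℕ) := by
  obtain ⟨j, l, hjl⟩ := h
  refine ⟨j, ?_⟩
  have hmem : ∀ k, A.N k ∈ Set.Icc j l := fun k => hjl ▸ Set.mem_range_self k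
  have hsurj : ∀ x, j ≤ x → x ≤ l → ∃ k, A.N k = x := fun x h1 h2 => by
    have : x ∈ Set.range A.N := hjl ▸ ⟨h1, h2⟩
    exact this
  rintro ⟨k, hk⟩
  induction k with
  | zero =>
    obtain ⟨i, hi⟩ := hsurj j le_rfl ((hmem ⟨0, hk⟩).1.trans (hmem ⟨0, hk⟩).2)
    have := A.N_strictMono.monotone (show (⟨0, hk⟩ : Fin A.r) ≤ i from Nat.zero_le _)
    have := (hmem ⟨0, hk⟩).1
    simp only
    omega
  | succ k ih =>
    have ih := ih (by omega)
    have hlt := A.N_strictMono (show (⟨k, by omega⟩ : Fin A.r) < ⟨k + 1, hk⟩ from Nat.lt_succ_self k)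
    have h2 := (hmem ⟨k + 1, hk⟩).2
    obtain ⟨i, hi⟩ := hsurj (j + k + 1) (by omega) (by simp only at ih; omega)
    have h3 : (⟨k, by omega⟩ : Fin A.r) < i := A.N_strictMono.lt_iff_lt.1 (by
      simp only at ih
      omega)
    have h4 := A.N_strictMono.monotone (show (⟨k + 1, hk⟩ : Fin A.r) ≤ i from h3)
    simp only at ih ⊢
    push_cast
    omega

/-- A simple automaton is well-formed if and only if the norms of the values of its local
transition function cancel along all configurations and no pair of different windows can lead from
equal windows to equal windows without meeting orthogonal values. -/
theorem IsSimple.wellFormed_iff {A : LQCA S} (h : A.IsSimple) : A.WellFormed ↔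
    (∀ w, weight A.q (fun w => A.gram w w) w =
      weight A.q (fun w => A.gram w w) (setHead A.q w)) ∧
    ¬ ∃ w w', Reach A.gram w w' ∧ TailEq w w' := by
  obtain ⟨a, ha⟩ := h.exists_eq_add
  -- The offset `a` only relabels the cells, so it disappears from statements about all cells.
  have hn : ∀ (c : A.Config) (i : ℤ), c.nbhd i = win A.r c.1 (i + a) := fun c i =>
    funext fun k => congrArg c.1 (by rw [ha]; ring)
  rw [← forall_finprod_eq_one_iff (q := A.q) (g := fun w => A.gram w w)
      A.gram_quiescent,
    ← forall_exists_eq_zero_iff (q := A.q) A.one_le_r A.gram_self_ne_zero, wellFormed_iff_gram]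
  simp only [hn]
  refine and_congr ⟨fun h f hf => ?_, fun h c => ?_⟩ ⟨fun h f f' hf hf' hne => ?_,
    fun h c c' hne => ?_⟩
  · rw [← h ⟨f, hf⟩]
    exact (finprod_comp_equiv (Equiv.addRight a)
      (f := fun i => A.gram (win A.r f i) (win A.r f i))).symm
  · rw [← h c.1 c.2]
    exact finprod_comp_equiv (Equiv.addRight a)
      (f := fun i => A.gram (win A.r c.1 i) (win A.r c.1 i))
  · obtain ⟨i, hi⟩ := h ⟨f, hf⟩ ⟨f', hf'⟩ fun e => hne (congrArg Subtype.val e)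
    exact ⟨_, hi⟩
  · obtain ⟨i, hi⟩ := h c.1 c'.1 c.2 c'.2 fun e => hne (Subtype.ext e)
    exact ⟨i - a, by simpa using hi⟩

end LQCA

/-! ### A structured language for the machine -/

namespace AlgebraicRAM

/-- A structured view of the memory: integer variables, seven integer arrays, complex variables,
and the nonnegative part of the memory for complex numbers. -/
structure Mem where
  /-- integer variables -/
  v : ℕ → ℤ
  /-- integer arrays -/
  a : Fin 7 → ℤ → ℤ
  /-- complex variables -/
  x : ℕ → ℂ
  /-- complex table -/
  t : ℤ → ℂ

/-- The cell of an integer variable. -/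
def reg (k : ℕ) : ℤ := 8 * ((k : ℤ) + 1) + 7

/-- The cell of a complex variable. -/
def creg (k : ℕ) : ℤ := -((k : ℤ) + 1)

/-- Operations of the structured language. -/
inductive Op where
  | const (d : ℕ) (k : ℤ)
  | add (d a b : ℕ)
  | sub (d a b : ℕ)
  | load (d : ℕ) (j : Fin 7) (a : ℕ)
  | store (j : Fin 7) (a b : ℕ)
  | xconst (d : ℕ) (k : ℤ)
  | xadd (d a b : ℕ)
  | xmul (d a b : ℕ)
  | xconj (d a : ℕ)
  | xload (d a : ℕ)
  | xstore (a b : ℕ)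

/-- The address of an entry of an array, computed into cell `7`. -/
def addrCode (j : Fin 7) (a : ℕ) : List Instr :=
  [.iadd 7 (reg a) (reg a), .iadd 7 7 7, .iadd 7 7 7, .iconst (-1) (j : ℕ), .iadd 7 7 (-1)]

namespace Op

/-- The machine code of an operation. -/
def code : Op → List Instr
  | const d k => [.iconst (reg d) k]
  | add d a b => [.iadd (reg d) (reg a) (reg b)]
  | sub d a b => [.isub (reg d) (reg a) (reg b)]
  | load d j a => addrCode j a ++ [.iload (reg d) 7]
  | store j a b => addrCode j a ++ [.istore 7 (reg b)]
  | xconst d k => [.xconst (creg d) k]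
  | xadd d a b => [.xadd (creg d) (creg a) (creg b)]
  | xmul d a b => [.xmul (creg d) (creg a) (creg b)]
  | xconj d a => [.xconj (creg d) (creg a)]
  | xload d a => [.xload (creg d) (reg a)]
  | xstore a b => [.xstore (reg a) (creg b)]

/-- Accesses to the complex table need nonnegative indices. -/
def Safe : Op → Mem → Prop
  | xload _ a, m => 0 ≤ m.v a
  | xstore a _, m => 0 ≤ m.v a
  | _, _ => True

/-- The effect of an operation. -/
noncomputable def eff : Op → Mem → Mem
  | const d k, m => ⟨Function.update m.v d k, m.a, m.x, m.t⟩
  | add d a b, m => ⟨Function.update m.v d (m.v a + m.v b), m.a, m.x, m.t⟩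
  | sub d a b, m => ⟨Function.update m.v d (m.v a - m.v b), m.a, m.x, m.t⟩
  | load d j a, m => ⟨Function.update m.v d (m.a j (m.v a)), m.a, m.x, m.t⟩
  | store j a b, m =>
    ⟨m.v, Function.update m.a j (Function.update (m.a j) (m.v a) (m.v b)), m.x, m.t⟩
  | xconst d k, m => ⟨m.v, m.a, Function.update m.x d (k : ℂ), m.t⟩
  | xadd d a b, m => ⟨m.v, m.a, Function.update m.x d (m.x a + m.x b), m.t⟩
  | xmul d a b, m => ⟨m.v, m.a, Function.update m.x d (m.x a * m.x b), m.t⟩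
  | xconj d a, m => ⟨m.v, m.a, Function.update m.x d ((starRingEnd ℂ) (m.x a)), m.t⟩
  | xload d a, m => ⟨m.v, m.a, Function.update m.x d (m.t (m.v a)), m.t⟩
  | xstore a b, m => ⟨m.v, m.a, m.x, Function.update m.t (m.v a) (m.x b)⟩

end Op

/-- Conditions of the structured language. -/
inductive Cond where
  | lt (a b : ℕ)
  | eq (a b : ℕ)
  | xeq (a b : ℕ)

namespace Cond

/-- The truth of a condition. -/
def Holds : Cond → Mem → Prop
  | lt a b, m => m.v a < m.v b
  | eq a b, m => m.v a = m.v b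
  | xeq a b, m => m.x a = m.x b

/-- The machine code at position `pc` that goes to `l₁` if the condition holds and to `l₂`
otherwise. -/
def code : Cond → (pc l₁ l₂ : ℕ) → List Instr
  | lt a b, _, l₁, l₂ => [.ijumpLE (reg b) (reg a) l₂, .jump l₁]
  -- The only integer branch of the machine is `≤`, so equality takes two comparisons. The first one
  -- skips the intermediate jump.
  | eq a b, pc, l₁, l₂ => [.ijumpLE (reg a) (reg b) (pc + 2), .jump l₂,
      .ijumpLE (reg b) (reg a) l₁, .jump l₂]
  | xeq a b, _, l₁, l₂ => [.xjumpEq (creg a) (creg b) l₁, .jump l₂]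

/-- The length of the machine code of a condition. -/
def len : Cond → ℕ
  | lt _ _ => 2
  | eq _ _ => 4
  | xeq _ _ => 2

theorem length_code (c : Cond) (pc l₁ l₂ : ℕ) : (c.code pc l₁ l₂).length = c.len := by
  cases c <;> rfl

end Cond

/-- Commands of the structured language. -/
inductive Com where
  | block (l : List Op)
  | seq (c₁ c₂ : Com)
  | ite (b : Cond) (c₁ c₂ : Com)
  | loop (b : Cond) (c : Com)

namespace Com

/-- The length of the machine code of a command. -/
def len : Com → ℕ
  | block l => (l.flatMap Op.code).length
  | seq c₁ c₂ => c₁.len + c₂.len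
  | ite b c₁ c₂ => b.len + c₁.len + 1 + c₂.len
  | loop b c => b.len + c.len + 1

/-- The machine code of a command at position `pc`. -/
def code : Com → ℕ → List Instr
  | block l, _ => l.flatMap Op.code
  | seq c₁ c₂, pc => c₁.code pc ++ c₂.code (pc + c₁.len)
  | ite b c₁ c₂, pc =>
    b.code pc (pc + b.len) (pc + b.len + c₁.len + 1) ++ (c₁.code (pc + b.len) ++
      (.jump (pc + b.len + c₁.len + 1 + c₂.len) :: c₂.code (pc + b.len + c₁.len + 1)))
  | loop b c, pc =>
    b.code pc (pc + b.len) (pc + b.len + c.len + 1) ++ (c.code (pc + b.len) ++ [.jump pc])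

theorem length_code (c : Com) (pc : ℕ) : (c.code pc).length = c.len := by
  induction c generalizing pc with
  | block l => rfl
  | seq c₁ c₂ h₁ h₂ => simp [code, len, h₁, h₂]
  | ite b c₁ c₂ h₁ h₂ =>
    simp only [code, len, List.length_append, List.length_cons, h₁, h₂, Cond.length_code]
    ring
  | loop b c h => simp [code, len, h, Cond.length_code, add_assoc]

end Com

/-- Execution of a command, with its cost. -/
inductive Exec : Com → Mem → ℕ → Mem → Prop
  | nil (m) : Exec (.block []) m 0 m
  | cons {o l m k m'} : o.Safe m → Exec (.block l) (o.eff m) k m' →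
      Exec (.block (o :: l)) m (k + 1) m'
  | seq {c₁ c₂ m k₁ m' k₂ m''} : Exec c₁ m k₁ m' → Exec c₂ m' k₂ m'' →
      Exec (.seq c₁ c₂) m (k₁ + k₂) m''
  | ite_true {b c₁ c₂ m k m'} : b.Holds m → Exec c₁ m k m' → Exec (.ite b c₁ c₂) m (k + 1) m'
  | ite_false {b c₁ c₂ m k m'} : ¬ b.Holds m → Exec c₂ m k m' → Exec (.ite b c₁ c₂) m (k + 1) m'
  | loop_true {b c m k m' k' m''} : b.Holds m → Exec c m k m' → Exec (.loop b c) m' k' m'' →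
      Exec (.loop b c) m (k + k' + 1) m''
  | loop_false {b c m} : ¬ b.Holds m → Exec (.loop b c) m 1 m

/-! ### Correctness of the compilation -/

/-- The program contains the instructions `l` from position `pc` on. -/
def CodeAt (P : Program) (pc : ℕ) (l : List Instr) : Prop :=
  ∃ p s, P = p ++ (l ++ s) ∧ p.length = pc

theorem CodeAt.left {P : Program} {pc : ℕ} {l₁ l₂ : List Instr} (h : CodeAt P pc (l₁ ++ l₂)) :
    CodeAt P pc l₁ := by
  obtain ⟨p, s, rfl, rfl⟩ := h
  exact ⟨p, l₂ ++ s, by simp, rfl⟩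

theorem CodeAt.right {P : Program} {pc : ℕ} {l₁ l₂ : List Instr} (h : CodeAt P pc (l₁ ++ l₂)) :
    CodeAt P (pc + l₁.length) l₂ := by
  obtain ⟨p, s, rfl, rfl⟩ := h
  exact ⟨p ++ l₁, s, by simp, by simp⟩

theorem CodeAt.head {P : Program} {pc : ℕ} {i : Instr} {l : List Instr}
    (h : CodeAt P pc (i :: l)) : P[pc]? = some i := by
  obtain ⟨p, s, rfl, rfl⟩ := h
  simp

theorem CodeAt.tail {P : Program} {pc : ℕ} {i : Instr} {l : List Instr}
    (h : CodeAt P pc (i :: l)) : CodeAt P (pc + 1) l :=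
  CodeAt.right (l₁ := [i]) h

/-- The program leads from `σ` to `σ'` in at most `k` steps. -/
def Run (P : Program) (σ : State) (k : ℕ) (σ' : State) : Prop :=
  ∃ k' ≤ k, (P.step)^[k'] σ = σ'

theorem Run.refl (P : Program) (σ : State) (k : ℕ) : Run P σ k σ := ⟨0, Nat.zero_le _, rfl⟩

theorem Run.trans {P : Program} {σ σ' σ'' : State} {k k' : ℕ} (h : Run P σ k σ')
    (h' : Run P σ' k' σ'') : Run P σ (k + k') σ'' := by
  obtain ⟨n, hn, rfl⟩ := h
  obtain ⟨n', hn', rfl⟩ := h'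
  exact ⟨n' + n, by omega, Function.iterate_add_apply _ _ _ _⟩

theorem Run.mono {P : Program} {σ σ' : State} {k k' : ℕ} (h : Run P σ k σ') (hk : k ≤ k') :
    Run P σ k' σ' := by
  obtain ⟨n, hn, h⟩ := h
  exact ⟨n, hn.trans hk, h⟩

theorem step_eq {P : Program} {σ : State} {i : Instr} (h : P[σ.pc]? = some i) :
    P.step σ = i.run σ := by
  rw [Program.step, h]

theorem Run.step {P : Program} {σ : State} {i : Instr} (h : P[σ.pc]? = some i) :
    Run P σ 1 (i.run σ) := ⟨1, le_rfl, step_eq h⟩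

/-- The instruction always passes control to the next one. -/
def Instr.IsStraight (i : Instr) : Prop := ∀ σ, (i.run σ).pc = σ.pc + 1

theorem run_straight {P : Program} {l : List Instr} (hl : ∀ i ∈ l, i.IsStraight) {σ : State}
    (h : CodeAt P σ.pc l) : Run P σ l.length (l.foldl (fun σ i => i.run σ) σ) ∧
      (l.foldl (fun σ i => i.run σ) σ).pc = σ.pc + l.length := by
  induction l generalizing σ with
  | nil => exact ⟨Run.refl _ _ _, rfl⟩
  | cons i l ih =>
    have hi := hl i (by simp) σ
    have := ih (fun j hj => hl j (by simp [hj])) (σ := i.run σ) (by rw [hi]; exact h.tail)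
    refine ⟨((Run.step h.head).trans this.1).mono (by simp [add_comm]), ?_⟩
    rw [List.foldl_cons, this.2, hi, List.length_cons]
    ring

/-- The state of the machine represents the structured memory. -/
structure Rel (σ : State) (m : Mem) : Prop where
  v : ∀ k, σ.I (reg k) = m.v k
  a : ∀ (j : Fin 7) i, σ.I (8 * i + (j : ℕ)) = m.a j i
  x : ∀ k, σ.X (creg k) = m.x k
  t : ∀ i, 0 ≤ i → σ.X i = m.t i

/-- This and the following facts show that writes do not interfere. Arrays occupy the residues `0`
to `6` modulo `8`, and integer variables occupy the residue `7` from cell `15` on. The cells `7` and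
`-1`, of the same residue, are free for address computations. Complex variables have negative cells
and the table nonnegative ones. -/
theorem reg_inj {k l : ℕ} : reg k = reg l ↔ k = l := by
  simp only [reg]
  omega

theorem creg_inj {k l : ℕ} : creg k = creg l ↔ k = l := by
  simp only [creg]
  omega

theorem reg_ne_seven (k : ℕ) : reg k ≠ 7 := by
  simp only [reg]
  omega

theorem reg_ne_neg_one (k : ℕ) : reg k ≠ -1 := by
  simp only [reg]
  omega

theorem entry_ne_reg (j : Fin 7) (i : ℤ) (k : ℕ) : 8 * i + ((j : ℕ) : ℤ) ≠ reg k := by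
  have := j.2
  simp only [reg]
  omega

theorem reg_ne_entry (j : Fin 7) (i : ℤ) (k : ℕ) : reg k ≠ 8 * i + ((j : ℕ) : ℤ) :=
  (entry_ne_reg j i k).symm

theorem entry_ne_seven (j : Fin 7) (i : ℤ) : 8 * i + ((j : ℕ) : ℤ) ≠ 7 := by
  have := j.2
  omega

theorem entry_ne_neg_one (j : Fin 7) (i : ℤ) : 8 * i + ((j : ℕ) : ℤ) ≠ -1 := by
  have := j.2
  omega

theorem entry_inj (j j' : Fin 7) (i i' : ℤ) :
    8 * i + ((j : ℕ) : ℤ) = 8 * i' + ((j' : ℕ) : ℤ) ↔ j = j' ∧ i = i' := by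
  have := j.2
  have := j'.2
  rw [Fin.ext_iff]
  omega

theorem Op.isStraight_code (o : Op) : ∀ i ∈ o.code, i.IsStraight := by
  intro i hi σ
  cases o <;> simp only [Op.code, addrCode, List.cons_append, List.nil_append, List.mem_cons,
    List.not_mem_nil, or_false] at hi <;> (try rcases hi with rfl | rfl | rfl | rfl | rfl | rfl) <;>
    rfl

theorem ne_creg {i : ℤ} (h : 0 ≤ i) (k : ℕ) : i ≠ creg k := by
  simp only [creg]
  omega

theorem creg_ne {i : ℤ} (h : 0 ≤ i) (k : ℕ) : creg k ≠ i := (ne_creg h k).symm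

theorem addrCode_run (σ : State) (j : Fin 7) (a : ℕ) :
    (addrCode j a).foldl (fun σ i => i.run σ) σ =
      ⟨σ.pc + 1 + 1 + 1 + 1 + 1, Function.update (Function.update σ.I (-1) ((j : ℕ) : ℤ)) 7
        (8 * σ.I (reg a) + ((j : ℕ) : ℤ)), σ.X⟩ := by
  simp only [addrCode, List.foldl_cons, List.foldl_nil, Instr.run, State.writeI]
  congr 1
  funext i
  simp only [Function.update_apply]
  by_cases h7 : i = 7
  · subst h7
    simp
    ring
  · simp [h7]

theorem Op.rel_run {σ : State} {m : Mem} (h : Rel σ m) (o : Op) (ho : o.Safe m) :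
    Rel (o.code.foldl (fun σ i => i.run σ) σ) (o.eff m) := by
  obtain ⟨hv, ha, hx, ht⟩ := h
  cases o
  case load d j a =>
    simp only [Op.code, List.foldl_append, addrCode_run]
    simp only [List.foldl_cons, List.foldl_nil, Instr.run, State.writeI, Op.eff]
    constructor <;> intros <;>
      simp_all [Function.update_apply, reg_inj, reg_ne_seven, reg_ne_neg_one, entry_ne_reg,
        entry_ne_seven, entry_ne_neg_one]
  case store j a b =>
    simp only [Op.code, List.foldl_append, addrCode_run]
    simp only [List.foldl_cons, List.foldl_nil, Instr.run, State.writeI, Op.eff]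
    constructor
    · intros
      simp_all [reg_ne_entry, reg_ne_seven, reg_ne_neg_one]
    · intro j' i
      simp only [Function.update_apply, entry_ne_seven, entry_ne_neg_one, if_false, hv, ha,
        if_true, reg_ne_seven, reg_ne_neg_one, entry_inj]
      by_cases hj : j' = j
      · subst hj
        simp [Function.update_apply]
      · simp [hj]
    · exact hx
    · exact ht
  all_goals
    simp only [Op.Safe] at ho
    constructor <;> intros <;>
      simp_all [Op.code, Op.eff, Instr.run, State.writeI, State.writeX, Function.update_apply,
        reg_inj, creg_inj, entry_ne_reg, ne_creg, creg_ne]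

theorem Cond.run_code {P : Program} {σ : State} {m : Mem} (h : Rel σ m) (c : Cond) (l₁ l₂ : ℕ)
    (hc : CodeAt P σ.pc (c.code σ.pc l₁ l₂)) :
    ∃ σ', Run P σ 4 σ' ∧ Rel σ' m ∧ (c.Holds m → σ'.pc = l₁) ∧ (¬ c.Holds m → σ'.pc = l₂) := by
  have hrel : ∀ pc, Rel ⟨pc, σ.I, σ.X⟩ m := fun pc => ⟨h.v, h.a, h.x, h.t⟩
  obtain ⟨hv, ha, hx, ht⟩ := h
  cases c with
  | lt a b =>
    simp only [code] at hc
    simp only [Holds, ← hv]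
    by_cases hlt : σ.I (reg a) < σ.I (reg b)
    · have s1 := Run.step hc.head
      simp only [Instr.run, State.branch, not_le.2 hlt, if_false] at s1
      have s2 := Run.step (σ := ⟨σ.pc + 1, σ.I, σ.X⟩) hc.tail.head
      simp only [Instr.run, State.branch, if_true] at s2
      exact ⟨_, (s1.trans s2).mono (by norm_num), hrel _, fun _ => rfl, fun hn => absurd hlt hn⟩
    · have s1 := Run.step hc.head
      simp only [Instr.run, State.branch, not_lt.1 hlt, if_true] at s1
      exact ⟨_, s1.mono (by norm_num), hrel _, fun hn => absurd hn hlt, fun _ => rfl⟩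
  | eq a b =>
    simp only [code] at hc
    simp only [Holds, ← hv]
    have s1 := Run.step hc.head
    by_cases hle : σ.I (reg a) ≤ σ.I (reg b)
    · simp only [Instr.run, State.branch, hle, if_true] at s1
      have s2 := Run.step (σ := ⟨σ.pc + 2, σ.I, σ.X⟩) hc.tail.tail.head
      by_cases hle' : σ.I (reg b) ≤ σ.I (reg a)
      · simp only [Instr.run, State.branch, hle', if_true] at s2
        exact ⟨_, (s1.trans s2).mono (by norm_num), hrel _, fun _ => rfl,
          fun hn => absurd (le_antisymm hle hle') hn⟩
      · simp only [Instr.run, State.branch, hle', if_false] at s2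
        have s3 := Run.step (σ := ⟨σ.pc + 2 + 1, σ.I, σ.X⟩) hc.tail.tail.tail.head
        simp only [Instr.run, State.branch, if_true] at s3
        exact ⟨_, ((s1.trans s2).trans s3).mono (by norm_num), hrel _,
          fun hn => absurd hn.ge hle', fun _ => rfl⟩
    · simp only [Instr.run, State.branch, hle, if_false] at s1
      have s2 := Run.step (σ := ⟨σ.pc + 1, σ.I, σ.X⟩) hc.tail.head
      simp only [Instr.run, State.branch, if_true] at s2
      exact ⟨_, (s1.trans s2).mono (by norm_num), hrel _, fun hn => absurd hn.le hle,
        fun _ => rfl⟩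
  | xeq a b =>
    simp only [code] at hc
    simp only [Holds, ← hx]
    have s1 := Run.step hc.head
    by_cases he : σ.X (creg a) = σ.X (creg b)
    · simp only [Instr.run, State.branch, he, if_true] at s1
      exact ⟨_, s1.mono (by norm_num), hrel _, fun _ => rfl, fun hn => absurd he hn⟩
    · simp only [Instr.run, State.branch, he, if_false] at s1
      have s2 := Run.step (σ := ⟨σ.pc + 1, σ.I, σ.X⟩) hc.tail.head
      simp only [Instr.run, State.branch, if_true] at s2
      exact ⟨_, (s1.trans s2).mono (by norm_num), hrel _, fun hn => absurd hn he, fun _ => rfl⟩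

theorem run_jump {P : Program} {σ : State} {m : Mem} (h : Rel σ m) {l : ℕ}
    (hc : P[σ.pc]? = some (.jump l)) : ∃ σ', Run P σ 1 σ' ∧ Rel σ' m ∧ σ'.pc = l := by
  refine ⟨_, Run.step hc, ⟨h.v, h.a, h.x, h.t⟩, ?_⟩
  simp [Instr.run, State.branch]

/-- The machine code of a command simulates its execution. -/
theorem Exec.run {c : Com} {m m' : Mem} {k : ℕ} (h : Exec c m k m') {P : Program} {σ : State}
    (hc : CodeAt P σ.pc (c.code σ.pc)) (hσ : Rel σ m) :
    ∃ σ', Run P σ (6 * k) σ' ∧ Rel σ' m' ∧ σ'.pc = σ.pc + c.len := by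
  induction h generalizing σ with
  | nil m => exact ⟨σ, Run.refl _ _ _, hσ, rfl⟩
  | @cons o l m k m' ho _ ih =>
    simp only [Com.code, List.flatMap_cons] at hc
    obtain ⟨r1, p1⟩ := run_straight o.isStraight_code hc.left
    obtain ⟨σ', r2, hσ', p2⟩ := ih (by rw [p1]; exact hc.right) (o.rel_run hσ ho)
    -- Array accesses are the longest operations: five instructions for the address and one for the
    -- access. A condition takes at most four steps and a closing jump one, so the factor `6` covers
    -- those as well.
    have hlen : o.code.length ≤ 6 := by cases o <;> simp [Op.code, addrCode]
    refine ⟨σ', (r1.trans r2).mono (by omega), hσ', ?_⟩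
    rw [p2, p1]
    simp [Com.len, add_assoc]
  | @seq c₁ c₂ m k₁ m' k₂ m'' _ _ ih₁ ih₂ =>
    simp only [Com.code] at hc
    obtain ⟨σ₁, r1, hσ₁, p1⟩ := ih₁ hc.left hσ
    have hc2 := hc.right
    rw [Com.length_code, ← p1] at hc2
    obtain ⟨σ₂, r2, hσ₂, p2⟩ := ih₂ hc2 hσ₁
    refine ⟨σ₂, (r1.trans r2).mono (by omega), hσ₂, ?_⟩
    rw [p2, p1, Com.len, add_assoc]
  | @ite_true b c₁ c₂ m k m' hb _ ih =>
    simp only [Com.code] at hc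
    obtain ⟨σ₀, r0, hσ₀, p0, -⟩ := b.run_code hσ _ _ hc.left
    have p0 := p0 hb
    have hc1 := hc.right
    rw [Cond.length_code, ← p0] at hc1
    obtain ⟨σ₁, r1, hσ₁, p1⟩ := ih hc1.left hσ₀
    have hc2 := hc1.right
    rw [Com.length_code, ← p1] at hc2
    obtain ⟨σ₂, r2, hσ₂, p2⟩ := run_jump hσ₁ hc2.head
    refine ⟨σ₂, ((r0.trans r1).trans r2).mono (by omega), hσ₂, ?_⟩
    rw [p2, p1, p0, Com.len]
    ring
  | @ite_false b c₁ c₂ m k m' hb _ ih =>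
    simp only [Com.code] at hc
    obtain ⟨σ₀, r0, hσ₀, -, p0⟩ := b.run_code hσ _ _ hc.left
    have p0 := p0 hb
    have hc1 := hc.right
    rw [Cond.length_code] at hc1
    have hc2 := hc1.right.tail
    rw [Com.length_code, ← p0] at hc2
    obtain ⟨σ₁, r1, hσ₁, p1⟩ := ih hc2 hσ₀
    refine ⟨σ₁, (r0.trans r1).mono (by omega), hσ₁, ?_⟩
    rw [p1, p0, Com.len]
    ring
  | @loop_true b c m k m' k' m'' hb _ _ ih₁ ih₂ =>
    have hc0 := hc
    simp only [Com.code] at hc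
    obtain ⟨σ₀, r0, hσ₀, p0, -⟩ := b.run_code hσ _ _ hc.left
    have p0 := p0 hb
    have hc1 := hc.right
    rw [Cond.length_code, ← p0] at hc1
    obtain ⟨σ₁, r1, hσ₁, p1⟩ := ih₁ hc1.left hσ₀
    have hc2 := hc1.right
    rw [Com.length_code, ← p1] at hc2
    obtain ⟨σ₂, r2, hσ₂, p2⟩ := run_jump hσ₁ hc2.head
    rw [← p2] at hc0
    obtain ⟨σ₃, r3, hσ₃, p3⟩ := ih₂ hc0 hσ₂
    refine ⟨σ₃, (((r0.trans r1).trans r2).trans r3).mono (by omega), hσ₃, ?_⟩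
    rw [p3, p2]
  | @loop_false b c m hb =>
    simp only [Com.code] at hc
    obtain ⟨σ₀, r0, hσ₀, -, p0⟩ := b.run_code hσ _ _ hc.left
    refine ⟨σ₀, r0.mono (by omega), hσ₀, ?_⟩
    rw [p0 hb, Com.len]
    ring

/-! ### Specifications -/

/-- From `m`, the command terminates with cost at most `T` in a memory that satisfies `Q`. -/
def Spec (c : Com) (m : Mem) (T : ℕ) (Q : Mem → Prop) : Prop :=
  ∃ k ≤ T, ∃ m', Exec c m k m' ∧ Q m'

theorem Spec.mono {c : Com} {m : Mem} {T T' : ℕ} {Q Q' : Mem → Prop} (h : Spec c m T Q)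
    (hT : T ≤ T') (hQ : ∀ m', Q m' → Q' m') : Spec c m T' Q' := by
  obtain ⟨k, hk, m', he, hq⟩ := h
  exact ⟨k, hk.trans hT, m', he, hQ _ hq⟩

theorem Spec.nil {m : Mem} {T : ℕ} {Q : Mem → Prop} (h : Q m) : Spec (.block []) m T Q :=
  ⟨0, Nat.zero_le _, m, Exec.nil m, h⟩

theorem Spec.cons {o : Op} {l : List Op} {m : Mem} {T : ℕ} {Q : Mem → Prop} (ho : o.Safe m)
    (h : Spec (.block l) (o.eff m) T Q) : Spec (.block (o :: l)) m (T + 1) Q := by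
  obtain ⟨k, hk, m', he, hq⟩ := h
  exact ⟨k + 1, by omega, m', Exec.cons ho he, hq⟩

theorem Spec.seq {c₁ c₂ : Com} {m : Mem} {T₁ T₂ : ℕ} {Q R : Mem → Prop} (h₁ : Spec c₁ m T₁ R)
    (h₂ : ∀ m', R m' → Spec c₂ m' T₂ Q) : Spec (.seq c₁ c₂) m (T₁ + T₂) Q := by
  obtain ⟨k, hk, m', he, hr⟩ := h₁
  obtain ⟨k', hk', m'', he', hq⟩ := h₂ m' hr
  exact ⟨k + k', by omega, m'', Exec.seq he he', hq⟩

theorem Spec.ite {b : Cond} {c₁ c₂ : Com} {m : Mem} {T : ℕ} {Q : Mem → Prop}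
    (h₁ : b.Holds m → Spec c₁ m T Q) (h₂ : ¬ b.Holds m → Spec c₂ m T Q) :
    Spec (.ite b c₁ c₂) m (T + 1) Q := by
  by_cases hb : b.Holds m
  · obtain ⟨k, hk, m', he, hq⟩ := h₁ hb
    exact ⟨k + 1, by omega, m', Exec.ite_true hb he, hq⟩
  · obtain ⟨k, hk, m', he, hq⟩ := h₂ hb
    exact ⟨k + 1, by omega, m', Exec.ite_false hb he, hq⟩

/-- A loop whose body decreases the number `i` of the invariant `Inv i`. -/
theorem Spec.loop {b : Cond} {c : Com} {T : ℕ} {Inv : ℕ → Mem → Prop}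
    (h : ∀ i m, Inv i m → b.Holds m → ∃ j < i, Spec c m T (Inv j)) {i : ℕ} {m : Mem}
    (hm : Inv i m) :
    Spec (.loop b c) m (i * (T + 1) + 1) fun m' => (∃ j, Inv j m') ∧ ¬ b.Holds m' := by
  induction i using Nat.strong_induction_on generalizing m with
  | _ i ih =>
    by_cases hb : b.Holds m
    · obtain ⟨j, hj, k, hk, m', he, hq⟩ := h i m hm hb
      obtain ⟨k', hk', m'', he', hq'⟩ := ih j hj hq
      refine ⟨k + k' + 1, ?_, m'', Exec.loop_true hb he he', hq'⟩
      have : (j + 1) * (T + 1) ≤ i * (T + 1) := Nat.mul_le_mul_right _ hj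
      nlinarith
    · exact ⟨1, by omega, m, Exec.loop_false hb, ⟨i, hm⟩, hb⟩

end AlgebraicRAM

/-! ### The decision procedure on numbered words -/

namespace Decision

/-- The number of states, the size of the neighborhood, and the number of the quiescent state. -/
structure Params where
  /-- number of states -/
  s : ℕ
  /-- size of the neighborhood -/
  r : ℕ
  /-- quiescent state -/
  q : ℕ
  two_le_s : 2 ≤ s
  one_le_r : 1 ≤ r
  q_lt : q < s

namespace Params

variable (p : Params)

/-- The number of words of length `r - 1`. -/
def z : ℕ := p.s ^ (p.r - 1)

/-- The number of words of length `r`. -/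
def w : ℕ := p.s ^ p.r

/-- The size of the table. -/
def n : ℕ := p.s ^ (p.r + 1)

theorem s_pos : 0 < p.s := by have := p.two_le_s; omega

theorem z_pos : 0 < p.z := pow_pos p.s_pos _

theorem w_eq : p.w = p.s * p.z := by
  have := p.one_le_r
  rw [w, z, ← pow_succ', Nat.sub_add_cancel this]

theorem n_eq : p.n = p.s * p.w := pow_succ' _ _

theorem w_pos : 0 < p.w := pow_pos p.s_pos _

/-- This needs at least two states, and it allows loops over `r` to be charged to the number of
words. -/
theorem r_le_w : p.r ≤ p.w := (Nat.lt_pow_self p.two_le_s).le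

theorem div_lt {W : ℕ} (h : W < p.w) : W / p.s < p.z :=
  Nat.div_lt_of_lt_mul (by rwa [← w_eq])

/-- The number of the word obtained by dropping the last letter and putting `q` in front. -/
def tin (W : ℕ) : ℕ := p.q + p.s * (W % p.z)

theorem tin_lt (W : ℕ) : p.tin W < p.w := by
  have h1 := Nat.mod_lt W p.z_pos
  have h2 := p.q_lt
  rw [tin, w_eq]
  nlinarith

/-- `tin` forgets exactly the last letter. Its table therefore also decides whether two words agree
in all other letters, that is, whether they can follow equal words. -/
theorem tin_inj {W U : ℕ} : p.tin W = p.tin U ↔ W % p.z = U % p.z := by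
  rw [tin, tin, Nat.add_left_cancel_iff, Nat.mul_right_inj p.s_pos.ne']

end Params

/-- The machine has no integer division. Remainders and quotients are tabulated by counters that are
updated as `W` grows by one. -/
theorem succ_mod_eq {k W : ℕ} (hk : 0 < k) :
    (W + 1) % k = if W % k + 1 < k then W % k + 1 else 0 := by
  have h := Nat.mod_lt W hk
  have e : W + 1 = k * (W / k) + (W % k + 1) := by rw [← add_assoc, Nat.div_add_mod]
  conv_lhs => rw [e, Nat.mul_add_mod]
  split_ifs with hlt
  · exact Nat.mod_eq_of_lt hlt
  · rw [show W % k + 1 = k by omega, Nat.mod_self]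

theorem succ_div_eq {k W : ℕ} (hk : 0 < k) :
    (W + 1) / k = if W % k + 1 < k then W / k else W / k + 1 := by
  have h := Nat.mod_lt W hk
  have e : W + 1 = k * (W / k) + (W % k + 1) := by rw [← add_assoc, Nat.div_add_mod]
  conv_lhs => rw [e, Nat.mul_add_div hk]
  split_ifs with hlt
  · rw [Nat.div_eq_of_lt hlt, add_zero]
  · rw [show W % k + 1 = k by omega, Nat.div_self hk]

theorem Params.tin_succ (p : Params) (W : ℕ) :
    p.tin (W + 1) = if p.tin W + p.s < p.w then p.tin W + p.s else p.tin W + p.s - p.w := by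
  have h := Nat.mod_lt W p.z_pos
  have hq := p.q_lt
  simp only [tin, succ_mod_eq p.z_pos, w_eq]
  by_cases hlt : W % p.z + 1 < p.z
  · rw [if_pos hlt, if_pos]
    · ring
    · nlinarith
  · have e : W % p.z + 1 = p.z := by omega
    have e2 : p.q + p.s * (W % p.z) + p.s = p.q + p.s * p.z := by
      rw [add_assoc, ← Nat.mul_succ, Nat.succ_eq_add_one, e]
    rw [if_neg hlt, if_neg, e2]
    · simp
    · rw [e2]
      omega

theorem pair_index_inj {k i j i' j' : ℕ} (hj : j < k) (hj' : j' < k) :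
    i * k + j = i' * k + j' ↔ i = i' ∧ j = j' := by
  refine ⟨fun h => ?_, fun h => by rw [h.1, h.2]⟩
  have hk : 0 < k := by omega
  have h1 := congrArg (· / k) h
  have h2 := congrArg (· % k) h
  simp only [Nat.mul_comm _ k, Nat.mul_add_div hk, Nat.mul_add_mod, Nat.div_eq_of_lt hj,
    Nat.div_eq_of_lt hj', Nat.mod_eq_of_lt hj, Nat.mod_eq_of_lt hj'] at h1 h2
  omega

variable (p : Params) (G : ℕ → ℕ → ℂ)

/-- A pair of different words with nonorthogonal values. -/
def Node (i j : ℕ) : Prop := i < p.w ∧ j < p.w ∧ i ≠ j ∧ G i j ≠ 0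

/-- Reachability of pairs of different words from pairs of equal words. -/
inductive NReach : ℕ → ℕ → Prop
  | base {i j} : Node p G i j → i % p.z = j % p.z → NReach i j
  | step {i j i' j'} : NReach i j → Node p G i' j' → i' % p.z = i / p.s → j' % p.z = j / p.s →
      NReach i' j'

/-- The weight of a numbered word. -/
noncomputable def nweight (W : ℕ) : ℂ :=
  ∏ j ∈ Finset.range p.r, G ((p.tin)^[j] W) ((p.tin)^[j] W)

/-- The norms of the local values do not cancel. -/
def BadNorm : Prop := ∃ W < p.w, nweight p G W ≠ nweight p G (p.tin (W / p.s))

/-- Equal words lead to equal words through different words. -/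
def BadPair : Prop := ∃ i j, NReach p G i j ∧ i / p.s = j / p.s

variable {p G}

theorem NReach.node {i j : ℕ} (h : NReach p G i j) : Node p G i j := by
  cases h <;> assumption

/-- All successors of `(i, j)` have been found. -/
def Closed (p : Params) (G : ℕ → ℕ → ℂ) (av : Finset (ℕ × ℕ)) (bad : Prop) (i j : ℕ) : Prop :=
  (∀ i' j', Node p G i' j' → i' % p.z = i / p.s → j' % p.z = j / p.s → (i', j') ∉ av) ∧
    (i / p.s = j / p.s → bad)

/-- The invariant of the search with stack `L`, set `av` of pairs that have not been found, and
set `ex` of pairs that are being processed. -/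
structure SearchInv (p : Params) (G : ℕ → ℕ → ℂ) (L : List (ℕ × ℕ)) (av : Finset (ℕ × ℕ))
    (ex : ℕ → ℕ → Prop) (bad : Prop) : Prop where
  reach : ∀ i j, (i, j) ∈ L → NReach p G i j
  base : ∀ i j, Node p G i j → i % p.z = j % p.z → (i, j) ∉ av
  closed : ∀ i j, Node p G i j → (i, j) ∉ av → (i, j) ∈ L ∨ ex i j ∨ Closed p G av bad i j
  sound : bad → BadNorm p G ∨ BadPair p G
  norm : BadNorm p G → bad

theorem Closed.mono {av av' : Finset (ℕ × ℕ)} {bad bad' : Prop} {i j : ℕ}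
    (h : Closed p G av bad i j) (hav : av' ⊆ av) (hbad : bad → bad') : Closed p G av' bad' i j :=
  ⟨fun i' j' h1 h2 h3 h4 => h.1 i' j' h1 h2 h3 (hav h4), fun h1 => hbad (h.2 h1)⟩

/-- When the stack is empty, every node that has been found is closed. By induction along `NReach`
all reachable pairs have then been found, and a reachable pair with equal tails has set the flag. -/
theorem SearchInv.bad_iff {av : Finset (ℕ × ℕ)} {bad : Prop}
    (h : SearchInv p G [] av (fun _ _ => False) bad) : bad ↔ BadNorm p G ∨ BadPair p G := by
  have hcl : ∀ i j, Node p G i j → (i, j) ∉ av → Closed p G av bad i j := fun i j h1 h2 => by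
    simpa using h.closed i j h1 h2
  have key : ∀ i j, NReach p G i j → (i, j) ∉ av := by
    intro i j hR
    induction hR with
    | base h1 h2 => exact h.base _ _ h1 h2
    | step h1 h2 h3 h4 ih => exact (hcl _ _ h1.node ih).1 _ _ h2 h3 h4
  refine ⟨h.sound, ?_⟩
  rintro (h1 | ⟨i, j, h1, h2⟩)
  · exact h.norm h1
  · exact (hcl i j h1.node (key i j h1)).2 h2

/-- The popped pair becomes the one that need not be closed yet. The flag may be raised only if its
tails agree, and then the pair itself is a witness of `BadPair`. -/
theorem SearchInv.pop {L : List (ℕ × ℕ)} {av : Finset (ℕ × ℕ)} {bad bad' : Prop} {i j : ℕ}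
    (h : SearchInv p G ((i, j) :: L) av (fun _ _ => False) bad)
    (h2 : i / p.s ≠ j / p.s → (bad' ↔ bad)) (h3 : bad → bad') :
    SearchInv p G L av (fun i' j' => (i', j') = (i, j)) bad' where
  reach i' j' hm := h.reach i' j' (List.mem_cons_of_mem _ hm)
  base := h.base
  closed i' j' hn hm := by
    rcases h.closed i' j' hn hm with h | h | h
    · rcases List.mem_cons.1 h with h | h
      · exact Or.inr (Or.inl h)
      · exact Or.inl h
    · exact h.elim
    · exact Or.inr (Or.inr (h.mono subset_rfl h3))
  sound hb := by
    by_cases he : i / p.s = j / p.s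
    · exact Or.inr ⟨i, j, h.reach i j (by simp), he⟩
    · exact h.sound ((h2 he).1 hb)
  norm hb := h3 (h.norm hb)

theorem SearchInv.push {L : List (ℕ × ℕ)} {av : Finset (ℕ × ℕ)} {bad : Prop}
    {ex : ℕ → ℕ → Prop} {i j : ℕ} (h : SearchInv p G L av ex bad) (hR : NReach p G i j) :
    SearchInv p G ((i, j) :: L) (av.erase (i, j)) ex bad where
  reach i' j' hm := by
    rcases List.mem_cons.1 hm with hm | hm
    · obtain ⟨rfl, rfl⟩ := Prod.mk.inj hm
      exact hR
    · exact h.reach i' j' hm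
  base i' j' h1 h2 h3 := h.base i' j' h1 h2 (Finset.mem_of_mem_erase h3)
  closed i' j' hn hm := by
    by_cases he : (i', j') = (i, j)
    · exact Or.inl (by simp [he])
    · have hm' : (i', j') ∉ av := fun h => hm (Finset.mem_erase.2 ⟨he, h⟩)
      rcases h.closed i' j' hn hm' with h | h | h
      · exact Or.inl (List.mem_cons_of_mem _ h)
      · exact Or.inr (Or.inl h)
      · exact Or.inr (Or.inr (h.mono (Finset.erase_subset _ _) id))
  sound := h.sound
  norm := h.norm

theorem SearchInv.done {L : List (ℕ × ℕ)} {av : Finset (ℕ × ℕ)} {bad : Prop} {i j : ℕ}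
    (h : SearchInv p G L av (fun i' j' => (i', j') = (i, j)) bad) (hc : Closed p G av bad i j) :
    SearchInv p G L av (fun _ _ => False) bad where
  reach := h.reach
  base := h.base
  closed i' j' hn hm := by
    rcases h.closed i' j' hn hm with h | h | h
    · exact Or.inl h
    · obtain ⟨rfl, rfl⟩ := Prod.mk.inj h
      exact Or.inr (Or.inr hc)
    · exact Or.inr (Or.inr h)
  sound := h.sound
  norm := h.norm

end Decision

/-! ### Straight-line blocks of operations. -/

namespace AlgebraicRAM

/-- All operations of the list can be executed safely. -/
def SafeAll : List Op → Mem → Prop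
  | [], _ => True
  | o :: l, m => o.Safe m ∧ SafeAll l (o.eff m)

theorem Spec.block {l : List Op} {m : Mem} {T : ℕ} {Q : Mem → Prop} (hT : l.length ≤ T)
    (hs : SafeAll l m) (h : Q (l.foldl (fun m o => o.eff m) m)) : Spec (.block l) m T Q := by
  induction l generalizing m T with
  | nil => exact Spec.nil h
  | cons o l ih =>
    obtain ⟨T, rfl⟩ : ∃ T', T = T' + 1 := ⟨T - 1, by simp at hT; omega⟩
    exact Spec.cons hs.1 (ih (by simpa using hT) hs.2 h)

theorem Spec.seq_le {c₁ c₂ : Com} {m : Mem} {T : ℕ} {Q : Mem → Prop} (T₁ T₂ : ℕ)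
    (R : Mem → Prop) (h₁ : Spec c₁ m T₁ R) (h₂ : ∀ m', R m' → Spec c₂ m' T₂ Q)
    (hT : T₁ + T₂ ≤ T) : Spec (.seq c₁ c₂) m T Q :=
  (Spec.seq h₁ h₂).mono hT fun _ => id

end AlgebraicRAM

/-! ### The graph search and its running time. -/

namespace Decision

open AlgebraicRAM

/-- The variables `0` to `7` hold `s`, `r`, `q`, `z`, `w`, `n`, `1`, `0`. -/
structure Consts (p : Params) (v : ℕ → ℤ) : Prop where
  s : v 0 = p.s
  r : v 1 = p.r
  q : v 2 = p.q
  z : v 3 = p.z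
  w : v 4 = p.w
  n : v 5 = p.n
  one : v 6 = 1
  zero : v 7 = 0

theorem Consts.congr {p : Params} {v v' : ℕ → ℤ} (h : Consts p v) (hv : ∀ k ≤ 7, v' k = v k) :
    Consts p v' where
  s := (hv 0 (by norm_num)).trans h.s
  r := (hv 1 (by norm_num)).trans h.r
  q := (hv 2 (by norm_num)).trans h.q
  z := (hv 3 (by norm_num)).trans h.z
  w := (hv 4 (by norm_num)).trans h.w
  n := (hv 5 (by norm_num)).trans h.n
  one := (hv 6 (by norm_num)).trans h.one
  zero := (hv 7 (by norm_num)).trans h.zero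

/-- The arrays `0`, `1`, `2` tabulate `tin W`, `W / s`, `W * w`. -/
def Tables (p : Params) (N : ℕ) (a : Fin 7 → ℤ → ℤ) : Prop :=
  ∀ W : ℕ, W < N → a 0 W = p.tin W ∧ a 1 W = (W / p.s : ℕ) ∧ a 2 W = (W * p.w : ℕ)

/-- The arrays hold the two components of the entries of the stack. -/
def StackRep (a b : ℤ → ℤ) : List (ℕ × ℕ) → Prop
  | [] => True
  | x :: L => a L.length = x.1 ∧ b L.length = x.2 ∧ StackRep a b L

theorem StackRep.update {a b : ℤ → ℤ} {L : List (ℕ × ℕ)} (h : StackRep a b L) {k : ℤ}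
    (hk : L.length ≤ k) (x y : ℤ) :
    StackRep (Function.update a k x) (Function.update b k y) L := by
  induction L with
  | nil => trivial
  | cons c L ih =>
    simp only [List.length_cons, Nat.cast_add, Nat.cast_one] at hk
    refine ⟨?_, ?_, ih h.2.2 (by omega)⟩
    · rw [Function.update_of_ne (by omega), h.1]
    · rw [Function.update_of_ne (by omega), h.2.1]

theorem StackRep.push {a b : ℤ → ℤ} {L : List (ℕ × ℕ)} (h : StackRep a b L) (i j : ℕ) :
    StackRep (Function.update a L.length i) (Function.update b L.length j) ((i, j) :: L) :=
  ⟨by simp, by simp, h.update le_rfl _ _⟩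

/-- The memory represents the stack `L` and the set `av` of available pairs. -/
structure SearchRep (p : Params) (L : List (ℕ × ℕ)) (av : Finset (ℕ × ℕ)) (m : Mem) : Prop where
  consts : Consts p m.v
  tables : Tables p p.w m.a
  sp : m.v 10 = L.length
  stack : StackRep (m.a 4) (m.a 5) L
  avail : ∀ i j, i < p.w → j < p.w →
    m.a 3 ((i * p.w + j : ℕ) : ℤ) = if (i, j) ∈ av then 1 else 0

theorem SearchRep.congr {p : Params} {L : List (ℕ × ℕ)} {av : Finset (ℕ × ℕ)} {m m' : Mem}
    (h : SearchRep p L av m) (hv : ∀ k ≤ 10, m'.v k = m.v k) (ha : m'.a = m.a) :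
    SearchRep p L av m' where
  consts := h.consts.congr fun k hk => hv k (by omega)
  tables := ha ▸ h.tables
  sp := (hv 10 le_rfl).trans h.sp
  stack := ha ▸ h.stack
  avail := ha ▸ h.avail

/-- Visit the pairs `(u, u')` where `u` is in variable `20` and `u'` starts from variable `21`. -/
def visitLoop : Com :=
  .loop (.lt 21 4) <|
    .seq (.block [.add 15 12 21, .load 23 3 15]) <|
    .seq (.ite (.lt 7 23)
      (.block [.store 3 15 7, .store 4 10 20, .store 5 10 21, .add 10 10 6])
      (.block [])) <|
    .block [.add 21 21 3]

/-- Visit the successors of a pair. -/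
def succLoop : Com :=
  .loop (.lt 20 4) <|
    .seq (.block [.load 12 2 20, .add 21 22 7]) <|
    .seq visitLoop <|
    .block [.add 20 20 3]

/-- Empty the stack. -/
def searchLoop : Com :=
  .loop (.lt 7 10) <|
    .seq (.block [.sub 10 10 6, .load 9 4 10, .load 11 5 10, .load 20 1 9, .load 22 1 11]) <|
    .seq (.ite (.eq 20 22) (.block [.const 8 1]) (.block [])) succLoop

/-- The state of the search while the pair `(W, W')` is being processed and the successors
that satisfy `done` have been visited. -/
structure VisitInv (p : Params) (G : ℕ → ℕ → ℂ) (f : ℤ) (W W' μ : ℕ) (done : ℕ → ℕ → Prop)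
    (m : Mem) (L : List (ℕ × ℕ)) (av : Finset (ℕ × ℕ)) : Prop where
  rep : SearchRep p L av m
  flag : m.v 8 = f
  out : m.v 22 = (W' / p.s : ℕ)
  inv : SearchInv p G L av (fun i j => (i, j) = (W, W')) (0 < f)
  measure : L.length + av.card = μ
  nodes : ∀ i j, (i, j) ∈ av → Node p G i j
  visited : ∀ i j, Node p G i j → i % p.z = W / p.s → j % p.z = W' / p.s → done i j → (i, j) ∉ av

theorem VisitInv.congr {p : Params} {G : ℕ → ℕ → ℂ} {f : ℤ} {W W' μ : ℕ}
    {done done' : ℕ → ℕ → Prop} {m m' : Mem} {L : List (ℕ × ℕ)} {av : Finset (ℕ × ℕ)}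
    (h : VisitInv p G f W W' μ done m L av) (hv : ∀ k ≤ 10, m'.v k = m.v k) (ha : m'.a = m.a)
    (ho : m'.v 22 = m.v 22)
    (hd : ∀ i j, Node p G i j → i % p.z = W / p.s → j % p.z = W' / p.s → done' i j →
      (i, j) ∈ av → done i j) :
    VisitInv p G f W W' μ done' m' L av where
  rep := h.rep.congr hv ha
  flag := (hv 8 (by norm_num)).trans h.flag
  out := ho.trans h.out
  inv := h.inv
  measure := h.measure
  nodes := h.nodes
  visited i j h1 h2 h3 h4 h5 := h.visited i j h1 h2 h3 (hd i j h1 h2 h3 h4 h5) h5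

/-- The words that can follow `W'` form the arithmetic progression `W' / s + b * z` with `b < s`,
because `w = s * z`. They are enumerated by repeated addition of `z`. -/
theorem spec_visitLoop {p : Params} {G : ℕ → ℕ → ℂ} {f : ℤ} {W W' μ u : ℕ} {m : Mem}
    {L : List (ℕ × ℕ)} {av : Finset (ℕ × ℕ)} (hR : NReach p G W W') (hu : u < p.w)
    (hu2 : u % p.z = W / p.s) (h : VisitInv p G f W W' μ (fun i _ => i < u) m L av)
    (h20 : m.v 20 = u) (h21 : m.v 21 = (W' / p.s : ℕ)) (h12 : m.v 12 = (u * p.w : ℕ)) :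
    Spec visitLoop m (p.s * 9 + 1) fun m' =>
      (∃ L av, VisitInv p G f W W' μ (fun i _ => i ≤ u) m' L av) ∧ m'.v 20 = u := by
  have hd := p.div_lt hR.node.2.1
  have hw := p.w_eq
  refine (Spec.loop (T := 8) (i := p.s) (Inv := fun k m => ∃ b L av, b + k = p.s ∧
    m.v 20 = u ∧ m.v 21 = (W' / p.s + b * p.z : ℕ) ∧ m.v 12 = (u * p.w : ℕ) ∧
    VisitInv p G f W W' μ (fun i j => i < u ∨ i = u ∧ j < W' / p.s + b * p.z) m L av) ?_
    ⟨0, L, av, by simp, h20, by simpa using h21, h12, h.congr (fun _ _ => rfl) rfl rfl ?_⟩).mono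
    (by simp) ?_
  · rintro k m ⟨b, L, av, hbk, h20, h21, h12, hI⟩ hlt
    have hc := hI.rep.consts
    simp only [Cond.Holds, h21, hc.w, Nat.cast_lt] at hlt
    have hb : b < p.s := by
      by_contra hge
      have : p.s * p.z ≤ b * p.z := Nat.mul_le_mul_right _ (not_lt.1 hge)
      rw [← hw] at this
      exact absurd (this.trans (Nat.le_add_left _ _)) (not_le.2 hlt)
    set u' := W' / p.s + b * p.z with hu'
    have hu'2 : u' % p.z = W' / p.s := by
      rw [hu', Nat.add_mul_mod_self_right, Nat.mod_eq_of_lt hd]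
    have hnext : ((u' : ℕ) : ℤ) + p.z = ((W' / p.s + (b + 1) * p.z : ℕ) : ℤ) := by
      rw [hu']
      push_cast
      ring
    -- The only number of the right residue between `u'` and `u' + z` is `u'` itself.
    have hstep : ∀ i j, j % p.z = W' / p.s →
        (i < u ∨ i = u ∧ j < W' / p.s + (b + 1) * p.z) →
        (i < u ∨ i = u ∧ j < u') ∨ (i, j) = (u, u') := by
      rintro i j hj (hij | ⟨rfl, hij⟩)
      · exact Or.inl (Or.inl hij)
      · rcases lt_trichotomy j u' with h1 | rfl | h1
        · exact Or.inl (Or.inr ⟨rfl, h1⟩)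
        · exact Or.inr rfl
        · exfalso
          have e1 : (W' / p.s + (b + 1) * p.z) = u' + p.z := by rw [hu']; ring
          rw [e1] at hij
          have e2 : (j - u') % p.z = 0 :=
            Nat.sub_mod_eq_zero_of_mod_eq (by rw [hj, hu'2])
          rw [Nat.mod_eq_of_lt (by omega)] at e2
          omega
    have hread : m.a 3 ((u : ℤ) * p.w + u') = if (u, u') ∈ av then 1 else 0 := by
      rw [← hI.rep.avail u u' hu hlt]
      push_cast
      rfl
    refine ⟨k - 1, by omega, ?_⟩
    refine Spec.seq_le 2 6 (fun m' => m' = ⟨Function.update (Function.update m.v 15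
      ((u : ℤ) * p.w + u')) 23 (if (u, u') ∈ av then 1 else 0), m.a, m.x, m.t⟩)
      (Spec.block (by simp) (by simp [SafeAll, Op.Safe]) ?_) ?_ (by norm_num)
    · simp [Op.eff, h12, h21, hread]
    rintro m' rfl
    by_cases hav : (u, u') ∈ av
    · refine Spec.seq_le 5 1 (fun m' => ∃ v a x t, m' = ⟨v, a, x, t⟩ ∧ v 20 = u ∧ v 21 = u' ∧
        v 12 = (u * p.w : ℕ) ∧ VisitInv p G f W W' μ
        (fun i j => i < u ∨ i = u ∧ j < W' / p.s + (b + 1) * p.z) ⟨v, a, x, t⟩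
        ((u, u') :: L) (av.erase (u, u'))) (Spec.ite (T := 4) (fun _ => Spec.block (by simp)
          (by simp [SafeAll, Op.Safe]) ?_) (fun hn => ?_)) ?_ (by norm_num)
      · simp only [List.foldl_cons, List.foldl_nil, Op.eff]
        refine ⟨_, _, _, _, rfl, ?_, ?_, ?_, ⟨⟨hc.congr ?_, ?_, ?_, ?_, ?_⟩, ?_, ?_, ?_, ?_, ?_, ?_⟩⟩
        · simp [h20]
        · simp [h21]
        · simp [h12]
        · intro k hk
          simp only [Function.update_apply]
          split_ifs <;> omega
        · intro i hi
          simpa [Function.update_apply] using hI.rep.tables i hi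
        · simp [hI.rep.sp, hc.one]
        · have := hI.rep.stack.push u u'
          simpa [Function.update_apply, hI.rep.sp, h20, h21] using this
        · intro i j hi hj
          have e : ((i * p.w + j : ℕ) : ℤ) = (u : ℤ) * p.w + u' ↔ (i, j) = (u, u') := by
            rw [Prod.mk.injEq, ← pair_index_inj hj hlt]
            norm_cast
          have := hI.rep.avail i j hi hj
          by_cases hij : (i, j) = (u, u')
          · have e' := e.2 hij
            simp [e', hc.zero, hij]
          · have e' := mt e.1 hij
            rw [← ne_eq] at e'
            simp only [Nat.cast_add, Nat.cast_mul] at e' this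
            simp only [Prod.mk.injEq] at hij
            simp [Function.update_of_ne e', this, hij]
        · simp [hI.flag]
        · simp [hI.out]
        · exact hI.inv.push (hR.step (hI.nodes _ _ hav) hu2 hu'2)
        -- A push moves a pair from `av` to the stack, which keeps the measure. Only popping lowers
        -- it.
        · rw [← hI.measure, List.length_cons, ← Finset.card_erase_add_one hav]
          ring
        · exact fun i j h => hI.nodes i j (Finset.mem_of_mem_erase h)
        · intro i j h1 h2 h3 h4 h5
          rw [Finset.mem_erase] at h5
          rcases hstep i j h3 h4 with h | h
          · exact hI.visited i j h1 h2 h3 h h5.2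
          · exact h5.1 h
      · exfalso
        simp [Cond.Holds, hav, hc.zero] at hn
      · rintro _ ⟨v, a, x, t, rfl, e20, e21, e12, hI'⟩
        refine Spec.block (by simp) (by simp [SafeAll, Op.Safe])
          ⟨b + 1, _, _, by omega, ?_, ?_, ?_, hI'.congr ?_ rfl ?_ ?_⟩
        · simp [Op.eff, e20]
        · have e3 : v 3 = p.z := hI'.rep.consts.z
          rw [← hnext]
          simp [Op.eff, e21, e3]
        · simp [Op.eff, e12]
        · intro k hk
          simp only [List.foldl_cons, List.foldl_nil, Op.eff, Function.update_apply]
          split_ifs <;> omega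
        · simp [Op.eff]
        · exact fun i j _ _ _ h _ => h
    · refine Spec.seq_le 5 1 _ (Spec.ite (T := 4) (fun hn => ?_) (fun _ =>
        Spec.nil (Q := fun m' => m' = _) rfl)) ?_ (by norm_num)
      · exfalso
        simp [Cond.Holds, hav, hc.zero] at hn
      · rintro _ rfl
        refine Spec.block (by simp) (by simp [SafeAll, Op.Safe])
          ⟨b + 1, L, av, by omega, ?_, ?_, ?_, hI.congr ?_ rfl ?_ ?_⟩
        · simp [Op.eff, h20]
        · rw [← hnext]
          simp [Op.eff, h21, hc.z]
        · simp [Op.eff, h12]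
        · intro k hk
          simp only [List.foldl_cons, List.foldl_nil, Op.eff, Function.update_apply]
          split_ifs <;> omega
        · simp [Op.eff]
        · intro i j h1 h2 h3 h4 h5
          rcases hstep i j h3 h4 with h | h
          · exact h
          · exact absurd (h ▸ h5) hav
  · intro i j _ _ h3 h4 _
    rcases h4 with h4 | ⟨rfl, h4⟩
    · exact h4
    · have := Nat.mod_le j p.z
      omega
  · rintro m' ⟨⟨k, b, L, av, -, h20, h21, -, hI⟩, hn⟩
    refine ⟨⟨L, av, hI.congr (fun _ _ => rfl) rfl rfl fun i j h1 _ _ h4 _ => ?_⟩, h20⟩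
    simp only [Cond.Holds, h21, hI.rep.consts.w, Nat.cast_lt] at hn
    have := h1.2.1
    omega

/-- There are `s` candidates for each component, hence `O(s²)` steps for all successors of one pair.
-/
theorem spec_succLoop {p : Params} {G : ℕ → ℕ → ℂ} {f : ℤ} {W W' μ : ℕ} {m : Mem}
    {L : List (ℕ × ℕ)} {av : Finset (ℕ × ℕ)} (hR : NReach p G W W')
    (h : VisitInv p G f W W' μ (fun _ _ => False) m L av) (h20 : m.v 20 = (W / p.s : ℕ)) :
    Spec succLoop m (p.s * (p.s * 9 + 5) + 1) fun m' =>
      ∃ L av, VisitInv p G f W W' μ (fun _ _ => True) m' L av := by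
  have hd := p.div_lt hR.node.1
  have hw := p.w_eq
  refine (Spec.loop (T := p.s * 9 + 4) (i := p.s) (Inv := fun k m => ∃ b L av, b + k = p.s ∧
    m.v 20 = (W / p.s + b * p.z : ℕ) ∧
    VisitInv p G f W W' μ (fun i _ => i < W / p.s + b * p.z) m L av) ?_
    ⟨0, L, av, by simp, by simpa using h20, h.congr (fun _ _ => rfl) rfl rfl ?_⟩).mono
    le_rfl ?_
  · rintro k m ⟨b, L, av, hbk, h20, hI⟩ hlt
    have hc := hI.rep.consts
    simp only [Cond.Holds, h20, hc.w, Nat.cast_lt] at hlt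
    have hb : b < p.s := by
      by_contra hge
      have : p.s * p.z ≤ b * p.z := Nat.mul_le_mul_right _ (not_lt.1 hge)
      rw [← hw] at this
      exact absurd (this.trans (Nat.le_add_left _ _)) (not_le.2 hlt)
    set u := W / p.s + b * p.z with hu
    have hu2 : u % p.z = W / p.s := by
      rw [hu, Nat.add_mul_mod_self_right, Nat.mod_eq_of_lt hd]
    refine ⟨k - 1, by omega, ?_⟩
    refine Spec.seq_le 2 (p.s * 9 + 2) (fun m' => m' = ⟨Function.update (Function.update m.v 12
      (u * p.w : ℕ)) 21 (W' / p.s : ℕ), m.a, m.x, m.t⟩)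
      (Spec.block (by simp) (by simp [SafeAll, Op.Safe]) ?_) ?_ (by omega)
    · simp [Op.eff, h20, hI.out, hc.zero, (hI.rep.tables u hlt).2.2]
    rintro m' rfl
    refine Spec.seq_le (p.s * 9 + 1) 1 _ (spec_visitLoop (u := u) hR hlt hu2
      (hI.congr ?_ rfl ?_ fun _ _ _ _ _ h _ => h) ?_ ?_ ?_) ?_ (by omega)
    · intro k hk
      simp only [Function.update_apply]
      split_ifs <;> omega
    · simp
    · simp [h20]
    · simp
    · simp
    rintro m' ⟨⟨L', av', hI'⟩, e20⟩
    refine Spec.block (by simp) (by simp [SafeAll, Op.Safe])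
      ⟨b + 1, L', av', by omega, ?_, hI'.congr ?_ rfl ?_ ?_⟩
    · simp only [List.foldl_cons, List.foldl_nil, Op.eff, Function.update_self, e20,
        hI'.rep.consts.z, hu]
      push_cast
      ring
    · intro k hk
      simp only [List.foldl_cons, List.foldl_nil, Op.eff, Function.update_apply]
      split_ifs <;> omega
    · simp [Op.eff]
    · intro i j _ h2 _ h4 _
      by_contra hgt
      have e1 : (W / p.s + (b + 1) * p.z) = u + p.z := by rw [hu]; ring
      have e2 : (i - u) % p.z = 0 := Nat.sub_mod_eq_zero_of_mod_eq (by rw [h2, hu2])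
      rw [Nat.mod_eq_of_lt (by omega)] at e2
      omega
  · intro i j _ h2 _ h4 _
    have := Nat.mod_le i p.z
    omega
  · rintro m' ⟨⟨k, b, L, av, -, h20, hI⟩, hn⟩
    refine ⟨L, av, hI.congr (fun _ _ => rfl) rfl rfl fun i j h1 _ _ h4 _ => ?_⟩
    simp only [Cond.Holds, h20, hI.rep.consts.w, Nat.cast_lt] at hn
    have := h1.1
    omega

/-- No pair is pushed by the search twice, since pushing makes it unavailable. So the number of
rounds is at most the length of the stack plus the number of available pairs. -/
theorem spec_searchLoop {p : Params} {G : ℕ → ℕ → ℂ} {m : Mem} {L : List (ℕ × ℕ)}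
    {av : Finset (ℕ × ℕ)} (hrep : SearchRep p L av m)
    (hinv : SearchInv p G L av (fun _ _ => False) (0 < m.v 8))
    (hn : ∀ i j, (i, j) ∈ av → Node p G i j) :
    Spec searchLoop m ((L.length + av.card) * (p.s * (p.s * 9 + 5) + 9) + 1) fun m' =>
      Consts p m'.v ∧ (0 < m'.v 8 ↔ BadNorm p G ∨ BadPair p G) := by
  refine (Spec.loop (T := p.s * (p.s * 9 + 5) + 8) (i := L.length + av.card)
    (Inv := fun k m => ∃ L av, L.length + av.card = k ∧ SearchRep p L av m ∧
      SearchInv p G L av (fun _ _ => False) (0 < m.v 8) ∧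
      ∀ i j, (i, j) ∈ av → Node p G i j) ?_ ⟨L, av, rfl, hrep, hinv, hn⟩).mono le_rfl ?_
  · rintro k m ⟨L, av, hk, hrep, hinv, hn⟩ hlt
    have hc := hrep.consts
    simp only [Cond.Holds, hc.zero, hrep.sp] at hlt
    obtain ⟨⟨W, W'⟩, L, rfl⟩ : ∃ x L', L = x :: L' := by
      cases L with
      | nil => simp at hlt
      | cons x L => exact ⟨x, L, rfl⟩
    have hR := hinv.reach W W' (by simp)
    obtain ⟨s1, s2, hstack⟩ := hrep.stack
    have hsp : m.v 10 - m.v 6 = L.length := by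
      rw [hrep.sp, hc.one]
      simp
    refine ⟨L.length + av.card, by simp at hk; omega, ?_⟩
    refine Spec.seq_le 5 (p.s * (p.s * 9 + 5) + 3) (fun m' => SearchRep p L av m' ∧
      m'.v 8 = m.v 8 ∧ m'.v 20 = (W / p.s : ℕ) ∧ m'.v 22 = (W' / p.s : ℕ))
      (Spec.block (by simp) (by simp [SafeAll, Op.Safe]) ?_) ?_ (by omega)
    · have t1 := (hrep.tables W hR.node.1).2.1
      have t2 := (hrep.tables W' hR.node.2.1).2.1
      simp only [List.foldl_cons, List.foldl_nil, Op.eff]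
      refine ⟨⟨hc.congr ?_, hrep.tables, ?_, hstack, hrep.avail⟩, ?_, ?_, ?_⟩
      · intro k hk
        simp only [Function.update_apply]
        split_ifs <;> omega
      · simp [hsp]
      · simp
      · simpa [hsp, s1] using t1
      · simpa [hsp, s2] using t2
    rintro m₁ ⟨hrep₁, e8, e20, e22⟩
    refine Spec.seq_le 2 (p.s * (p.s * 9 + 5) + 1) (fun m' => SearchRep p L av m' ∧
      m'.v 20 = (W / p.s : ℕ) ∧ m'.v 22 = (W' / p.s : ℕ) ∧
      (W / p.s = W' / p.s → 0 < m'.v 8) ∧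
      SearchInv p G L av (fun i j => (i, j) = (W, W')) (0 < m'.v 8)) ?_ ?_ (by omega)
    · refine Spec.ite (T := 1) (fun hb => Spec.block (by simp) (by simp [SafeAll, Op.Safe]) ?_)
        (fun hb => Spec.nil ?_)
      · simp only [Cond.Holds, e20, e22, Nat.cast_inj] at hb
        simp only [List.foldl_cons, List.foldl_nil, Op.eff]
        refine ⟨⟨hrep₁.consts.congr ?_, hrep₁.tables, ?_, hrep₁.stack, hrep₁.avail⟩,
          ?_, ?_, ?_, hinv.pop ?_ ?_⟩
        · intro k hk
          simp only [Function.update_apply]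
          split_ifs <;> omega
        · simp [hrep₁.sp]
        · simp [e20]
        · simp [e22]
        · simp
        · exact fun h => absurd hb h
        · simp
      · simp only [Cond.Holds, e20, e22, Nat.cast_inj] at hb
        refine ⟨hrep₁, e20, e22, fun h => absurd h hb, hinv.pop ?_ ?_⟩
        · intro _
          rw [e8]
        · rw [e8]
          exact id
    rintro m₂ ⟨hrep₂, e20, e22, htail, hinv₂⟩
    refine (spec_succLoop (μ := L.length + av.card) hR
      ⟨hrep₂, rfl, e22, hinv₂, rfl, hn, fun _ _ _ _ _ h => h.elim⟩ e20).mono le_rfl ?_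
    rintro m₃ ⟨L', av', hI⟩
    refine ⟨L', av', hI.measure, hI.rep, ?_, hI.nodes⟩
    rw [hI.flag]
    -- All successors have been visited and the flag accounts for equal tails, so the processed pair
    -- is closed.
    exact hI.inv.done ⟨fun i j h1 h2 h3 => hI.visited i j h1 h2 h3 trivial, htail⟩
  · rintro m' ⟨⟨k, L, av, -, hrep, hinv, -⟩, hb⟩
    simp only [Cond.Holds, hrep.consts.zero, hrep.sp] at hb
    obtain rfl : L = [] := by
      cases L with
      | nil => rfl
      | cons x L => simp at hb
    exact ⟨hrep.consts, hinv.bad_iff⟩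

end Decision

namespace Decision

open AlgebraicRAM

/-- The inner product of the local values of two numbered words, from the table. -/
noncomputable def gramOf (p : Params) (T : ℕ → ℂ) (W W' : ℕ) : ℂ :=
  ∑ y ∈ Finset.range p.s, (starRingEnd ℂ) (T (p.s * W + y)) * T (p.s * W' + y)

theorem table_index_lt {p : Params} {W y : ℕ} (hW : W < p.w) (hy : y < p.s) :
    p.s * W + y < p.n := by
  rw [p.n_eq]
  have : p.s * (W + 1) ≤ p.s * p.w := Nat.mul_le_mul_left _ hW
  rw [Nat.mul_succ] at this
  omega

/-! ### Powers and tables -/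

/-- Compute `s ^ (r - 1)`, `s ^ r`, `s ^ (r + 1)`. -/
def powers : Com :=
  .seq (.block [.const 3 0, .add 4 6 7, .add 5 0 7, .const 26 0]) <|
  .loop (.lt 26 1) <|
    .seq (.block [.add 3 4 7, .add 4 5 7, .const 27 0, .const 28 0]) <|
    .seq (.loop (.lt 28 0) (.block [.add 27 27 4, .add 28 28 6])) <|
    .block [.add 5 27 7, .add 26 26 6]

/-- The input has been read. -/
structure Loaded (p : Params) (v : ℕ → ℤ) : Prop where
  s : v 0 = p.s
  r : v 1 = p.r
  q : v 2 = p.q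
  one : v 6 = 1
  zero : v 7 = 0
  flag : v 8 = 0

/-- The variables `3`, `4`, `5` hold consecutive powers of `s` and move up by one in every round.
The new power is a sum of `s` copies of the previous one, as integers cannot be multiplied. -/
theorem spec_powers {p : Params} {m : Mem} (h : Loaded p m.v) :
    Spec powers m (p.r * (p.s * 3 + 8) + 5) fun m' =>
      Consts p m'.v ∧ m'.v 8 = 0 ∧ m'.t = m.t := by
  refine Spec.seq_le 4 (p.r * (p.s * 3 + 8) + 1) (fun m' => Loaded p m'.v ∧ m'.t = m.t ∧
    m'.v 4 = 1 ∧ m'.v 5 = p.s ∧ m'.v 26 = 0) (Spec.block (by simp) (by simp [SafeAll, Op.Safe])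
      ?_) ?_ (by omega)
  · simp only [List.foldl_cons, List.foldl_nil, Op.eff]
    refine ⟨⟨?_, ?_, ?_, ?_, ?_, ?_⟩, trivial, ?_, ?_, ?_⟩ <;>
      simp [h.s, h.r, h.q, h.one, h.zero, h.flag]
  rintro m₁ ⟨h₁, ht, h4, h5, h26⟩
  -- Before the first round variable `3` does not yet hold a power, hence the condition `1 ≤ b`. It
  -- is met at the end because `r ≥ 1`.
  refine (Spec.loop (T := p.s * 3 + 7) (i := p.r) (Inv := fun k m' => ∃ b : ℕ, b + k = p.r ∧
    Loaded p m'.v ∧ m'.t = m.t ∧ m'.v 26 = b ∧ m'.v 4 = (p.s ^ b : ℕ) ∧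
    m'.v 5 = (p.s ^ (b + 1) : ℕ) ∧ (1 ≤ b → m'.v 3 = (p.s ^ (b - 1) : ℕ))) ?_
    ⟨0, by simp, h₁, ht, by simp [h26], by simp [h4], by simp [h5], by simp⟩).mono le_rfl ?_
  · rintro k m₂ ⟨b, hbk, h₂, ht, h26, h4, h5, h3⟩ hlt
    simp only [Cond.Holds, h26, h₂.r, Nat.cast_lt] at hlt
    refine ⟨k - 1, by omega, ?_⟩
    refine Spec.seq_le 4 (p.s * 3 + 3) (fun m' => Loaded p m'.v ∧ m'.t = m.t ∧ m'.v 26 = b ∧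
      m'.v 3 = (p.s ^ b : ℕ) ∧ m'.v 4 = (p.s ^ (b + 1) : ℕ) ∧ m'.v 27 = 0 ∧ m'.v 28 = 0)
      (Spec.block (by simp) (by simp [SafeAll, Op.Safe]) ?_) ?_ (by omega)
    · simp only [List.foldl_cons, List.foldl_nil, Op.eff]
      refine ⟨⟨?_, ?_, ?_, ?_, ?_, ?_⟩, ht, ?_, ?_, ?_, ?_, ?_⟩ <;>
        simp [h₂.s, h₂.r, h₂.q, h₂.one, h₂.zero, h₂.flag, h26, h4, h5]
    rintro m₃ ⟨h₃, ht, h26, h3, h4, h27, h28⟩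
    refine Spec.seq_le (p.s * 3 + 1) 2 (fun m' => Loaded p m'.v ∧ m'.t = m.t ∧ m'.v 26 = b ∧
      m'.v 3 = (p.s ^ b : ℕ) ∧ m'.v 4 = (p.s ^ (b + 1) : ℕ) ∧ m'.v 27 = (p.s ^ (b + 2) : ℕ))
      ?_ ?_ (by omega)
    · refine (Spec.loop (T := 2) (i := p.s) (Inv := fun k m' => ∃ c : ℕ, c + k = p.s ∧
        Loaded p m'.v ∧ m'.t = m.t ∧ m'.v 26 = b ∧ m'.v 3 = (p.s ^ b : ℕ) ∧
        m'.v 4 = (p.s ^ (b + 1) : ℕ) ∧ m'.v 28 = c ∧ m'.v 27 = (c * p.s ^ (b + 1) : ℕ)) ?_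
        ⟨0, by simp, h₃, ht, h26, h3, h4, by simp [h28], by simp [h27]⟩).mono le_rfl ?_
      · rintro k m₄ ⟨c, hck, h₄, ht, h26, h3, h4, h28, h27⟩ hlt
        simp only [Cond.Holds, h28, h₄.s, Nat.cast_lt] at hlt
        refine ⟨k - 1, by omega, Spec.block (by simp) (by simp [SafeAll, Op.Safe])
          ⟨c + 1, by omega, ?_⟩⟩
        simp only [List.foldl_cons, List.foldl_nil, Op.eff]
        refine ⟨⟨?_, ?_, ?_, ?_, ?_, ?_⟩, ht, ?_, ?_, ?_, ?_, ?_⟩ <;>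
          simp [h₄.s, h₄.r, h₄.q, h₄.one, h₄.zero, h₄.flag, h26, h4, h3, h28, h27]
        ring
      · rintro m' ⟨⟨k, c, hck, h', ht, h26, h3, h4, h28, h27⟩, hn⟩
        simp only [Cond.Holds, h28, h'.s, Nat.cast_lt] at hn
        obtain rfl : c = p.s := by omega
        exact ⟨h', ht, h26, h3, h4, by rw [h27]; congr 1; ring⟩
    rintro m₄ ⟨h₄, ht, h26, h3, h4, h27⟩
    refine Spec.block (by simp) (by simp [SafeAll, Op.Safe]) ⟨b + 1, by omega, ?_⟩
    simp only [List.foldl_cons, List.foldl_nil, Op.eff]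
    refine ⟨⟨?_, ?_, ?_, ?_, ?_, ?_⟩, ht, ?_, ?_, ?_, ?_⟩ <;>
      simp [h₄.s, h₄.r, h₄.q, h₄.one, h₄.zero, h₄.flag, h26, h4, h3, h27]
  · rintro m' ⟨⟨k, b, hbk, h', ht, h26, h4, h5, h3⟩, hn⟩
    simp only [Cond.Holds, h26, h'.r, Nat.cast_lt] at hn
    obtain rfl : b = p.r := by omega
    exact ⟨⟨h'.s, h'.r, h'.q, h3 p.one_le_r, h4, h5, h'.one, h'.zero⟩, h'.flag, ht⟩

/-- Tabulate `tin W`, `W / s`, `W * w`. -/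
def tabulate : Com :=
  .seq (.block [.const 9 0, .add 17 2 7, .const 18 0, .const 19 0, .const 12 0]) <|
  .loop (.lt 9 4) <|
    .seq (.block [.store 0 9 17, .store 1 9 18, .store 2 9 12, .add 9 9 6, .add 12 12 4,
      .add 19 19 6, .add 17 17 0]) <|
    .seq (.ite (.lt 17 4) (.block []) (.block [.sub 17 17 4])) <|
    .ite (.lt 19 0) (.block []) (.block [.const 19 0, .add 18 18 6])

/-- Variables `17`, `18`, `19` and `12` carry `tin W`, `W / s`, `W % s` and `W * w` from one `W` to
the next, each corrected on overflow where needed. -/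
theorem spec_tabulate {p : Params} {m : Mem} (h : Consts p m.v) (h8 : m.v 8 = 0) :
    Spec tabulate m (p.w * 13 + 6) fun m' =>
      Consts p m'.v ∧ m'.v 8 = 0 ∧ Tables p p.w m'.a ∧ m'.t = m.t := by
  refine Spec.seq_le 5 (p.w * 13 + 1) (fun m' => Consts p m'.v ∧ m'.v 8 = 0 ∧ m'.t = m.t ∧
    m'.v 9 = 0 ∧ m'.v 17 = p.q ∧ m'.v 18 = 0 ∧ m'.v 19 = 0 ∧ m'.v 12 = 0)
    (Spec.block (by simp) (by simp [SafeAll, Op.Safe]) ?_) ?_ (by omega)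
  · simp only [List.foldl_cons, List.foldl_nil, Op.eff]
    refine ⟨h.congr ?_, ?_, trivial, ?_, ?_, ?_, ?_, ?_⟩
    · intro k hk
      simp only [Function.update_apply]
      split_ifs <;> omega
    all_goals simp [h8, h.q, h.zero]
  rintro m₁ ⟨h₁, h8, ht, h9, h17, h18, h19, h12⟩
  refine (Spec.loop (T := 12) (i := p.w) (Inv := fun k m' => ∃ W : ℕ, W + k = p.w ∧
    Consts p m'.v ∧ m'.v 8 = 0 ∧ m'.t = m.t ∧ m'.v 9 = W ∧ m'.v 17 = p.tin W ∧
    m'.v 18 = (W / p.s : ℕ) ∧ m'.v 19 = (W % p.s : ℕ) ∧ m'.v 12 = (W * p.w : ℕ) ∧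
    Tables p W m'.a) ?_
    ⟨0, by simp, h₁, h8, ht, by simp [h9], by simp [h17, Params.tin], by simp [h18],
      by simp [h19], by simp [h12], fun W hW => by omega⟩).mono le_rfl ?_
  · rintro k m₂ ⟨W, hWk, h₂, h8, ht, h9, h17, h18, h19, h12, htab⟩ hlt
    simp only [Cond.Holds, h9, h₂.w, Nat.cast_lt] at hlt
    refine ⟨k - 1, by omega, ?_⟩
    refine Spec.seq_le 7 5 (fun m' => Consts p m'.v ∧ m'.v 8 = 0 ∧ m'.t = m.t ∧
      m'.v 9 = (W + 1 : ℕ) ∧ m'.v 17 = (p.tin W + p.s : ℕ) ∧ m'.v 18 = (W / p.s : ℕ) ∧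
      m'.v 19 = (W % p.s + 1 : ℕ) ∧ m'.v 12 = ((W + 1) * p.w : ℕ) ∧ Tables p (W + 1) m'.a)
      (Spec.block (by simp) (by simp [SafeAll, Op.Safe]) ?_) ?_ (by norm_num)
    · simp only [List.foldl_cons, List.foldl_nil, Op.eff]
      refine ⟨h₂.congr ?_, ?_, ht, ?_, ?_, ?_, ?_, ?_, ?_⟩
      · intro k hk
        simp only [Function.update_apply]
        split_ifs <;> omega
      · simp [h8]
      · simp [h9, h₂.one]
      · simp [h17, h₂.s]
      · simp [h18]
      · simp [h19, h₂.one]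
      · simp [h12, h₂.w]
        ring
      · intro V hV
        by_cases hVW : V = W
        · subst hVW
          simp [h9, h17, h18, h12]
        · have := htab V (by omega)
          simpa [Function.update_apply, h9, hVW] using this
    rintro m₃ ⟨h₃, h8, ht, h9, h17, h18, h19, h12, htab⟩
    refine Spec.seq_le 2 3 (fun m' => Consts p m'.v ∧ m'.v 8 = 0 ∧ m'.t = m.t ∧
      m'.v 9 = (W + 1 : ℕ) ∧ m'.v 17 = p.tin (W + 1) ∧ m'.v 18 = (W / p.s : ℕ) ∧
      m'.v 19 = (W % p.s + 1 : ℕ) ∧ m'.v 12 = ((W + 1) * p.w : ℕ) ∧ Tables p (W + 1) m'.a)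
      (Spec.ite (T := 1) (fun hb => Spec.nil ?_) (fun hb => Spec.block (by simp)
        (by simp [SafeAll, Op.Safe]) ?_)) ?_ (by norm_num)
    · simp only [Cond.Holds, h17, h₃.w, Nat.cast_lt] at hb
      refine ⟨h₃, h8, ht, h9, ?_, h18, h19, h12, htab⟩
      rw [h17, p.tin_succ, if_pos hb]
    · simp only [Cond.Holds, h17, h₃.w, Nat.cast_lt] at hb
      simp only [List.foldl_cons, List.foldl_nil, Op.eff]
      refine ⟨h₃.congr ?_, ?_, ht, ?_, ?_, ?_, ?_, ?_, htab⟩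
      · intro k hk
        simp only [Function.update_apply]
        split_ifs <;> omega
      · simp [h8]
      · simp [h9]
      · rw [Function.update_self, h17, h₃.w, p.tin_succ, if_neg hb]
        omega
      · simp [h18]
      · simp [h19]
      · simp [h12]
    rintro m₄ ⟨h₄, h8, ht, h9, h17, h18, h19, h12, htab⟩
    refine Spec.ite (T := 2) (fun hb => Spec.nil ⟨W + 1, by omega, h₄, h8, ht, h9, h17, ?_, ?_,
      h12, htab⟩) (fun hb => Spec.block (by simp) (by simp [SafeAll, Op.Safe])
      ⟨W + 1, by omega, ?_⟩)
    · simp only [Cond.Holds, h19, h₄.s, Nat.cast_lt] at hb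
      rw [h18, succ_div_eq p.s_pos, if_pos hb]
    · simp only [Cond.Holds, h19, h₄.s, Nat.cast_lt] at hb
      rw [h19, succ_mod_eq p.s_pos, if_pos hb]
    · simp only [Cond.Holds, h19, h₄.s, Nat.cast_lt] at hb
      simp only [List.foldl_cons, List.foldl_nil, Op.eff]
      refine ⟨h₄.congr ?_, ?_, ht, ?_, ?_, ?_, ?_, ?_, htab⟩
      · intro k hk
        simp only [Function.update_apply]
        split_ifs <;> omega
      · simp [h8]
      · simp [h9]
      · simp [h17]
      · simp only [succ_div_eq p.s_pos, if_neg hb]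
        simp [h18, h₄.one]
      · simp only [succ_mod_eq p.s_pos, if_neg hb]
        simp
      · simp [h12]
  · rintro m' ⟨⟨k, W, hWk, h', h8, ht, h9, -, -, -, -, htab⟩, hn⟩
    simp only [Cond.Holds, h9, h'.w, Nat.cast_lt] at hn
    obtain rfl : W = p.w := by omega
    exact ⟨h', h8, htab, ht⟩

/-! ### Inner products -/

/-- Compute an inner product into the complex variable `1`. -/
def dotLoop : Com :=
  .loop (.lt 16 0) <|
    .block [.xload 2 13, .xconj 2 2, .xload 3 14, .xmul 2 2 3, .xadd 1 1 2, .add 13 13 6,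
      .add 14 14 6, .add 16 16 6]

/-- The pointer in variable `14` ends where the row of `W' + 1` begins, so the next call needs no
address computation for it. -/
theorem spec_dotLoop {p : Params} {T : ℕ → ℂ} {W W' : ℕ} {m : Mem} (h0 : m.v 0 = p.s)
    (h6 : m.v 6 = 1) (ht : ∀ k < p.n, m.t (k : ℕ) = T k) (hW : W < p.w) (hW' : W' < p.w)
    (h16 : m.v 16 = 0) (h13 : m.v 13 = (p.s * W : ℕ)) (h14 : m.v 14 = (p.s * W' : ℕ))
    (hx : m.x 1 = 0) :
    Spec dotLoop m (p.s * 9 + 1) fun m' => m'.a = m.a ∧ m'.t = m.t ∧ m'.x 0 = m.x 0 ∧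
      m'.x 1 = gramOf p T W W' ∧ m'.v 14 = (p.s * (W' + 1) : ℕ) ∧
      ∀ k, k ≠ 13 → k ≠ 14 → k ≠ 16 → m'.v k = m.v k := by
  refine (Spec.loop (T := 8) (i := p.s) (Inv := fun k m' => ∃ y : ℕ, y + k = p.s ∧
    m'.a = m.a ∧ m'.t = m.t ∧ m'.x 0 = m.x 0 ∧ m'.v 16 = y ∧ m'.v 13 = (p.s * W + y : ℕ) ∧
    m'.v 14 = (p.s * W' + y : ℕ) ∧ m'.x 1 = ∑ y ∈ Finset.range y,
      (starRingEnd ℂ) (T (p.s * W + y)) * T (p.s * W' + y) ∧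
    ∀ k, k ≠ 13 → k ≠ 14 → k ≠ 16 → m'.v k = m.v k) ?_
    ⟨0, by simp, rfl, rfl, rfl, by simp [h16], by simp [h13], by simp [h14], by simp [hx],
      fun _ _ _ _ => rfl⟩).mono le_rfl ?_
  · rintro k m₁ ⟨y, hyk, ha, ht', hx0, h16, h13, h14, hx1, hv⟩ hlt
    have e0 := hv 0 (by norm_num) (by norm_num) (by norm_num)
    have e6 := hv 6 (by norm_num) (by norm_num) (by norm_num)
    simp only [Cond.Holds, h16, e0, h0, Nat.cast_lt] at hlt
    refine ⟨k - 1, by omega, Spec.block (by simp) ?_ ⟨y + 1, by omega, ?_⟩⟩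
    · simp only [SafeAll, Op.Safe, Op.eff, h13, h14]
      simp
      constructor <;> positivity
    · have t1 := ht _ (table_index_lt hW hlt)
      have t2 := ht _ (table_index_lt hW' hlt)
      simp only [List.foldl_cons, List.foldl_nil, Op.eff]
      refine ⟨ha, ht', ?_, ?_, ?_, ?_, ?_, ?_⟩
      · simp [hx0]
      · simp [h16, e6, h6]
      · simp [h13, e6, h6]
        ring
      · simp [h14, e6, h6]
        ring
      · rw [Finset.sum_range_succ]
        simp only [← t1, ← t2, ← hx1, ← ht', ← h13, ← h14]
        simp
      · intro k k1 k2 k3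
        simp [k1, k2, k3, hv k k1 k2 k3]
  · rintro m' ⟨⟨k, y, hyk, ha, ht', hx0, h16, h13, h14, hx1, hv⟩, hn⟩
    have e0 := hv 0 (by norm_num) (by norm_num) (by norm_num)
    simp only [Cond.Holds, h16, e0, h0, Nat.cast_lt] at hn
    obtain rfl : y = p.s := by omega
    exact ⟨ha, ht', hx0, hx1, by rw [h14]; congr 1, hv⟩

end Decision

/-! ### Treatment of all pairs of words. -/

namespace Decision

open AlgebraicRAM

/-- A pair of different words with nonorthogonal values that can follow equal words. -/
def BaseNode (p : Params) (G : ℕ → ℕ → ℂ) (i j : ℕ) : Prop :=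
  Node p G i j ∧ i % p.z = j % p.z

/-- A pair of different words with nonorthogonal values that cannot follow equal words. -/
def InnerNode (p : Params) (G : ℕ → ℕ → ℂ) (i j : ℕ) : Prop :=
  Node p G i j ∧ i % p.z ≠ j % p.z

/-- The stack contains the base nodes among the first `N` pairs. -/
def BaseStack (p : Params) (G : ℕ → ℕ → ℂ) (N : ℕ) (sp : ℤ) (a b : ℤ → ℤ) : Prop :=
  ∃ L : List (ℕ × ℕ), sp = L.length ∧ StackRep a b L ∧ (∀ i j, (i, j) ∈ L → BaseNode p G i j) ∧
    (∀ i j, BaseNode p G i j → i * p.w + j < N → (i, j) ∈ L) ∧ L.length ≤ N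

open Classical in
/-- The state after the first `N` pairs of words have been treated. -/
structure PairInv (p : Params) (T : ℕ → ℂ) (N : ℕ) (m : Mem) : Prop where
  consts : Consts p m.v
  flag : m.v 8 = 0
  zero : m.x 0 = 0
  tables : Tables p p.w m.a
  table : ∀ k < p.n, m.t (k : ℕ) = T k
  norms : ∀ i < p.w, i * p.w + i < N → m.t ((p.n + i : ℕ) : ℤ) = gramOf p T i i
  avail : ∀ i j, i < p.w → j < p.w → i * p.w + j < N →
    m.a 3 ((i * p.w + j : ℕ) : ℤ) = if InnerNode p (gramOf p T) i j then 1 else 0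
  stack : BaseStack p (gramOf p T) N (m.v 10) (m.a 4) (m.a 5)

theorem PairInv.congr {p : Params} {T : ℕ → ℂ} {N : ℕ} {m m' : Mem} (h : PairInv p T N m)
    (hv : ∀ k ≤ 10, k ≠ 9 → m'.v k = m.v k) (hx : m'.x 0 = m.x 0) (ha : m'.a = m.a)
    (ht : m'.t = m.t) : PairInv p T N m' where
  consts := h.consts.congr fun k hk => hv k (by omega) (by omega)
  flag := (hv 8 (by norm_num) (by norm_num)).trans h.flag
  zero := hx.trans h.zero
  tables := ha ▸ h.tables
  table := ht ▸ h.table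
  norms := ht ▸ h.norms
  avail := ha ▸ h.avail
  stack := by
    rw [hv 10 le_rfl (by norm_num), ha]
    exact h.stack

theorem BaseStack.skip {p : Params} {G : ℕ → ℕ → ℂ} {W W' : ℕ} {sp : ℤ} {a b : ℤ → ℤ}
    (h : BaseStack p G (W * p.w + W') sp a b) (hW' : W' < p.w) (hb : ¬ BaseNode p G W W') :
    BaseStack p G (W * p.w + W' + 1) sp a b := by
  obtain ⟨L, h1, h2, h3, h4, h5⟩ := h
  refine ⟨L, h1, h2, h3, fun i j hij hlt => h4 i j hij (lt_of_le_of_ne (by omega) fun he => ?_),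
    by omega⟩
  obtain ⟨rfl, rfl⟩ := (pair_index_inj hij.1.2.1 hW').1 he
  exact hb hij

theorem BaseStack.push {p : Params} {G : ℕ → ℕ → ℂ} {W W' : ℕ} {sp : ℤ} {a b : ℤ → ℤ}
    (h : BaseStack p G (W * p.w + W') sp a b) (hb : BaseNode p G W W') :
    BaseStack p G (W * p.w + W' + 1) (sp + 1) (Function.update a sp W)
      (Function.update b sp W') := by
  obtain ⟨L, rfl, h2, h3, h4, h5⟩ := h
  refine ⟨(W, W') :: L, by simp, h2.push W W', fun i j hm => ?_, fun i j hij hlt => ?_,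
    by simpa using h5⟩
  · rcases List.mem_cons.1 hm with hm | hm
    · obtain ⟨rfl, rfl⟩ := Prod.mk.inj hm
      exact hb
    · exact h3 i j hm
  · by_cases he : i * p.w + j = W * p.w + W'
    · obtain ⟨rfl, rfl⟩ := (pair_index_inj hij.1.2.1 hb.1.2.1).1 he
      simp
    · exact List.mem_cons_of_mem _ (h4 i j hij (by omega))

open Classical in
-- Pairs are treated in the order of `i * w + j`, which is injective for `j < w`, so only the data
-- of the current pair change. Norms are stored from cell `n` on and leave the input table intact.
theorem PairInv.extend {p : Params} {T : ℕ → ℂ} {W W' : ℕ} {m m' : Mem}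
    (h : PairInv p T (W * p.w + W') m) (hW : W < p.w) (hW' : W' < p.w)
    (hv : ∀ k ≤ 8, m'.v k = m.v k) (hx : m'.x 0 = m.x 0) (ha : ∀ j < 3, m'.a j = m.a j)
    (h3 : m'.a 3 = Function.update (m.a 3) ((W * p.w + W' : ℕ) : ℤ)
      (if InnerNode p (gramOf p T) W W' then 1 else 0))
    (ht : ∀ k : ℕ, (k ≠ p.n + W ∨ W ≠ W') → m'.t k = m.t k)
    (hg : W = W' → m'.t ((p.n + W : ℕ) : ℤ) = gramOf p T W W)
    (hs : BaseStack p (gramOf p T) (W * p.w + W' + 1) (m'.v 10) (m'.a 4) (m'.a 5)) :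
    PairInv p T (W * p.w + W' + 1) m' where
  consts := h.consts.congr fun k hk => hv k (by omega)
  flag := (hv 8 (by norm_num)).trans h.flag
  zero := hx.trans h.zero
  tables := fun V hV => by
    rw [ha 0 (by decide), ha 1 (by decide), ha 2 (by decide)]
    exact h.tables V hV
  table k hk := by
    rw [ht k (Or.inl (by omega))]
    exact h.table k hk
  norms i hi hlt := by
    by_cases he : i * p.w + i = W * p.w + W'
    · obtain ⟨rfl, rfl⟩ := (pair_index_inj hi hW').1 he
      exact hg rfl
    · rw [ht _ ?_]
      · exact h.norms i hi (by omega)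
      · by_contra hcon
        push Not at hcon
        obtain ⟨h1, rfl⟩ := hcon
        obtain rfl : i = W := by omega
        exact he rfl
  avail i j hi hj hlt := by
    rw [h3]
    by_cases he : i * p.w + j = W * p.w + W'
    · obtain ⟨rfl, rfl⟩ := (pair_index_inj hj hW').1 he
      rw [Function.update_self]
    · rw [Function.update_of_ne (by exact_mod_cast he)]
      exact h.avail i j hi hj (by omega)
  stack := hs

/-- Treat the pair of words in the variables `9` and `11`, with inner product in `x 1`. -/
def classify : Com :=
  .seq (.block [.add 15 12 11]) <|
  .ite (.eq 9 11) (.block [.store 3 15 7, .add 24 5 9, .xstore 24 1]) <|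
  .ite (.xeq 1 0) (.block [.store 3 15 7]) <|
  .seq (.block [.load 24 0 9, .load 25 0 11]) <|
  .ite (.eq 24 25) (.block [.store 3 15 7, .store 4 10 9, .store 5 10 11, .add 10 10 6])
    (.block [.store 3 15 6])

/-- Treat all pairs of words. -/
def pairLoop : Com :=
  .seq (.block [.const 10 0, .const 9 0, .const 28 0, .xconst 0 0]) <|
  .loop (.lt 9 4) <|
    .seq (.block [.load 12 2 9, .const 11 0, .const 14 0]) <|
    .seq (.loop (.lt 11 4) <|
      .seq (.block [.xconst 1 0, .const 16 0, .add 13 28 7]) <|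
      .seq dotLoop <|
      .seq classify <|
      .block [.add 11 11 6]) <|
    .block [.add 9 9 6, .add 28 28 0]

/-- The loop variables while the pair `(W, W')` is treated. -/
structure PairVars (p : Params) (W W' : ℕ) (v : ℕ → ℤ) : Prop where
  fst : v 9 = W
  snd : v 11 = W'
  row : v 12 = (W * p.w : ℕ)
  pos : v 28 = (p.s * W : ℕ)

theorem PairVars.congr {p : Params} {W W' : ℕ} {v v' : ℕ → ℤ} (h : PairVars p W W' v)
    (h9 : v' 9 = v 9) (h11 : v' 11 = v 11) (h12 : v' 12 = v 12) (h28 : v' 28 = v 28) :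
    PairVars p W W' v' :=
  ⟨h9.trans h.fst, h11.trans h.snd, h12.trans h.row, h28.trans h.pos⟩

/-- Base nodes go to the stack at once and are marked unavailable, so the search never pushes them
again. Inner nodes become available, and pairs that are not nodes never do. On the diagonal the
inner product is kept as a norm. -/
theorem spec_classify {p : Params} {T : ℕ → ℂ} {W W' : ℕ} {m : Mem} (hW : W < p.w)
    (hW' : W' < p.w) (h : PairInv p T (W * p.w + W') m) (hvars : PairVars p W W' m.v)
    (hx : m.x 1 = gramOf p T W W') :
    Spec classify m 10 fun m' => PairInv p T (W * p.w + W' + 1) m' ∧ PairVars p W W' m'.v ∧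
      m'.v 14 = m.v 14 := by
  classical
  refine Spec.seq_le 1 9 (fun m' => PairInv p T (W * p.w + W') m' ∧ PairVars p W W' m'.v ∧
    m'.v 14 = m.v 14 ∧ m'.x 1 = gramOf p T W W' ∧ m'.v 15 = (W * p.w + W' : ℕ))
    (Spec.block (by simp) (by simp [SafeAll, Op.Safe]) ?_) ?_ (by norm_num)
  · simp only [List.foldl_cons, List.foldl_nil, Op.eff]
    refine ⟨h.congr ?_ rfl rfl rfl, hvars.congr ?_ ?_ ?_ ?_, ?_, hx, ?_⟩
    · intro k hk hk9
      simp only [Function.update_apply]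
      split_ifs <;> omega
    · simp
    · simp
    · simp
    · simp
    · simp
    · simp [hvars.row, hvars.snd]
  clear h hvars hx
  rintro ⟨v, a, x, t⟩ ⟨h, hvars, h14, hx, h15⟩
  have hc := h.consts
  have e5 : v 5 = p.n := hc.n
  have e6 : v 6 = 1 := hc.one
  have e7 : v 7 = 0 := hc.zero
  have e9 : v 9 = W := hvars.fst
  have e11 : v 11 = W' := hvars.snd
  have e15 : v 15 = (W * p.w + W' : ℕ) := h15
  have ex0 : x 0 = 0 := h.zero
  have ex1 : x 1 = gramOf p T W W' := hx
  refine Spec.ite (T := 8) (fun hb => (Spec.block (T := 3) (by simp) ?_ ?_).mono (by norm_num)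
    fun _ => id) (fun hb => ?_)
  · simp only [SafeAll, Op.Safe, Op.eff, Function.update_self, e5, e9]
    simp
    positivity
  · simp only [Cond.Holds, e9, e11, Nat.cast_inj] at hb
    have hnode : ¬ Node p (gramOf p T) W W' := fun hn => hn.2.2.1 hb
    simp only [List.foldl_cons, List.foldl_nil, Op.eff]
    refine ⟨h.extend hW hW' ?_ rfl ?_ ?_ ?_ ?_ ?_, hvars.congr ?_ ?_ ?_ ?_, ?_⟩
    · intro k hk
      simp only [Function.update_apply]
      split_ifs <;> omega
    · intro j hj
      exact Function.update_of_ne (by omega) _ _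
    · rw [if_neg fun hn => hnode hn.1]
      simp only [Function.update_self, e15, e7]
    · intro k hk
      have hk' : k ≠ p.n + W := hk.resolve_right fun h => h hb
      simp only [Function.update_self, e5, e9]
      exact Function.update_of_ne (by exact_mod_cast hk') _ _
    · rintro rfl
      simp [e5, e9, ex1]
    · simpa using h.stack.skip hW' fun hn => hnode hn.1
    · simp
    · simp
    · simp
    · simp
    · simpa using h14
  simp only [Cond.Holds, e9, e11, Nat.cast_inj] at hb
  refine Spec.ite (T := 7) (fun hz => (Spec.block (T := 1) (by simp) (by simp [SafeAll, Op.Safe])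
    ?_).mono (by norm_num) fun _ => id) (fun hz => ?_)
  · simp only [Cond.Holds, ex1, ex0] at hz
    have hnode : ¬ Node p (gramOf p T) W W' := fun hn => hn.2.2.2 hz
    simp only [List.foldl_cons, List.foldl_nil, Op.eff]
    refine ⟨h.extend hW hW' (fun _ _ => rfl) rfl ?_ ?_ (fun _ _ => rfl) (fun h => absurd h hb) ?_,
      hvars, h14⟩
    · intro j hj
      exact Function.update_of_ne (by omega) _ _
    · rw [if_neg fun hn => hnode hn.1]
      simp only [Function.update_self, e15, e7]
    · simpa using h.stack.skip hW' fun hn => hnode hn.1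
  simp only [Cond.Holds, ex1, ex0] at hz
  have hnode : Node p (gramOf p T) W W' := ⟨hW, hW', hb, hz⟩
  refine Spec.seq_le 2 5 (fun m' => m' = ⟨Function.update (Function.update v 24 (p.tin W)) 25
    (p.tin W'), a, x, t⟩) (Spec.block (by simp) (by simp [SafeAll, Op.Safe]) ?_) ?_ (by norm_num)
  · have t1 : a 0 W = p.tin W := (h.tables W hW).1
    have t2 : a 0 W' = p.tin W' := (h.tables W' hW').1
    simp [Op.eff, e9, e11, t1, t2]
  rintro m' rfl
  refine Spec.ite (T := 4) (fun he => Spec.block (by simp) (by simp [SafeAll, Op.Safe]) ?_)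
    (fun he => (Spec.block (T := 1) (by simp) (by simp [SafeAll, Op.Safe])
    ?_).mono (by norm_num) fun _ => id)
  · have he' : W % p.z = W' % p.z := by
      simpa [Cond.Holds, p.tin_inj] using he
    simp only [List.foldl_cons, List.foldl_nil, Op.eff]
    refine ⟨h.extend hW hW' ?_ rfl ?_ ?_ (fun _ _ => rfl) (fun h => absurd h hb) ?_,
      hvars.congr ?_ ?_ ?_ ?_, ?_⟩
    · intro k hk
      simp only [Function.update_apply]
      split_ifs <;> omega
    · intro j hj
      simp only
      rw [Function.update_of_ne (by omega), Function.update_of_ne (by omega),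
        Function.update_of_ne (by omega)]
    · rw [if_neg fun hn => hn.2 he']
      simp [e15, e7]
    · simpa [e6, e9, e11] using h.stack.push ⟨hnode, he'⟩
    · simp
    · simp
    · simp
    · simp
    · simpa using h14
  · have he' : W % p.z ≠ W' % p.z := by
      simpa [Cond.Holds, p.tin_inj] using he
    simp only [List.foldl_cons, List.foldl_nil, Op.eff]
    refine ⟨h.extend hW hW' ?_ rfl ?_ ?_ (fun _ _ => rfl) (fun h => absurd h hb) ?_,
      hvars.congr ?_ ?_ ?_ ?_, ?_⟩
    · intro k hk
      simp only [Function.update_apply]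
      split_ifs <;> omega
    · intro j hj
      exact Function.update_of_ne (by omega) _ _
    · rw [if_pos ⟨hnode, he'⟩]
      simp [e15, e6]
    · simpa using h.stack.skip hW' fun hn => he' hn.2
    · simp
    · simp
    · simp
    · simp
    · simpa using h14

/-- There are `w²` inner products with `s` terms each. Variable `28` holds the start of the table
row of `W`. -/
theorem spec_pairLoop {p : Params} {T : ℕ → ℂ} {m : Mem} (hc : Consts p m.v) (h8 : m.v 8 = 0)
    (htab : Tables p p.w m.a) (ht : ∀ k < p.n, m.t (k : ℕ) = T k) :
    Spec pairLoop m (p.w * (p.w * (p.s * 9 + 16) + 7) + 5) fun m' =>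
      PairInv p T (p.w * p.w) m' := by
  refine Spec.seq_le 4 (p.w * (p.w * (p.s * 9 + 16) + 7) + 1) (fun m' => PairInv p T 0 m' ∧
    m'.v 9 = 0 ∧ m'.v 28 = 0) (Spec.block (by simp) (by simp [SafeAll, Op.Safe]) ?_) ?_ (by omega)
  · simp only [List.foldl_cons, List.foldl_nil, Op.eff]
    refine ⟨⟨hc.congr ?_, ?_, ?_, htab, ht, ?_, ?_, ⟨[], ?_⟩⟩, ?_, ?_⟩
    · intro k hk
      simp only [Function.update_apply]
      split_ifs <;> omega
    · simp [h8]
    · simp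
    · intro i _ h
      omega
    · intro i j _ _ h
      omega
    · simp [StackRep]
    · simp
    · simp
  rintro m₁ ⟨h₁, h9, h28⟩
  refine (Spec.loop (T := p.w * (p.s * 9 + 16) + 6) (i := p.w) (Inv := fun k m' => ∃ W : ℕ,
    W + k = p.w ∧ PairInv p T (W * p.w) m' ∧ m'.v 9 = W ∧ m'.v 28 = (p.s * W : ℕ)) ?_
    ⟨0, by simp, by simpa using h₁, by simp [h9], by simp [h28]⟩).mono le_rfl ?_
  · rintro k m₂ ⟨W, hWk, h₂, h9, h28⟩ hW
    simp only [Cond.Holds, h9, h₂.consts.w, Nat.cast_lt] at hW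
    refine ⟨k - 1, by omega, ?_⟩
    refine Spec.seq_le 3 (p.w * (p.s * 9 + 16) + 3) (fun m' => PairInv p T (W * p.w + 0) m' ∧
      PairVars p W 0 m'.v ∧ m'.v 14 = 0) (Spec.block (by simp) (by simp [SafeAll, Op.Safe]) ?_) ?_
      (by omega)
    · have := (h₂.tables W hW).2.2
      simp only [List.foldl_cons, List.foldl_nil, Op.eff]
      refine ⟨h₂.congr ?_ rfl rfl rfl, ⟨?_, ?_, ?_, ?_⟩, ?_⟩
      · intro k hk hk9
        simp only [Function.update_apply]
        split_ifs <;> omega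
      · simp [h9]
      · simp
      · simpa [h9] using this
      · simp [h28]
      · simp
    rintro m₃ ⟨h₃, hv₃, h14⟩
    refine Spec.seq_le (p.w * (p.s * 9 + 16) + 1) 2 (fun m' => PairInv p T ((W + 1) * p.w) m' ∧
      m'.v 9 = W ∧ m'.v 28 = (p.s * W : ℕ)) ?_ ?_ (by omega)
    · refine (Spec.loop (T := p.s * 9 + 15) (i := p.w) (Inv := fun k m' => ∃ W' : ℕ,
        W' + k = p.w ∧ PairInv p T (W * p.w + W') m' ∧ PairVars p W W' m'.v ∧
        m'.v 14 = (p.s * W' : ℕ)) ?_ ⟨0, by simp, h₃, hv₃, by simp [h14]⟩).mono le_rfl ?_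
      · rintro k m₄ ⟨W', hWk', h₄, hv₄, h14⟩ hW'
        simp only [Cond.Holds, hv₄.snd, h₄.consts.w, Nat.cast_lt] at hW'
        refine ⟨k - 1, by omega, ?_⟩
        refine Spec.seq_le 3 (p.s * 9 + 12) (fun m' => PairInv p T (W * p.w + W') m' ∧
          PairVars p W W' m'.v ∧ m'.v 14 = (p.s * W' : ℕ) ∧ m'.v 13 = (p.s * W : ℕ) ∧
          m'.v 16 = 0 ∧ m'.x 1 = 0) (Spec.block (by simp) (by simp [SafeAll, Op.Safe]) ?_) ?_
          (by omega)
        · simp only [List.foldl_cons, List.foldl_nil, Op.eff]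
          refine ⟨h₄.congr ?_ ?_ rfl rfl, hv₄.congr ?_ ?_ ?_ ?_, ?_, ?_, ?_, ?_⟩
          · intro k hk hk9
            simp only [Function.update_apply]
            split_ifs <;> omega
          · simp
          · simp
          · simp
          · simp
          · simp
          · simp [h14]
          · simp [hv₄.pos, h₄.consts.zero]
          · simp
          · simp
        rintro m₅ ⟨h₅, hv₅, h14, h13, h16, hx⟩
        refine Spec.seq_le (p.s * 9 + 1) 11 (fun m' => PairInv p T (W * p.w + W') m' ∧
          PairVars p W W' m'.v ∧ m'.v 14 = (p.s * (W' + 1) : ℕ) ∧ m'.x 1 = gramOf p T W W')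
          ((spec_dotLoop h₅.consts.s h₅.consts.one h₅.table hW hW' h16 h13 h14 hx).mono le_rfl ?_)
          ?_ (by omega)
        · rintro m' ⟨ha, ht, hx0, hx1, h14, hv⟩
          refine ⟨h₅.congr (fun k hk _ => hv k (by omega) (by omega) (by omega)) hx0 ha ht,
            hv₅.congr ?_ ?_ ?_ ?_, h14, hx1⟩ <;> exact hv _ (by norm_num) (by norm_num) (by norm_num)
        rintro m₆ ⟨h₆, hv₆, h14, hx⟩
        refine Spec.seq_le 10 1 _ (spec_classify hW hW' h₆ hv₆ hx) ?_ le_rfl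
        rintro m₇ ⟨h₇, hv₇, e14⟩
        refine Spec.block (by simp) (by simp [SafeAll, Op.Safe]) ⟨W' + 1, by omega, ?_⟩
        simp only [List.foldl_cons, List.foldl_nil, Op.eff]
        refine ⟨h₇.congr ?_ rfl rfl rfl, ⟨?_, ?_, ?_, ?_⟩, ?_⟩
        · intro k hk hk9
          simp only [Function.update_apply]
          split_ifs <;> omega
        · simp [hv₇.fst]
        · simp [hv₇.snd, h₇.consts.one]
        · simp [hv₇.row]
        · simp [hv₇.pos]
        · simp [e14, h14]
      · rintro m' ⟨⟨k, W', hWk', h', hv', -⟩, hn⟩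
        simp only [Cond.Holds, hv'.snd, h'.consts.w, Nat.cast_lt] at hn
        obtain rfl : W' = p.w := by omega
        exact ⟨by rw [Nat.succ_mul]; exact h', hv'.fst, hv'.pos⟩
    rintro m₄ ⟨h₄, h9, h28⟩
    refine Spec.block (by simp) (by simp [SafeAll, Op.Safe]) ⟨W + 1, by omega, ?_⟩
    simp only [List.foldl_cons, List.foldl_nil, Op.eff]
    refine ⟨h₄.congr ?_ rfl rfl rfl, ?_, ?_⟩
    · intro k hk hk9
      simp only [Function.update_apply]
      split_ifs <;> omega
    · simp [h9, h₄.consts.one]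
    · simp [h28, h₄.consts.s]
      ring
  · rintro m' ⟨⟨k, W, hWk, h', h9, -⟩, hn⟩
    simp only [Cond.Holds, h9, h'.consts.w, Nat.cast_lt] at hn
    obtain rfl : W = p.w := by omega
    exact h'

end Decision

/-! ### Comparison of the weights. -/

namespace Decision

open AlgebraicRAM

/-- Multiply the norms of the windows up to position `0` of two words. -/
def weightLoop : Com :=
  .loop (.lt 16 1) <|
    .seq (.block [.add 13 5 24, .xload 3 13, .xmul 1 1 3]) <|
    .seq (.block [.add 13 5 25, .xload 3 13, .xmul 2 2 3]) <|
    .block [.load 24 0 24, .load 25 0 25, .add 16 16 6]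

/-- Compare the weights of all words. -/
def normLoop : Com :=
  .seq (.block [.const 9 0]) <|
  .loop (.lt 9 4) <|
    .seq (.block [.add 24 9 7, .load 25 1 9, .load 25 0 25, .xconst 1 1, .xconst 2 1,
      .const 16 0]) <|
    .seq weightLoop <|
    .seq (.ite (.xeq 1 2) (.block []) (.block [.const 8 1])) <|
    .block [.add 9 9 6]

/-- The state during the comparison of the weights. -/
structure NormInv (p : Params) (G : ℕ → ℕ → ℂ) (W : ℕ) (m₀ m : Mem) : Prop where
  consts : Consts p m.v
  a : m.a = m₀.a
  t : m.t = m₀.t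
  sp : m.v 10 = m₀.v 10
  fst : m.v 9 = W
  flag : 0 < m.v 8 ↔ ∃ V < W, nweight p G V ≠ nweight p G (p.tin (V / p.s))

theorem NormInv.congr {p : Params} {G : ℕ → ℕ → ℂ} {W : ℕ} {m₀ m m' : Mem}
    (h : NormInv p G W m₀ m) (hv : ∀ k ≤ 10, m'.v k = m.v k) (ha : m'.a = m.a) (ht : m'.t = m.t) :
    NormInv p G W m₀ m' where
  consts := h.consts.congr fun k hk => hv k (by omega)
  a := ha.trans h.a
  t := ht.trans h.t
  sp := (hv 10 le_rfl).trans h.sp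
  fst := (hv 9 (by norm_num)).trans h.fst
  flag := by rw [hv 8 (by norm_num), h.flag]

theorem iterate_tin_lt {p : Params} {W : ℕ} (hW : W < p.w) (j : ℕ) : (p.tin)^[j] W < p.w := by
  cases j with
  | zero => exact hW
  | succ j =>
    rw [Function.iterate_succ_apply']
    exact p.tin_lt _

/-- Successive shifts are lookups in the table of `tin`, and their factors are the stored norms. -/
theorem spec_weightLoop {p : Params} {G : ℕ → ℕ → ℂ} {W V V' : ℕ} {m₀ m : Mem}
    (hn : ∀ i < p.w, m₀.t ((p.n + i : ℕ) : ℤ) = G i i) (htab : Tables p p.w m₀.a)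
    (h : NormInv p G W m₀ m) (hV : V < p.w) (hV' : V' < p.w) (h24 : m.v 24 = V)
    (h25 : m.v 25 = V') (h16 : m.v 16 = 0) (h1 : m.x 1 = 1) (h2 : m.x 2 = 1) :
    Spec weightLoop m (p.r * 10 + 1) fun m' => NormInv p G W m₀ m' ∧
      m'.x 1 = nweight p G V ∧ m'.x 2 = nweight p G V' := by
  refine (Spec.loop (T := 9) (i := p.r) (Inv := fun k m' => ∃ b : ℕ, b + k = p.r ∧
    NormInv p G W m₀ m' ∧ m'.v 16 = b ∧ m'.v 24 = ((p.tin)^[b] V : ℕ) ∧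
    m'.v 25 = ((p.tin)^[b] V' : ℕ) ∧
    m'.x 1 = ∏ j ∈ Finset.range b, G ((p.tin)^[j] V) ((p.tin)^[j] V) ∧
    m'.x 2 = ∏ j ∈ Finset.range b, G ((p.tin)^[j] V') ((p.tin)^[j] V')) ?_
    ⟨0, by simp, h, by simp [h16], by simp [h24], by simp [h25], by simp [h1],
      by simp [h2]⟩).mono le_rfl ?_
  · rintro k m₁ ⟨b, hbk, h₁, h16, h24, h25, hx1, hx2⟩ hlt
    have hc := h₁.consts
    simp only [Cond.Holds, h16, hc.r, Nat.cast_lt] at hlt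
    have l1 := iterate_tin_lt hV b
    have l2 := iterate_tin_lt hV' b
    have n1 := hn _ l1
    have n2 := hn _ l2
    have t1 := (htab _ l1).1
    have t2 := (htab _ l2).1
    rw [Nat.cast_add, ← h₁.t] at n1 n2
    rw [← h₁.a, ← Function.iterate_succ_apply' p.tin] at t1 t2
    refine ⟨k - 1, by omega, ?_⟩
    -- Only variable `13` and the complex variables change here. The value `y` left in variable `13`
    -- is irrelevant.
    refine Spec.seq_le 3 6 (fun m' => ∃ y, m' = ⟨Function.update m₁.v 13 y, m₁.a, m'.x, m₁.t⟩ ∧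
      m'.x 1 = ∏ j ∈ Finset.range (b + 1), G ((p.tin)^[j] V) ((p.tin)^[j] V) ∧
      m'.x 2 = ∏ j ∈ Finset.range b, G ((p.tin)^[j] V') ((p.tin)^[j] V'))
      (Spec.block (by simp) ?_ ⟨_, rfl, ?_, ?_⟩) ?_ (by norm_num)
    · simp only [SafeAll, Op.Safe, Op.eff, Function.update_self, hc.n, h24]
      simp
      positivity
    · rw [Finset.prod_range_succ]
      simp [Op.eff, h24, hx1, hc.n, n1]
    · simp [Op.eff, hx2]
    rintro ⟨v₂, a₂, x₂, t₂⟩ ⟨y, e, hx1, hx2⟩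
    obtain ⟨rfl, rfl, -, rfl⟩ := Mem.mk.inj e
    simp only at hx1 hx2
    clear e
    refine Spec.seq_le 3 3 (fun m' => ∃ y, m' = ⟨Function.update m₁.v 13 y, m₁.a, m'.x, m₁.t⟩ ∧
      m'.x 1 = ∏ j ∈ Finset.range (b + 1), G ((p.tin)^[j] V) ((p.tin)^[j] V) ∧
      m'.x 2 = ∏ j ∈ Finset.range (b + 1), G ((p.tin)^[j] V') ((p.tin)^[j] V'))
      (Spec.block (by simp) ?_ ⟨p.n + (p.tin)^[b] V', ?_, ?_, ?_⟩) ?_ (by norm_num)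
    · simp [SafeAll, Op.Safe, Op.eff, hc.n, h25]
      positivity
    · simp [Op.eff, hc.n, h25]
    · simp [Op.eff, hx1]
    · rw [Finset.prod_range_succ]
      simp [Op.eff, h25, hx2, hc.n, n2]
    rintro ⟨v₂, a₂, x₂, t₂⟩ ⟨y, e, hx1, hx2⟩
    obtain ⟨rfl, rfl, -, rfl⟩ := Mem.mk.inj e
    simp only at hx1 hx2
    clear e
    refine Spec.block (by simp) (by simp [SafeAll, Op.Safe]) ⟨b + 1, by omega, ?_⟩
    simp only [List.foldl_cons, List.foldl_nil, Op.eff]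
    refine ⟨h₁.congr ?_ rfl rfl, ?_, ?_, ?_, hx1, hx2⟩
    · intro k hk
      simp only [Function.update_apply]
      split_ifs <;> omega
    · simp [h16, hc.one]
    · simp [h24, t1]
    · simp [h25, t2]
  · rintro m' ⟨⟨k, b, hbk, h', h16, -, -, hx1, hx2⟩, hn⟩
    simp only [Cond.Holds, h16, h'.consts.r, Nat.cast_lt] at hn
    obtain rfl : b = p.r := by omega
    exact ⟨h', hx1, hx2⟩

theorem spec_normLoop {p : Params} {G : ℕ → ℕ → ℂ} {m : Mem} (hc : Consts p m.v)
    (h8 : m.v 8 = 0) (hn : ∀ i < p.w, m.t ((p.n + i : ℕ) : ℤ) = G i i)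
    (htab : Tables p p.w m.a) :
    Spec normLoop m (p.w * (p.r * 10 + 11) + 2) fun m' => NormInv p G p.w m m' := by
  refine Spec.seq_le 1 (p.w * (p.r * 10 + 11) + 1) (fun m' => NormInv p G 0 m m')
    (Spec.block (by simp) (by simp [SafeAll, Op.Safe]) ?_) ?_ (by omega)
  · simp only [List.foldl_cons, List.foldl_nil, Op.eff]
    refine ⟨hc.congr ?_, rfl, rfl, ?_, ?_, ?_⟩
    · intro k hk
      simp only [Function.update_apply]
      split_ifs <;> omega
    · simp
    · simp
    · simp [h8]
  rintro m₁ h₁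
  refine (Spec.loop (T := p.r * 10 + 10) (i := p.w) (Inv := fun k m' => ∃ W : ℕ,
    W + k = p.w ∧ NormInv p G W m m') ?_ ⟨0, by simp, h₁⟩).mono le_rfl ?_
  · rintro k m₂ ⟨W, hWk, h₂⟩ hW
    simp only [Cond.Holds, h₂.fst, h₂.consts.w, Nat.cast_lt] at hW
    have hWs : W / p.s < p.w := (Nat.div_le_self _ _).trans_lt hW
    have hV' := p.tin_lt (W / p.s)
    refine ⟨k - 1, by omega, ?_⟩
    refine Spec.seq_le 6 (p.r * 10 + 4) (fun m' => NormInv p G W m m' ∧ m'.v 24 = W ∧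
      m'.v 25 = p.tin (W / p.s) ∧ m'.v 16 = 0 ∧ m'.x 1 = 1 ∧ m'.x 2 = 1)
      (Spec.block (by simp) (by simp [SafeAll, Op.Safe]) ?_) ?_ (by omega)
    · have t1 := (htab W hW).2.1
      have t2 := (htab (W / p.s) hWs).1
      rw [← h₂.a] at t1 t2
      simp only [List.foldl_cons, List.foldl_nil, Op.eff]
      refine ⟨h₂.congr ?_ rfl rfl, ?_, ?_, ?_, ?_, ?_⟩
      · intro k hk
        simp only [Function.update_apply]
        split_ifs <;> omega
      · simp [h₂.fst, h₂.consts.zero]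
      · simp [h₂.fst, t1]
        exact t2
      · simp
      · simp
      · simp
    rintro m₃ ⟨h₃, h24, h25, h16, hx1, hx2⟩
    refine Spec.seq_le (p.r * 10 + 1) 3 _ (spec_weightLoop hn htab h₃ hW hV' h24 h25 h16 hx1 hx2)
      ?_ (by omega)
    rintro m₄ ⟨h₄, hx1, hx2⟩
    refine Spec.seq_le 2 1 (fun m' => Consts p m'.v ∧ m'.a = m.a ∧ m'.t = m.t ∧
      m'.v 10 = m.v 10 ∧ m'.v 9 = W ∧ (0 < m'.v 8 ↔ ∃ V < W + 1,
        nweight p G V ≠ nweight p G (p.tin (V / p.s)))) (Spec.ite (T := 1)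
      (fun hb => Spec.nil ?_) (fun hb => Spec.block (by simp) (by simp [SafeAll, Op.Safe]) ?_)) ?_
      le_rfl
    · simp only [Cond.Holds, hx1, hx2] at hb
      refine ⟨h₄.consts, h₄.a, h₄.t, h₄.sp, h₄.fst, h₄.flag.trans ⟨fun ⟨V, h1, h2⟩ =>
        ⟨V, by omega, h2⟩, fun ⟨V, h1, h2⟩ => ⟨V, lt_of_le_of_ne (by omega) ?_, h2⟩⟩⟩
      rintro rfl
      exact h2 hb
    · simp only [Cond.Holds, hx1, hx2] at hb
      simp only [List.foldl_cons, List.foldl_nil, Op.eff]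
      refine ⟨h₄.consts.congr ?_, h₄.a, h₄.t, ?_, ?_, ?_⟩
      · intro k hk
        simp only [Function.update_apply]
        split_ifs <;> omega
      · simp [h₄.sp]
      · simp [h₄.fst]
      · simp only [Function.update_self, zero_lt_one, true_iff]
        exact ⟨W, by omega, hb⟩
    rintro m₅ ⟨hc₅, ha, ht, hsp, h9, hflag⟩
    refine Spec.block (by simp) (by simp [SafeAll, Op.Safe]) ⟨W + 1, by omega, ?_⟩
    simp only [List.foldl_cons, List.foldl_nil, Op.eff]
    refine ⟨hc₅.congr ?_, ha, ht, ?_, ?_, ?_⟩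
    · intro k hk
      simp only [Function.update_apply]
      split_ifs <;> omega
    · simp [hsp]
    · simp [h9, hc₅.one]
    · simpa using hflag
  · rintro m' ⟨⟨k, W, hWk, h'⟩, hn⟩
    simp only [Cond.Holds, h'.fst, h'.consts.w, Nat.cast_lt] at hn
    obtain rfl : W = p.w := by omega
    exact h'

/-! ### The complete program -/

/-- The decision procedure for at least two states. -/
def work : Com :=
  .seq powers <| .seq tabulate <| .seq pairLoop <| .seq normLoop searchLoop

/-- The decision procedure, which leaves `1` in variable `8` if the automaton is not
well-formed. -/
def procedure : Com :=
  .seq (.block [.const 7 0, .const 6 1, .load 0 0 7, .load 1 1 7, .load 2 2 7, .const 8 0]) <|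
  -- A single state is treated separately: the size is then `1` whatever `r` is, so no loop over `r`
  -- would be affordable.
  .ite (.lt 6 0) work (.block [])

/-- The base nodes on the stack and the available inner nodes satisfy the invariant of the search.
Each of the two collections has at most `w²` elements, which gives the factor `2 * (w * w)`. -/
theorem spec_pairSearch {p : Params} {T : ℕ → ℂ} {m₀ m : Mem}
    (h₀ : PairInv p T (p.w * p.w) m₀) (h : NormInv p (gramOf p T) p.w m₀ m) :
    Spec searchLoop m (2 * (p.w * p.w) * (p.s * (p.s * 9 + 5) + 9) + 1) fun m' =>
      Consts p m'.v ∧ (0 < m'.v 8 ↔ BadNorm p (gramOf p T) ∨ BadPair p (gramOf p T)) := by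
  classical
  obtain ⟨L, h1, h2, h3, h4, h5⟩ := h₀.stack
  have hin : ∀ i j, i < p.w → j < p.w → i * p.w + j < p.w * p.w := fun i j hi hj => by
    have : (i + 1) * p.w ≤ p.w * p.w := Nat.mul_le_mul_right _ hi
    rw [Nat.succ_mul] at this
    omega
  set av := (Finset.range p.w ×ˢ Finset.range p.w).filter
    (fun x => InnerNode p (gramOf p T) x.1 x.2) with hav
  have hmem : ∀ i j, (i, j) ∈ av ↔ InnerNode p (gramOf p T) i j := fun i j => by
    rw [hav, Finset.mem_filter, Finset.mem_product, Finset.mem_range, Finset.mem_range]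
    exact ⟨fun h => h.2, fun h => ⟨⟨h.1.1, h.1.2.1⟩, h⟩⟩
  have hcard : av.card ≤ p.w * p.w := by
    refine (Finset.card_filter_le _ _).trans ?_
    simp
  refine (spec_searchLoop (L := L) (av := av) (G := gramOf p T)
    ⟨h.consts, h.a ▸ h₀.tables, h.sp.trans h1, h.a ▸ h2, fun i j hi hj => ?_⟩
    ⟨fun i j hm => ?_, fun i j hn he hm => ?_, fun i j hn hm => ?_, fun hb => ?_, fun hb => ?_⟩
    fun i j hm => ((hmem i j).1 hm).1).mono ?_ fun _ => id
  · rw [h.a, h₀.avail i j hi hj (hin i j hi hj)]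
    simp only [hmem]
  · exact NReach.base (h3 i j hm).1 (h3 i j hm).2
  · exact ((hmem i j).1 hm).2 he
  · have he : i % p.z = j % p.z := by
      by_contra he
      exact hm ((hmem i j).2 ⟨hn, he⟩)
    exact Or.inl (h4 i j ⟨hn, he⟩ (hin i j hn.1 hn.2.1))
  · exact Or.inl (h.flag.1 hb)
  · exact h.flag.2 hb
  · gcongr
    omega

theorem spec_work {p : Params} {T : ℕ → ℂ} {m : Mem} (h : Loaded p m.v)
    (ht : ∀ k < p.n, m.t (k : ℕ) = T k) : Spec work m (200 * p.n ^ 2) fun m' =>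
      Consts p m'.v ∧ (0 < m'.v 8 ↔ BadNorm p (gramOf p T) ∨ BadPair p (gramOf p T)) := by
  -- The search contributes the leading term `18 * (s * w) ^ 2`. The other terms are absorbed
  -- generously using `r ≤ w` and `2 ≤ s`.
  have bound : (p.r * (p.s * 3 + 8) + 5) + ((p.w * 13 + 6) +
      ((p.w * (p.w * (p.s * 9 + 16) + 7) + 5) + ((p.w * (p.r * 10 + 11) + 2) +
      (2 * (p.w * p.w) * (p.s * (p.s * 9 + 5) + 9) + 1)))) ≤ 200 * p.n ^ 2 := by
    have hr := p.r_le_w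
    have hs := p.two_le_s
    have hw := p.w_pos
    rw [p.n_eq]
    set s := p.s
    set w := p.w
    set r := p.r
    have a1 : 1 ≤ w * w := Nat.mul_pos hw hw
    have a2 : w ≤ w * w := Nat.le_mul_of_pos_left _ hw
    have a3 : w * r ≤ w * w := Nat.mul_le_mul_left _ hr
    have a4 : r * s ≤ w * w * s := Nat.mul_le_mul_right _ (hr.trans a2)
    have a5 : w * w * s * 2 ≤ w * w * s * s := Nat.mul_le_mul_left _ hs
    have a6 : w * w * 2 ≤ w * w * s := Nat.mul_le_mul_left _ hs
    have e : 200 * (s * w) ^ 2 = 200 * (w * w * s * s) := by ring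
    rw [e]
    nlinarith
  refine (Spec.seq (spec_powers h) fun m₁ h₁ => ?_).mono bound fun _ => id
  obtain ⟨hc₁, h8, t1⟩ := h₁
  refine Spec.seq (spec_tabulate hc₁ h8) fun m₂ h₂ => ?_
  obtain ⟨hc₂, h8, htab, t2⟩ := h₂
  refine Spec.seq (spec_pairLoop (T := T) hc₂ h8 htab fun k hk => ?_) fun m₃ h₃ => ?_
  · rw [t2, t1, ht k hk]
  refine Spec.seq (spec_normLoop (G := gramOf p T) h₃.consts h₃.flag (fun i hi => ?_) h₃.tables)
    fun m₄ h₄ => spec_pairSearch h₃ h₄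
  refine h₃.norms i hi ?_
  have : (i + 1) * p.w ≤ p.w * p.w := Nat.mul_le_mul_right _ hi
  rw [Nat.succ_mul] at this
  omega

/-- The machine program. -/
def program : Program :=
  procedure.code 0 ++ [.ijumpLE (reg 8) (reg 7) (procedure.len + 2), .halt false, .halt true]

/-- The structured view of a state. -/
def memOf (σ : State) : Mem where
  v k := σ.I (reg k)
  a j i := σ.I (8 * i + (j : ℕ))
  x k := σ.X (creg k)
  t := σ.X

theorem rel_memOf (σ : State) : Rel σ (memOf σ) :=
  ⟨fun _ => rfl, fun _ _ => rfl, fun _ => rfl, fun _ _ => rfl⟩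

/-- The compiled procedure falls through to a branch on the flag. The simulation costs a factor `6`
and the branch one more step. -/
theorem answersWithin_program {ints : List ℤ} {nums : List ℂ} {t : ℕ} {Q : Prop}
    (h : Spec procedure (memOf (initial ints nums)) t fun m' => m'.v 7 = 0 ∧ (0 < m'.v 8 ↔ ¬ Q)) :
    ∃ b : Bool, program.AnswersWithin ints nums (6 * t + 1) b ∧ (b = true ↔ Q) := by
  obtain ⟨k, hk, m', he, h7, h8⟩ := h
  have hcode : CodeAt program 0 (procedure.code 0 ++
      [.ijumpLE (reg 8) (reg 7) (procedure.len + 2), .halt false, .halt true]) :=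
    ⟨[], [], by simp [program], rfl⟩
  obtain ⟨σ, hrun, hσ, hpc⟩ := he.run (P := program) (σ := initial ints nums) hcode.left
    (rel_memOf _)
  have hend := hcode.right
  rw [Com.length_code] at hend
  have hpc' : σ.pc = 0 + procedure.len := hpc
  rw [← hpc'] at hend
  have hstep := Run.step hend.head
  simp only [Instr.run, State.branch, hσ.v, h7] at hstep
  obtain ⟨n, hn, hfin⟩ := hrun.trans hstep
  by_cases hb : m'.v 8 ≤ 0
  · refine ⟨true, ⟨n, by omega, ?_⟩, ?_⟩
    · rw [hfin]
      simp only [hb, if_true]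
      have := hend.tail.tail.head
      rw [hpc'] at this
      rw [zero_add] at this
      exact this
    · simp only [true_iff]
      by_contra hQ
      have := h8.2 hQ
      omega
  · refine ⟨false, ⟨n, by omega, ?_⟩, ?_⟩
    · rw [hfin]
      simp only [hb, if_false]
      exact hend.tail.head
    · simp only [Bool.false_eq_true, false_iff]
      exact h8.1 (not_le.1 hb)

end Decision

/-! ### Numbered words -/

namespace Decision

open AlgebraicRAM Window

/-- The lowest `m` digits in base `s` determine the residue modulo `s ^ m` and conversely, by
induction on `m`. All relations between words are translated to numbers through this equivalence. -/
theorem forall_digit_eq_iff {s a b m : ℕ} :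
    (∀ k < m, a / s ^ k % s = b / s ^ k % s) ↔ a % s ^ m = b % s ^ m := by
  induction m with
  | zero => simp [Nat.mod_one]
  | succ m ih =>
    constructor
    · intro h
      rw [Nat.mod_pow_succ, Nat.mod_pow_succ, ih.1 fun k hk => h k (by omega), h m (by omega)]
    · intro h k hk
      have hm : a % s ^ m = b % s ^ m := by
        have := congrArg (· % s ^ m) h
        simpa only [Nat.mod_mod_of_dvd _ (pow_dvd_pow s (Nat.le_succ m))] using this
      rcases Nat.lt_succ_iff_lt_or_eq.1 hk with hk | rfl
      · exact ih.2 hm k hk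
      · rw [Nat.mod_pow_succ, Nat.mod_pow_succ, hm, Nat.add_left_cancel_iff] at h
        rcases Nat.eq_zero_or_pos (s ^ k) with h0 | h0
        · obtain ⟨rfl, -⟩ := pow_eq_zero_iff'.1 h0
          simp [h0]
        · exact Nat.eq_of_mul_eq_mul_left h0 h

section

variable {S : Type*} [Fintype S] (e : S ≃ Fin (Fintype.card S)) (A : LQCA S)
  (hS : 2 ≤ Fintype.card S)

/-- The parameters of an automaton. -/
def params : Params where
  s := Fintype.card S
  r := A.r
  q := e A.q
  two_le_s := hS
  one_le_r := A.one_le_r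
  q_lt := (e A.q).2

/-- The word with number `W`. -/
def word (W : ℕ) : Fin A.r → S := fun k =>
  e.symm ⟨W / Fintype.card S ^ (k : ℕ) % Fintype.card S, Nat.mod_lt _ (by omega)⟩

/-- The number of a word. -/
def number (w : Fin A.r → S) : ℕ := finFunctionFinEquiv fun k => e (w k)

/-- The entries of the table of `δ`. -/
noncomputable def entry (k : ℕ) : ℂ := (A.encodeTable e).getD k 0

variable {e A hS}

theorem word_eq_iff {W U : ℕ} {k l : Fin A.r} :
    word e A hS W k = word e A hS U l ↔ W / Fintype.card S ^ (k : ℕ) % Fintype.card S =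
      U / Fintype.card S ^ (l : ℕ) % Fintype.card S := by
  simp [word]

theorem number_lt (w : Fin A.r → S) : number e A w < (params e A hS).w := Fin.is_lt _

theorem word_number (w : Fin A.r → S) : word e A hS (number e A w) = w := by
  have h := (finFunctionFinEquiv (m := Fintype.card S) (n := A.r)).symm_apply_apply
    fun k => e (w k)
  funext k
  rw [← e.symm_apply_apply (w k), ← congrFun h k]
  rfl

theorem word_inj {W U : ℕ} (hW : W < (params e A hS).w) (hU : U < (params e A hS).w) :
    word e A hS W = word e A hS U ↔ W = U := by
  refine ⟨fun h => ?_, fun h => h ▸ rfl⟩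
  have := (forall_digit_eq_iff (s := Fintype.card S) (m := A.r) (a := W) (b := U)).1
    fun k hk => word_eq_iff.1 (congrFun h ⟨k, hk⟩)
  change W % (params e A hS).w = U % (params e A hS).w at this
  rwa [Nat.mod_eq_of_lt hW, Nat.mod_eq_of_lt hU] at this

/-- The first letter of a word is its lowest digit, so dropping the last letter is reduction modulo
`s ^ (r - 1)`, while dropping the first letter is division by `s`. -/
theorem initEq_word {W U : ℕ} : InitEq (word e A hS W) (word e A hS U) ↔
    W % (params e A hS).z = U % (params e A hS).z := by
  rw [Params.z, ← forall_digit_eq_iff]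
  exact ⟨fun h k hk => word_eq_iff.1 (h ⟨k, Nat.lt_of_lt_pred hk⟩ (Nat.add_lt_of_lt_sub hk)),
    fun h k hk => word_eq_iff.2 (h k (Nat.lt_sub_of_add_lt hk))⟩

theorem div_digit (W k s : ℕ) : W / s / s ^ k % s = W / s ^ (k + 1) % s := by
  rw [Nat.div_div_eq_div_mul, pow_succ']

theorem follows_word {W U : ℕ} (hW : W < (params e A hS).w) :
    Follows (word e A hS W) (word e A hS U) ↔
      U % (params e A hS).z = W / (params e A hS).s := by
  conv_rhs => rw [← Nat.mod_eq_of_lt ((params e A hS).div_lt hW)]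
  rw [Params.z, ← forall_digit_eq_iff]
  refine ⟨fun h k hk => ?_, fun h k hk => ?_⟩
  · rw [div_digit]
    exact word_eq_iff.1 (h k (Nat.add_lt_of_lt_sub hk))
  · refine word_eq_iff.2 ?_
    have := h k (Nat.lt_sub_of_add_lt hk)
    rw [div_digit] at this
    exact this

theorem tailEq_word {W U : ℕ} (hW : W < (params e A hS).w) (hU : U < (params e A hS).w) :
    TailEq (word e A hS W) (word e A hS U) ↔
      W / (params e A hS).s = U / (params e A hS).s := by
  conv_rhs => rw [← Nat.mod_eq_of_lt ((params e A hS).div_lt hW),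
    ← Nat.mod_eq_of_lt ((params e A hS).div_lt hU)]
  rw [Params.z, ← forall_digit_eq_iff]
  refine ⟨fun h k hk => ?_, fun h k hk => ?_⟩
  · rw [div_digit, div_digit]
    exact word_eq_iff.1 (h ⟨k + 1, Nat.add_lt_of_lt_sub hk⟩ (Nat.succ_pos k))
  · obtain ⟨l, hl⟩ := Nat.exists_eq_succ_of_ne_zero hk.ne'
    have hlr : l + 1 < A.r := by
      have := k.2
      omega
    have := h l (Nat.lt_sub_of_add_lt hlr)
    rw [div_digit, div_digit] at this
    refine word_eq_iff.2 ?_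
    rw [hl]
    exact this

theorem word_tin (W : ℕ) :
    word e A hS ((params e A hS).tin W) = shiftIn A.q (word e A hS W) := by
  have hs := (params e A hS).s_pos
  funext ⟨k, hk⟩
  cases k with
  | zero =>
    simp only [shiftIn, if_true]
    rw [← e.symm_apply_apply A.q, word]
    congr 1
    ext
    simp only [pow_zero, Nat.div_one]
    change (((e A.q : ℕ) + Fintype.card S * _) % Fintype.card S) = _
    rw [Nat.add_mul_mod_self_left, Nat.mod_eq_of_lt (e A.q).2]
  | succ l =>
    have e1 : (params e A hS).tin W / (params e A hS).s = W % (params e A hS).z := by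
      rw [Params.tin, Nat.add_mul_div_left _ _ hs, Nat.div_eq_of_lt (params e A hS).q_lt, zero_add]
    have e2 := (forall_digit_eq_iff (s := Fintype.card S) (m := A.r - 1)
      (a := W % (params e A hS).z) (b := W)).2 (Nat.mod_mod _ _) l (Nat.lt_sub_of_add_lt hk)
    rw [← e1] at e2
    simp only [shiftIn, Nat.succ_ne_zero, if_false]
    refine word_eq_iff.2 ?_
    simp only [Nat.add_sub_cancel]
    rw [← e2]
    exact (div_digit _ _ _).symm

theorem word_tin_div (W : ℕ) :
    word e A hS ((params e A hS).tin (W / (params e A hS).s)) =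
      setHead A.q (word e A hS W) := by
  rw [word_tin]
  funext ⟨k, hk⟩
  cases k with
  | zero => rfl
  | succ l =>
    simp only [shiftIn, setHead, Nat.succ_ne_zero, if_false]
    exact word_eq_iff.2 (div_digit _ _ _)

/-- In the input table the new state is the lowest digit of the position, and the remaining digits
spell the word `W`. -/
theorem entry_eq {W y : ℕ} (hW : W < (params e A hS).w) (hy : y < Fintype.card S) :
    entry e A (Fintype.card S * W + y) = A.δ (word e A hS W) (e.symm ⟨y, hy⟩) := by
  have hlt : Fintype.card S * W + y < Fintype.card S ^ (A.r + 1) :=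
    table_index_lt (p := params e A hS) hW hy
  have hs : 0 < Fintype.card S := by omega
  have h1 : (fun i : Fin A.r => e.symm ((finFunctionFinEquiv (n := A.r + 1)).symm
      ⟨Fintype.card S * W + y, hlt⟩ i.succ)) = word e A hS W := by
    funext i
    refine congrArg e.symm (Fin.ext ?_)
    change (Fintype.card S * W + y) / Fintype.card S ^ ((i : ℕ) + 1) % Fintype.card S = _
    rw [← div_digit, Nat.mul_add_div hs, Nat.div_eq_of_lt hy, add_zero]
  have h2 : (finFunctionFinEquiv (n := A.r + 1)).symm ⟨Fintype.card S * W + y, hlt⟩ 0 =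
      ⟨y, hy⟩ := by
    refine Fin.ext ?_
    change (Fintype.card S * W + y) / Fintype.card S ^ 0 % Fintype.card S = y
    rw [pow_zero, Nat.div_one, Nat.mul_add_mod, Nat.mod_eq_of_lt hy]
  rw [entry, LQCA.encodeTable, List.getD_eq_getElem _ _ (by simpa using hlt), List.getElem_ofFn,
    ← h1, ← h2]

theorem gramOf_entry {W U : ℕ} (hW : W < (params e A hS).w) (hU : U < (params e A hS).w) :
    gramOf (params e A hS) (entry e A) W U = A.gram (word e A hS W) (word e A hS U) := by
  change ∑ y ∈ Finset.range (Fintype.card S), _ = _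
  rw [Finset.sum_range, LQCA.gram, ← e.symm.sum_comp]
  refine Finset.sum_congr rfl fun y _ => ?_
  have a := entry_eq (e := e) (A := A) (hS := hS) hW y.2
  have b := entry_eq (e := e) (A := A) (hS := hS) hU y.2
  rw [Fin.eta] at a b
  rw [a.symm, b.symm]
  rfl

theorem nweight_entry {W : ℕ} (hW : W < (params e A hS).w) :
    nweight (params e A hS) (gramOf (params e A hS) (entry e A)) W =
      weight A.q (fun w => A.gram w w) (word e A hS W) := by
  refine Finset.prod_congr rfl fun j _ => ?_
  have h : ∀ j, word e A hS ((params e A hS).tin^[j] W) =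
      (shiftIn A.q)^[j] (word e A hS W) := by
    intro j
    induction j with
    | zero => rfl
    | succ j ih => rw [Function.iterate_succ_apply', Function.iterate_succ_apply', word_tin, ih]
  rw [gramOf_entry (iterate_tin_lt hW j) (iterate_tin_lt hW j), h]

theorem badNorm_iff : BadNorm (params e A hS) (gramOf (params e A hS) (entry e A)) ↔
    ¬ ∀ w, weight A.q (fun w => A.gram w w) w =
      weight A.q (fun w => A.gram w w) (setHead A.q w) := by
  rw [not_forall]
  constructor
  · rintro ⟨W, hW, h⟩
    rw [nweight_entry hW, nweight_entry (Params.tin_lt _ _), word_tin_div] at h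
    exact ⟨_, h⟩
  · rintro ⟨w, h⟩
    have hW := number_lt (e := e) (hS := hS) w
    refine ⟨number e A w, hW, ?_⟩
    rw [nweight_entry hW, nweight_entry (Params.tin_lt _ _), word_tin_div, word_number]
    exact h

theorem node_iff {W U : ℕ} (hW : W < (params e A hS).w) (hU : U < (params e A hS).w) :
    Node (params e A hS) (gramOf (params e A hS) (entry e A)) W U ↔
      word e A hS W ≠ word e A hS U ∧ A.gram (word e A hS W) (word e A hS U) ≠ 0 := by
  rw [Node, gramOf_entry hW hU, ne_eq (word e A hS W), word_inj hW hU]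
  exact ⟨fun h => h.2.2, fun h => ⟨hW, hU, h⟩⟩

theorem NReach.reach {W U : ℕ}
    (h : NReach (params e A hS) (gramOf (params e A hS) (entry e A)) W U) :
    Reach A.gram (word e A hS W) (word e A hS U) := by
  induction h with
  | base hn hz =>
    obtain ⟨h1, h2⟩ := (node_iff hn.1 hn.2.1).1 hn
    exact Reach.base h1 h2 (initEq_word.2 hz)
  | step hR hn hz hz' ih =>
    obtain ⟨h1, h2⟩ := (node_iff hn.1 hn.2.1).1 hn
    exact ih.step h1 h2 ((follows_word hR.node.1).2 hz) ((follows_word hR.node.2.1).2 hz')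

theorem nreach_number {w u : Fin A.r → S} (h : Reach A.gram w u) :
    NReach (params e A hS) (gramOf (params e A hS) (entry e A)) (number e A w)
      (number e A u) := by
  have hnode : ∀ w u : Fin A.r → S, w ≠ u → A.gram w u ≠ 0 →
      Node (params e A hS) (gramOf (params e A hS) (entry e A)) (number e A w) (number e A u) :=
    fun w u h1 h2 => (node_iff (number_lt w) (number_lt u)).2 (by
      rw [word_number, word_number]
      exact ⟨h1, h2⟩)
  induction h with
  | base h1 h2 h3 =>
    refine NReach.base (hnode _ _ h1 h2) (initEq_word.1 ?_)
    rwa [word_number, word_number]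
  | step _ h1 h2 h3 h4 ih =>
    refine NReach.step ih (hnode _ _ h1 h2) ((follows_word (number_lt _)).1 ?_)
      ((follows_word (number_lt _)).1 ?_) <;> rwa [word_number, word_number]

theorem badPair_iff : BadPair (params e A hS) (gramOf (params e A hS) (entry e A)) ↔
    ∃ w w', Reach A.gram w w' ∧ TailEq w w' := by
  constructor
  · rintro ⟨W, U, h1, h2⟩
    exact ⟨_, _, h1.reach, (tailEq_word h1.node.1 h1.node.2.1).2 h2⟩
  · rintro ⟨w, u, h1, h2⟩
    refine ⟨_, _, nreach_number h1, (tailEq_word (number_lt w) (number_lt u)).1 ?_⟩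
    rwa [word_number, word_number]

theorem not_wellFormed_iff (h : A.IsSimple) : ¬ A.WellFormed ↔
    BadNorm (params e A hS) (gramOf (params e A hS) (entry e A)) ∨
      BadPair (params e A hS) (gramOf (params e A hS) (entry e A)) := by
  rw [h.wellFormed_iff, badNorm_iff, badPair_iff]
  rw [not_and_or, not_not]

end

/-- With one state there is only one window, so neither obstruction can occur. -/
theorem wellFormed_of_subsingleton {S : Type*} [Fintype S] [Subsingleton S] {A : LQCA S}
    (h : A.IsSimple) : A.WellFormed := by
  refine h.wellFormed_iff.2 ⟨fun w => by rw [Subsingleton.elim (setHead A.q w) w], ?_⟩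
  rintro ⟨w, w', hR, -⟩
  exact hR.ne (Subsingleton.elim _ _)

theorem spec_procedure {S : Type*} [Fintype S] (e : S ≃ Fin (Fintype.card S)) {A : LQCA S}
    (h : A.IsSimple) :
    Spec procedure (memOf (initial (A.encodeInts e) (A.encodeTable e))) (7 + 200 * A.size ^ 2)
      fun m' => m'.v 7 = 0 ∧ (0 < m'.v 8 ↔ ¬ A.WellFormed) := by
  set m := memOf (initial (A.encodeInts e) (A.encodeTable e)) with hm
  -- The first three input integers lie in the cells `0`, `1`, `2`, which are the entries at index
  -- `0` of the arrays `0`, `1`, `2`.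
  have m0 : m.a 0 0 = Fintype.card S := rfl
  have m1 : m.a 1 0 = A.r := rfl
  have m2 : m.a 2 0 = (e A.q : ℕ) := rfl
  refine Spec.seq_le 6 (1 + 200 * A.size ^ 2) (fun m' => m'.v 0 = Fintype.card S ∧ m'.v 1 = A.r ∧
    m'.v 2 = (e A.q : ℕ) ∧ m'.v 6 = 1 ∧ m'.v 7 = 0 ∧ m'.v 8 = 0 ∧ m'.t = m.t)
    (Spec.block (by simp) (by simp [SafeAll, Op.Safe]) ?_) ?_ (by omega)
  · simp [Op.eff, m0, m1, m2]
  rintro m' ⟨h0, h1, h2, h6, h7, h8, ht⟩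
  refine (Spec.ite (T := 200 * A.size ^ 2) (fun hb => ?_) (fun hb => Spec.nil ?_)).mono
    (by omega) fun _ => id
  · simp only [Cond.Holds, h6, h0] at hb
    have hS : 2 ≤ Fintype.card S := by omega
    refine (spec_work (p := params e A hS) (T := entry e A) ⟨h0, h1, h2, h6, h7, h8⟩
      fun k _ => ?_).mono le_rfl fun m'' hw => ⟨hw.1.zero, hw.2.trans (not_wellFormed_iff h).symm⟩
    rw [ht]
    simp [hm, memOf, initial, memoryOf, entry]
  · simp only [Cond.Holds, h6, h0] at hb
    have : Subsingleton S := Fintype.card_le_one_iff_subsingleton.1 (by omega)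
    exact ⟨h7, by simp [h8, wellFormed_of_subsingleton h]⟩

end Decision

theorem theorem2 :
    ∃ (P : AlgebraicRAM.Program) (C : ℕ),
      ∀ (S : Type*) [Fintype S] (e : S ≃ Fin (Fintype.card S)) (A : LQCA S), A.IsSimple →
        ∃ b : Bool,
          AlgebraicRAM.Program.AnswersWithin P (A.encodeInts e) (A.encodeTable e)
            (C * A.size ^ 2) b ∧
          (b = true ↔ A.WellFormed) := by
  -- The time is `6 * (7 + 200 * n ^ 2) + 1 = 43 + 1200 * n ^ 2`, and `43 ≤ 43 * n ^ 2` because `n`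
  -- is positive.
  refine ⟨Decision.program, 1243, fun S _ e A h => ?_⟩
  obtain ⟨b, ⟨k, hk, hb⟩, hiff⟩ := Decision.answersWithin_program (Decision.spec_procedure e h)
  refine ⟨b, ⟨k, hk.trans ?_, hb⟩, hiff⟩
  have hpos : 0 < A.size ^ 2 := pow_pos (pow_pos (Fintype.card_pos_iff.2 ⟨A.q⟩) _) _
  omega
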